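/- **Setting.** Let $N\in\mathbb N$, $0<m\le m_c:=\frac{N-2}{N+2}$ (so $N\ge 3$), $\nu,L>0$, $p>\frac{N+2}{2}$ and $r\ge 1$. Write $\lambda_s:=N(m-1)+2s$, and $u^{\langle m\rangle}:=|u|^{m-1}u$ (equal to $0$ where $u=0$) for $u\in\mathbb R^k$. For an open bounded set $\Omega\subset\mathbb R^N$ and $T>0$ let $\Omega_T:=\Omega\times(0,T]$. Consider the system $$\partial_t u-\operatorname{div}\boldsymbol A(x,t,u,Du^{\langle m\rangle})=\operatorname{div}F\quad\text{in }\Omega_T,$$ where $\boldsymbol A:\Omega_T\times\mathbb R^k\times\mathbb R^{kN}\to\mathbb R^{kN}$ is a Carathéodory vector field such that, for a.e. $(x,t)\in\Omega_T$ and all $(u,\xi)\in\mathbb R^k\times\mathbb R^{kN}$, $$\boldsymbol A(x,t,u,\xi)\cdot\xi\ge\nu|\xi|^2,\qquad |\boldsymbol A(x,t,u,\xi)|\le L|\xi|,\qquad \sum_{\alpha=1}^N\big(\boldsymbol A_\alpha(x,t,u,\xi)\cdot u^{\langle m\rangle}\big)\big(\xi_\alpha\cdot u^{\langle m\rangle}\big)\ge0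 .$$ A local weak solution is a function $u\in C^0((0,T);L^{1+m}_{\rm loc}(\Omega,\mathbb R^k))$ with $u^{\langle m\rangle}\in L^2_{\rm loc}(0,T;W^{1,2}_{\rm loc}(\Omega,\mathbb R^k))$ such that $$\iint_{\Omega_T}\big[u\cdot\partial_t\varphi-\boldsymbol A(x,t,u,Du^{\langle m\rangle})\cdot D\varphi\big]\,dx\,dt=\iint_{\Omega_T}F\cdot D\varphi\,dx\,dt\qquad\text{for all }\varphi\in C_0^\infty(\Omega\times(0,T),\mathbb R^k).$$ For $z_o=(x_o,t_o)$ let $Q_{R,S}(z_o):=B_R(x_o)\times(t_o-S,t_o]$. **Proposition (quantitative $L^\infty$-estimate).** Let $N,m,\nu,L,p,r$ be as above with $\lambda_r>0$. Then there is a constant $C=C(N,m,\nu,L,p,r)>0$ with the following property. Let $k$, $\Omega$, $T$, $\boldsymbol A$ be as above, let $F\in L^{2p}_{\rm loc}(\Omega_T,\mathbb R^{kN})$, and let $u$ be a local weak solution that is locally bounded in $\Omega_T$. Then for all cylinders $Q_{\rho,\vartheta}=Q_{\rho,\vartheta}(z_o)$, $\rho,\vartheta>0$, whose closure is contained in $\Omega_T$,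 and all $\sigma\in[\tfrac12,1)$, $$\operatorname*{ess\,sup}_{Q_{\sigma\rho,\sigma\vartheta}(z_o)}|u|\le\max\Bigg\{\bigg[\frac{C}{(1-\sigma)^{N+2}}\Big(\frac{\rho^2}{\vartheta}\Big)^{\frac N2}\frac{1}{|Q_{\rho,\vartheta}|}\iint_{Q_{\rho,\vartheta}}|u|^r\,dx\,dt\bigg]^{\frac{2}{\lambda_r}},\ \bigg[\Big(\frac{\vartheta}{\rho^2}\Big)^{p-\frac N2}\frac{1}{|Q_{\rho,\vartheta}|}\iint_{Q_{\rho,\vartheta}}|\rho F|^{2p}\,dx\,dt\bigg]^{\frac{2}{\lambda_{p(1+m)}}},\ \Big(\frac{\vartheta}{\rho^2}\Big)^{\frac1{1-m}}\Bigg\}.$$ -/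

import Mathlib

open MeasureTheory Set Filter Topology
open scoped ENNReal ContDiff

noncomputable section

namespace PorousMedium

/-- `ℝᴺ` with the Euclidean norm. -/
abbrev Space (N : ℕ) : Type := EuclideanSpace ℝ (Fin N)

/-- Space-time `ℝᴺ × ℝ`; a point is `z = (x, t)`. -/
abbrev SpaceTime (N : ℕ) : Type := Space N × ℝ

/-- `ℝ^{kN}`, written as `ξ = (ξ_1, …, ξ_N)` with `ξ_α ∈ ℝᵏ`, with its Euclidean (Frobenius)
norm and inner product. -/
abbrev GradSpace (N k : ℕ) : Type := PiLp 2 (fun _ : Fin N => Space k)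

/-- The power `|v|^{m-1} v` of a vector; it is `0` for `v = 0`. -/
def vecPow {k : ℕ} (m : ℝ) (v : Space k) : Space k := ‖v‖ ^ (m - 1) • v

/-- The scaling exponent `λ_r = N (m - 1) + 2 r`. -/
def lam (N : ℕ) (m r : ℝ) : ℝ := N * (m - 1) + 2 * r

/-- `Ω_T = Ω × (0, T]`. -/
def domain {N : ℕ} (Ω : Set (Space N)) (T : ℝ) : Set (SpaceTime N) := Ω ×ˢ Ioc 0 T

/-- The backward cylinder `Q_{R,S}(x_o, t_o) = B_R(x_o) × (t_o - S, t_o]`. -/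
def cylinder {N : ℕ} (z : SpaceTime N) (R S : ℝ) : Set (SpaceTime N) :=
  Metric.ball z.1 R ×ˢ Ioc (z.2 - S) z.2

/-- `f ∈ L^q_loc(S)`: `f` is in `L^q` on all compact subsets of `S`. -/
def MemLpLocOn {N : ℕ} {Y : Type*} [NormedAddCommGroup Y] (f : SpaceTime N → Y) (q : ℝ≥0∞)
    (S : Set (SpaceTime N)) : Prop :=
  ∀ K ⊆ S, IsCompact K → MemLp f q (volume.restrict K)

/-- `f` is (essentially) bounded on all compact subsets of `S`. -/
def LocallyBoundedOn {N k : ℕ} (f : SpaceTime N → Space k) (S : Set (SpaceTime N)) : Prop :=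
  ∀ K ⊆ S, IsCompact K → ∃ M : ℝ, ∀ᵐ z ∂(volume.restrict K), ‖f z‖ ≤ M

/-- Carathéodory vector field on `S`: measurable in `(x, t)`, continuous in `(u, ξ)`. -/
structure IsCaratheodory {N k : ℕ} (S : Set (SpaceTime N))
    (A : SpaceTime N → Space k → GradSpace N k → GradSpace N k) : Prop where
  measurable : ∀ v ξ, AEStronglyMeasurable (fun z => A z v ξ) (volume.restrict S)
  continuous : ∀ᵐ z ∂(volume.restrict S),
    Continuous (fun y : Space k × GradSpace N k => A z y.1 y.2)

/-- Ellipticity, linear growth and the diagonal-structure condition for the vector field. -/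
def GrowthConditions {N k : ℕ} (m ν L : ℝ) (S : Set (SpaceTime N))
    (A : SpaceTime N → Space k → GradSpace N k → GradSpace N k) : Prop :=
  ∀ᵐ z ∂(volume.restrict S), ∀ (v : Space k) (ξ : GradSpace N k),
    ν * ‖ξ‖ ^ 2 ≤ inner ℝ (A z v ξ) ξ ∧
    ‖A z v ξ‖ ≤ L * ‖ξ‖ ∧
    0 ≤ ∑ α : Fin N, inner ℝ (A z v ξ α) (vecPow m v) * inner ℝ (ξ α) (vecPow m v)

/-- `g` is the weak gradient of `w` in the open set `Ω`:
`∫ ∂_α η w dx = - ∫ η g_α dx` for all scalar `η ∈ C_0^∞(Ω)`. -/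
structure HasWeakGradientOn {N k : ℕ} (Ω : Set (Space N)) (w : Space N → Space k)
    (g : Space N → GradSpace N k) : Prop where
  locallyIntegrable : LocallyIntegrableOn w Ω
  locallyIntegrable_grad : LocallyIntegrableOn g Ω
  integral_eq : ∀ η : Space N → ℝ, ContDiff ℝ ∞ η → HasCompactSupport η → tsupport η ⊆ Ω →
    ∀ α : Fin N,
      ∫ x in Ω, (fderiv ℝ η x (EuclideanSpace.single α 1)) • w x = -∫ x in Ω, η x • g x α

/-- The classical time derivative `∂_t φ`. -/
def timeDeriv {N k : ℕ} (φ : SpaceTime N → Space k) (z : SpaceTime N) : Space k :=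
  deriv (fun s => φ (z.1, s)) z.2

/-- The classical spatial gradient `Dφ = (∂_{x_1} φ, …, ∂_{x_N} φ)`. -/
def spaceGrad {N k : ℕ} (φ : SpaceTime N → Space k) (z : SpaceTime N) : GradSpace N k :=
  WithLp.toLp 2 (fun α : Fin N =>
    fderiv ℝ (fun x => φ (x, z.2)) z.1 (EuclideanSpace.single α 1))

/-- `u` is a local weak solution in `Ω_T` of
`∂_t u - div A(x, t, u, D(|u|^{m-1}u)) = div F`. Only the values on `Ω × (0, T)` matter. -/
structure IsLocalWeakSolution {N k : ℕ} (m : ℝ) (Ω : Set (Space N)) (T : ℝ)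
    (A : SpaceTime N → Space k → GradSpace N k → GradSpace N k)
    (F : SpaceTime N → GradSpace N k) (u : SpaceTime N → Space k) : Prop where
  aestronglyMeasurable : AEStronglyMeasurable u (volume.restrict (Ω ×ˢ Ioo 0 T))
  /- `u ∈ C⁰((0,T); L^{1+m}_loc(Ω, ℝᵏ))` -/
  memLp_slice : ∀ K ⊆ Ω, IsCompact K → ∀ t ∈ Ioo 0 T,
    MemLp (fun x => u (x, t)) (ENNReal.ofReal (1 + m)) (volume.restrict K)
  continuous_slice : ∀ K ⊆ Ω, IsCompact K → ∀ t ∈ Ioo 0 T,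
    Tendsto (fun s => eLpNorm (fun x => u (x, s) - u (x, t)) (ENNReal.ofReal (1 + m))
      (volume.restrict K)) (𝓝 t) (𝓝 0)
  /- the right-hand side is square integrable -/
  memLp_rhs : MemLpLocOn F 2 (Ω ×ˢ Ioo 0 T)
  /- `|u|^{m-1}u ∈ L²_loc(0,T; W^{1,2}_loc(Ω, ℝᵏ))` -/
  memLp_pow : MemLpLocOn (fun z => vecPow m (u z)) 2 (Ω ×ˢ Ioo 0 T)
  /- the gradient `G = D(|u|^{m-1}u)` and the weak form of the system -/
  exists_grad : ∃ G : SpaceTime N → GradSpace N k,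
    MemLpLocOn G 2 (Ω ×ˢ Ioo 0 T) ∧
    (∀ᵐ t ∂(volume.restrict (Ioo 0 T)),
      HasWeakGradientOn Ω (fun x => vecPow m (u (x, t))) (fun x => G (x, t))) ∧
    ∀ φ : SpaceTime N → Space k, ContDiff ℝ ∞ φ → HasCompactSupport φ →
      tsupport φ ⊆ Ω ×ˢ Ioo 0 T →
      ∫ z in Ω ×ˢ Ioo 0 T,
          (inner ℝ (u z) (timeDeriv φ z) - inner ℝ (A z (u z) (G z)) (spaceGrad φ z)) =
        ∫ z in Ω ×ˢ Ioo 0 T, inner ℝ (F z) (spaceGrad φ z)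

end PorousMedium

end

open MeasureTheory Set Filter Topology
open scoped ENNReal ContDiff

noncomputable section

/-! The proof is a De Giorgi iteration on the superlevel sets of |u|, run up to the number κ that is
the right-hand side of the claim itself. Local boundedness only makes the integrals finite; the
bound on u enters no constant.

Energy. Put w = |u|^{m-1}u and test the system with ψ g(w), where g(w) = χ(|w|²)² |w|^{2b} w, b =
(r-1-m)/(2m), and χ vanishes below a level. As a function of u this field is the gradient of a
convex radial potential (`radialPotential_convex`), so the time term is formally the time derivative
of the potential. In the product with the flux, differentiating the scalar factor of g produces the
diagonal sum with a nonnegative coefficient, which is dropped; this is how a sup bound becomes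
possible for a system. Since u has no weak time derivative, `IsDistribSolution.energy_le` works with
time shifts and needs only convexity of the potential. The outcome is
`LocalSolution.energy_inequality`: it controls the truncated gradient and, through time cutoffs
whose derivative is minus a bump, the potential on almost every time slice.

Gain. Sobolev's inequality on slices, interpolated with the slice bound (`parabolic_sobolev`),
raises the exponent from r to r+m-1+2r/N in `exists_higher_integrability`; the surplus is λ_r/N.
Lowering the exponent back to r where |u| > a', and Hölder's inequality for F, give the passage
between two levels and two cylinders, `exists_backward_level_step`.

Iteration. Divided by its natural scaling (`normalized_step`), the level integral satisfies x_{n+1}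
≤ C bⁿ (x_n + x_n^{1-1/p})^{1+2/N}. The condition p > (N+2)/2 says exactly that (1-1/p)(1+2/N) > 1,
so a small x_0 forces x_n → 0 (`tendsto_zero_of_le_pow_mul_add_rpow`), that is |u| ≤ κ on the small
cylinder (`exists_sup_bound`).

Choice of κ. The three entries of the maximum correspond to the three quantitative hypotheses of
`exists_sup_bound`: smallness of the initial level integral, the bound for F, and θ κ^{m-1} ≤ ρ²,
which makes the spatial cutoff terms no worse than the temporal ones. The condition m ≤ m_c together
with λ_r > 0 gives r > 1+m, hence b ≥ 0. As Hölder's inequality for F needs an exponent at most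
p(1+m), the iteration runs with q = min(r, p(1+m)) in place of r. -/

namespace PorousMedium

/-! ### Mollification and weak derivatives -/

section Mollification

variable {E : Type*} [NormedAddCommGroup E] [NormedSpace ℝ E] [FiniteDimensional ℝ E]
  [MeasurableSpace E] [BorelSpace E] {μ : Measure E} [μ.IsAddHaarMeasure]
  {Y : Type*} [NormedAddCommGroup Y]

/-- Translations act continuously on `L²`. -/
theorem tendsto_eLpNorm_translate_sub {f : E → Y} (hf : MemLp f 2 μ) :
    Tendsto (fun y => eLpNorm (fun x => f (x - y) - f x) 2 μ) (𝓝 0) (𝓝 0) := by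
  have : Fact ((1 : ℝ≥0∞) ≤ 2) := ⟨by norm_num⟩
  let g : E → C(E, E) := fun y => ⟨fun x => x - y, by fun_prop⟩
  have hg : Continuous g := by
    refine ContinuousMap.continuous_of_continuous_uncurry _ ?_
    change Continuous (fun p : E × E => p.2 - p.1)
    fun_prop
  have hgm : ∀ y, MeasurePreserving (g y) μ μ := fun y => measurePreserving_sub_right μ y
  -- Translations depend continuously on y in the compact-open topology, and composing a fixed L²
  -- function with measure-preserving maps is continuous for that topology.
  have hc : Continuous fun y => Lp.compMeasurePreserving (g y) (hgm y) (hf.toLp f) :=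
    continuous_const.compMeasurePreservingLp hg hgm (by norm_num)
  have h0 := (tendsto_iff_edist_tendsto_0.1 (hc.tendsto 0))
  refine h0.congr fun y => ?_
  rw [Lp.edist_def]
  refine eLpNorm_congr_ae ?_
  have h1 : ∀ y, (Lp.compMeasurePreserving (g y) (hgm y) (hf.toLp f) : E → Y) =ᵐ[μ]
      fun x => f (x - y) := fun y =>
    (Lp.coeFn_compMeasurePreserving _ (hgm y)).trans
      ((hgm y).quasiMeasurePreserving.ae_eq_comp hf.coeFn_toLp)
  have h2 := h1 0
  simp only [sub_zero] at h2
  exact (h1 y).sub h2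

variable [NormedSpace ℝ Y] [CompleteSpace Y]

theorem ContDiffBump.integrable_normed_smul_of_memLp (j : ContDiffBump (0 : E)) {f : E → Y}
    (hf : MemLp f 2 μ) (x : E) : Integrable (fun y => j.normed μ y • f (x - y)) μ :=
  (j.hasCompactSupport_normed.convolutionExists_left (ContinuousLinearMap.lsmul ℝ ℝ)
    j.continuous_normed (hf.locallyIntegrable (by norm_num)) x).integrable

/-- The bump is a probability density. Jensen's inequality bounds the squared averaged difference
pointwise by the average of squares, and Tonelli then leaves an average of translation errors over
the support of the bump. -/
theorem eLpNorm_convolution_sub_le (j : ContDiffBump (0 : E)) {f : E → Y} (hf : MemLp f 2 μ)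
    {ε : ℝ≥0∞}
    (hε : ∀ y ∈ Metric.ball (0 : E) j.rOut, eLpNorm (fun x => f (x - y) - f x) 2 μ ≤ ε) :
    eLpNorm (fun x => (convolution (j.normed μ) f (ContinuousLinearMap.lsmul ℝ ℝ) μ) x - f x) 2 μ
      ≤ ε := by
  set κ : E → ℝ≥0∞ := fun y => ENNReal.ofReal (j.normed μ y) with hκ
  have hκm : Measurable κ := (j.continuous_normed.measurable).ennreal_ofReal
  have hκ1 : ∫⁻ y, κ y ∂μ = 1 := by
    rw [← ofReal_integral_eq_lintegral_ofReal j.integrable_normed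
      (ae_of_all _ j.nonneg_normed), j.integral_normed, ENNReal.ofReal_one]
  set P : Measure E := μ.withDensity κ with hP
  have : IsProbabilityMeasure P := ⟨by rw [hP, withDensity_apply _ MeasurableSet.univ,
    Measure.restrict_univ, hκ1]⟩
  have hac : P ≪ μ := withDensity_absolutelyContinuous _ _
  have hms : AEStronglyMeasurable (fun p : E × E => f (p.1 - p.2) - f p.1) (μ.prod μ) := by
    refine AEStronglyMeasurable.sub ?_ ?_
    · exact hf.1.comp_quasiMeasurePreserving (quasiMeasurePreserving_sub μ μ)
    · exact hf.1.comp_fst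
  have hpt : ∀ x, (‖(convolution (j.normed μ) f (ContinuousLinearMap.lsmul ℝ ℝ) μ) x - f x‖ₑ) ^ (2:ℝ)
      ≤ ∫⁻ y, κ y * ‖f (x - y) - f x‖ₑ ^ (2:ℝ) ∂μ := by
    intro x
    have e1 : (convolution (j.normed μ) f (ContinuousLinearMap.lsmul ℝ ℝ) μ) x - f x
        = ∫ y, j.normed μ y • (f (x - y) - f x) ∂μ := by
      rw [convolution_def]
      simp only [ContinuousLinearMap.lsmul_apply, smul_sub]
      rw [integral_sub (ContDiffBump.integrable_normed_smul_of_memLp j hf x)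
        (j.integrable_normed.smul_const _), j.integral_normed_smul]
    have hfx : AEStronglyMeasurable (fun y => f (x - y) - f x) μ :=
      (hf.1.comp_quasiMeasurePreserving
        (quasiMeasurePreserving_sub_left_of_right_invariant μ x)).sub aestronglyMeasurable_const
    have e2 : ‖∫ y, j.normed μ y • (f (x - y) - f x) ∂μ‖ₑ ≤ eLpNorm (fun y => f (x - y) - f x) 1 P := by
      refine (enorm_integral_le_lintegral_enorm _).trans_eq ?_
      rw [eLpNorm_one_eq_lintegral_enorm, hP,
        lintegral_withDensity_eq_lintegral_mul₀' hκm.aemeasurable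
          (by exact hfx.enorm.mono_ac hac)]
      refine lintegral_congr fun y => ?_
      rw [enorm_smul, Pi.mul_apply, hκ]
      simp only
      rw [Real.enorm_eq_ofReal (j.nonneg_normed y)]
    -- Jensen, as comparison of L¹ and L² norms for the probability measure `P`.
    have e3 := eLpNorm_le_eLpNorm_of_exponent_le (μ := P) (p := 1) (q := 2) (by norm_num)
      (hfx.mono_ac hac)
    have e4 := ENNReal.rpow_le_rpow (e2.trans e3) (z := 2) (by norm_num)
    rw [e1]
    refine e4.trans_eq ?_
    rw [eLpNorm_eq_lintegral_rpow_enorm_toReal (by norm_num) (by norm_num)]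
    simp only [ENNReal.toReal_ofNat, one_div]
    rw [← ENNReal.rpow_mul, inv_mul_cancel₀ (by norm_num), ENNReal.rpow_one, hP,
        lintegral_withDensity_eq_lintegral_mul₀' hκm.aemeasurable
          ((hfx.enorm.pow_const _).mono_ac hac)]
    rfl
  have hae : AEMeasurable (fun p : E × E => κ p.2 * ‖f (p.1 - p.2) - f p.1‖ₑ ^ (2:ℝ)) (μ.prod μ) :=
    (hκm.comp measurable_snd).aemeasurable.mul (hms.enorm.pow_const _)
  have hsq : ∀ g : E → Y, (eLpNorm g 2 μ) ^ (2:ℝ) = ∫⁻ x, ‖g x‖ₑ ^ (2:ℝ) ∂μ := by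
    intro g
    rw [eLpNorm_eq_lintegral_rpow_enorm_toReal (by norm_num) (by norm_num)]
    simp only [ENNReal.toReal_ofNat, one_div]
    rw [← ENNReal.rpow_mul, inv_mul_cancel₀ (by norm_num), ENNReal.rpow_one]
  rw [← ENNReal.rpow_le_rpow_iff (z := 2) (by norm_num), hsq]
  calc _ ≤ ∫⁻ x, ∫⁻ y, κ y * ‖f (x - y) - f x‖ₑ ^ (2:ℝ) ∂μ ∂μ := lintegral_mono hpt
    _ = ∫⁻ y, ∫⁻ x, κ y * ‖f (x - y) - f x‖ₑ ^ (2:ℝ) ∂μ ∂μ :=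
        lintegral_lintegral_swap hae
    _ = ∫⁻ y, κ y * ∫⁻ x, ‖f (x - y) - f x‖ₑ ^ (2:ℝ) ∂μ ∂μ := by
        refine lintegral_congr fun y => lintegral_const_mul' _ _ ENNReal.ofReal_ne_top
    _ ≤ ∫⁻ y, κ y * ε ^ (2:ℝ) ∂μ := by
        refine lintegral_mono fun y => ?_
        by_cases hy : y ∈ Metric.ball (0 : E) j.rOut
        · rw [← hsq]
          gcongr
          exact hε y hy
        · have : j.normed μ y = 0 := by
            rw [← j.support_normed_eq (μ := μ)] at hy
            exact Function.notMem_support.1 hy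
          simp [hκ, this]
    _ = ε ^ (2:ℝ) := by rw [lintegral_mul_const _ hκm, hκ1, one_mul]

/-- A sequence of bump functions at `0` with shrinking supports. -/
def shrinkingBump (E : Type*) [NormedAddCommGroup E] (δ : ℝ) (hδ : 0 < δ) (n : ℕ) :
    ContDiffBump (0 : E) where
  rIn := δ / (2 * (n + 1))
  rOut := δ / (n + 1)
  rIn_pos := by positivity
  rIn_lt_rOut := by
    have h : (0:ℝ) < n + 1 := by positivity
    rw [div_lt_div_iff_of_pos_left hδ (by positivity) h]
    linarith

theorem shrinkingBump_rOut_le {δ : ℝ} (hδ : 0 < δ) (n : ℕ) :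
    (shrinkingBump E δ hδ n).rOut ≤ δ := by
  change δ / (n + 1) ≤ δ
  exact div_le_self hδ.le (by linarith [Nat.cast_nonneg (α := ℝ) n])

theorem tendsto_shrinkingBump_rOut {δ : ℝ} (hδ : 0 < δ) :
    Tendsto (fun n => (shrinkingBump E δ hδ n).rOut) atTop (𝓝 0) := by
  change Tendsto (fun n : ℕ => δ / ((n : ℝ) + 1)) atTop (𝓝 0)
  exact tendsto_const_nhds.div_atTop
    (tendsto_atTop_add_const_right _ _ tendsto_natCast_atTop_atTop)

/-- The bounded ratio of the radii is the hypothesis under which bump convolutions converge almost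
everywhere. -/
theorem shrinkingBump_rOut_le_rIn {δ : ℝ} (hδ : 0 < δ) (n : ℕ) :
    (shrinkingBump E δ hδ n).rOut ≤ 2 * (shrinkingBump E δ hδ n).rIn := by
  change δ / (n + 1) ≤ 2 * (δ / (2 * (n + 1)))
  have h : (0:ℝ) < n + 1 := by positivity
  apply le_of_eq
  field_simp

theorem tendsto_eLpNorm_convolution_sub {f : E → Y} (hf : MemLp f 2 μ) {δ : ℝ} (hδ : 0 < δ) :
    Tendsto (fun n => eLpNorm (fun x => (convolution ((shrinkingBump E δ hδ n).normed μ) f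
      (ContinuousLinearMap.lsmul ℝ ℝ) μ) x - f x) 2 μ) atTop (𝓝 0) := by
  rw [ENNReal.tendsto_nhds_zero]
  intro ε hε
  have h := (ENNReal.tendsto_nhds_zero.1 (tendsto_eLpNorm_translate_sub hf)) ε hε
  obtain ⟨r, hr, hball⟩ := Metric.eventually_nhds_iff_ball.1 h
  filter_upwards [(tendsto_shrinkingBump_rOut (E := E) hδ).eventually (gt_mem_nhds hr)] with n hn
  exact eLpNorm_convolution_sub_le _ hf fun y hy => hball y (Metric.ball_subset_ball hn.le hy)

theorem norm_convolution_normed_le (j : ContDiffBump (0 : E)) {f : E → Y} {M : ℝ}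
    (hM : ∀ x, ‖f x‖ ≤ M) (x : E) :
    ‖(convolution (j.normed μ) f (ContinuousLinearMap.lsmul ℝ ℝ) μ) x‖ ≤ M := by
  rw [convolution_def]
  calc _ ≤ ∫ y, j.normed μ y * M ∂μ := by
        refine norm_integral_le_of_norm_le (j.integrable_normed.mul_const _) (ae_of_all _ fun y => ?_)
        simp only [ContinuousLinearMap.lsmul_apply]
        rw [norm_smul, Real.norm_of_nonneg (j.nonneg_normed y)]
        exact mul_le_mul_of_nonneg_left (hM _) (j.nonneg_normed y)
    _ = M := by rw [integral_mul_const, j.integral_normed, one_mul]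

/-- `g i` is the weak derivative of `w` in the direction `e i` in the open set `U`. -/
def HasWeakDerivs {ι : Type*} (μ : Measure E) (U : Set E) (e : ι → E) (w : E → Y)
    (g : ι → E → Y) : Prop :=
  ∀ η : E → ℝ, ContDiff ℝ ∞ η → HasCompactSupport η → tsupport η ⊆ U → ∀ i,
    ∫ z, fderiv ℝ η z (e i) • w z ∂μ = -∫ z, η z • g i z ∂μ

/-- Local approximation by smooth functions. -/
theorem HasWeakDerivs.exists_smooth_approx {ι : Type*} {U : Set E} {e : ι → E} {w : E → Y}
    {g : ι → E → Y} (h : HasWeakDerivs μ U e w g) (hU : IsOpen U) {K : Set E}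
    (hK : IsCompact K) (hKU : K ⊆ U) (hw : MemLp w 2 μ) (hg : ∀ i, MemLp (g i) 2 μ) {M : ℝ}
    (hM : ∀ z, ‖w z‖ ≤ M) :
    ∃ (W : ℕ → E → Y) (D : ℕ → ι → E → Y), (∀ n, ContDiff ℝ ∞ (W n)) ∧
      (∀ n z, ‖W n z‖ ≤ M) ∧ (∀ᵐ z ∂μ, Tendsto (fun n => W n z) atTop (𝓝 (w z))) ∧
      (∀ n i, Continuous (D n i)) ∧
      (∀ i, Tendsto (fun n => eLpNorm (D n i - g i) 2 μ) atTop (𝓝 0)) ∧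
      ∀ n, ∀ z ∈ K, ∀ i, fderiv ℝ (W n) z (e i) = D n i z := by
  -- With radii at most δ, the reflected bump centred at a point of `K` is supported in `U`, hence
  -- an admissible test function. So the derivative of the mollification is identified on `K` only.
  obtain ⟨δ, hδ, hδU⟩ := hK.exists_cthickening_subset_open hU hKU
  set j := shrinkingBump E δ hδ with hj
  have hwl : LocallyIntegrable w μ := hw.locallyIntegrable (by norm_num)
  refine ⟨fun n => convolution ((j n).normed μ) w (ContinuousLinearMap.lsmul ℝ ℝ) μ,
    fun n i => convolution ((j n).normed μ) (g i) (ContinuousLinearMap.lsmul ℝ ℝ) μ,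
    fun n => ?_, fun n z => norm_convolution_normed_le _ hM z, ?_, fun n i => ?_, fun i =>
    tendsto_eLpNorm_convolution_sub (hg i) hδ, fun n z hz i => ?_⟩
  · exact (j n).hasCompactSupport_normed.contDiff_convolution_left _ (j n).contDiff_normed hwl
  · exact ContDiffBump.ae_convolution_tendsto_right_of_locallyIntegrable (K := 2)
      (tendsto_shrinkingBump_rOut hδ) (Eventually.of_forall (shrinkingBump_rOut_le_rIn hδ)) hwl
  · exact (j n).hasCompactSupport_normed.continuous_convolution_left _ (j n).continuous_normed
      ((hg i).locallyIntegrable (by norm_num))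
  · have h1 : ContDiff ℝ 1 ((j n).normed μ) := (j n).contDiff_normed (n := 1)
    rw [((j n).hasCompactSupport_normed.hasFDerivAt_convolution_left
      (ContinuousLinearMap.lsmul ℝ ℝ) h1 hwl z).fderiv]
    have hce : ConvolutionExistsAt (fderiv ℝ ((j n).normed μ)) w z
        ((ContinuousLinearMap.lsmul ℝ ℝ).precompL E : (E →L[ℝ] ℝ) →L[ℝ] Y →L[ℝ] E →L[ℝ] Y) μ :=
      ((j n).hasCompactSupport_normed.fderiv ℝ).convolutionExists_left _
        (h1.continuous_fderiv one_ne_zero) hwl z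
    rw [convolution_def, ContinuousLinearMap.integral_apply hce.integrable]
    simp only [ContinuousLinearMap.precompL_apply, ContinuousLinearMap.lsmul_apply]
    have hη : ContDiff ℝ ∞ (fun y => (j n).normed μ (z - y)) :=
      ((j n).contDiff_normed (n := ⊤)).comp (contDiff_const.sub contDiff_id)
    have hsupp : tsupport (fun y => (j n).normed μ (z - y)) ⊆ Metric.closedBall z (j n).rOut := by
      refine closure_minimal (fun y hy => ?_) Metric.isClosed_closedBall
      have : z - y ∈ Metric.ball (0 : E) (j n).rOut := by
        rw [← (j n).support_normed_eq (μ := μ)]; exact hy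
      rw [mem_ball_zero_iff] at this
      rw [mem_closedBall_iff_norm, norm_sub_rev]; exact this.le
    have hcs : HasCompactSupport (fun y => (j n).normed μ (z - y)) :=
      HasCompactSupport.of_support_subset_isCompact (isCompact_closedBall z (j n).rOut)
        ((subset_tsupport _).trans hsupp)
    have hsU : tsupport (fun y => (j n).normed μ (z - y)) ⊆ U := by
      refine hsupp.trans (((Metric.closedBall_subset_closedBall
        (shrinkingBump_rOut_le hδ n)).trans ?_).trans hδU)
      exact Metric.closedBall_subset_cthickening hz δ
    have key := h _ hη hcs hsU i
    have e1 : ∀ y, fderiv ℝ (fun y => (j n).normed μ (z - y)) y (e i)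
        = - fderiv ℝ ((j n).normed μ) (z - y) (e i) := by
      intro y
      have hd : HasFDerivAt (fun y => (j n).normed μ (z - y))
          ((fderiv ℝ ((j n).normed μ) (z - y)).comp (-ContinuousLinearMap.id ℝ E)) y := by
        have a1 := (h1.differentiable one_ne_zero (z - y)).hasFDerivAt
        have a2 : HasFDerivAt (fun y : E => z - y) (-ContinuousLinearMap.id ℝ E) y :=
          (hasFDerivAt_id y).const_sub z
        exact a1.comp y a2
      rw [hd.fderiv]; simp
    simp only [e1, neg_smul, integral_neg, neg_inj] at key
    rw [convolution_eq_swap]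
    simp only [ContinuousLinearMap.lsmul_apply]
    rw [← key, ← integral_sub_left_eq_self _ μ z]
    simp

end Mollification

/-! ### Chain rule for smooth functions of a bounded weakly differentiable map -/

section ChainRule

variable {E : Type*} [NormedAddCommGroup E] [NormedSpace ℝ E] [FiniteDimensional ℝ E]
  [MeasurableSpace E] [BorelSpace E] {μ : Measure E} [μ.IsAddHaarMeasure]
  {X : Type*} [NormedAddCommGroup X] [NormedSpace ℝ X] [FiniteDimensional ℝ X]
  {Y : Type*} [NormedAddCommGroup Y] [NormedSpace ℝ Y]

theorem eLpNorm_two_rpow_two {α Z : Type*} [MeasurableSpace α] [NormedAddCommGroup Z]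
    (f : α → Z) (ν : Measure α) : (eLpNorm f 2 ν) ^ (2 : ℝ) = ∫⁻ x, ‖f x‖ₑ ^ (2 : ℝ) ∂ν := by
  rw [eLpNorm_eq_lintegral_rpow_enorm_toReal (by norm_num) (by norm_num)]
  simp only [ENNReal.toReal_ofNat, one_div]
  rw [← ENNReal.rpow_mul, inv_mul_cancel₀ (by norm_num), ENNReal.rpow_one]

theorem tendsto_eLpNorm_two_iff {α Z : Type*} [MeasurableSpace α] [NormedAddCommGroup Z]
    {ν : Measure α} {F : ℕ → α → Z} :
    Tendsto (fun n => eLpNorm (F n) 2 ν) atTop (𝓝 0) ↔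
      Tendsto (fun n => ∫⁻ x, ‖F n x‖ₑ ^ (2 : ℝ) ∂ν) atTop (𝓝 0) := by
  simp only [← eLpNorm_two_rpow_two]
  constructor
  · intro h
    have := (ENNReal.continuous_rpow_const (y := 2)).continuousAt.tendsto.comp h
    simpa [Function.comp_def] using this
  · intro h
    have := (ENNReal.continuous_rpow_const (y := 2⁻¹)).continuousAt.tendsto.comp h
    have e : ∀ a : ℝ≥0∞, (a ^ (2 : ℝ)) ^ (2⁻¹ : ℝ) = a := fun a => by
      rw [← ENNReal.rpow_mul, mul_inv_cancel₀ (by norm_num), ENNReal.rpow_one]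
    simp only [Function.comp_def, e] at this
    rwa [ENNReal.zero_rpow_of_pos (by norm_num)] at this

theorem tendsto_eLpNorm_two_of_dominated {α Z : Type*} [MeasurableSpace α]
    [NormedAddCommGroup Z] {ν : Measure α} {F : ℕ → α → Z} {b : α → ℝ}
    (hF : ∀ n, AEStronglyMeasurable (F n) ν) (hb : MemLp b 2 ν)
    (hbound : ∀ n, ∀ᵐ x ∂ν, ‖F n x‖ ≤ b x)
    (hlim : ∀ᵐ x ∂ν, Tendsto (fun n => F n x) atTop (𝓝 0)) :
    Tendsto (fun n => eLpNorm (F n) 2 ν) atTop (𝓝 0) := by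
  rw [tendsto_eLpNorm_two_iff]
  have h := tendsto_lintegral_of_dominated_convergence' (μ := ν)
    (F := fun n x => ‖F n x‖ₑ ^ (2 : ℝ)) (f := fun _ => 0) (fun x => ‖b x‖ₑ ^ (2 : ℝ))
    (fun n => (hF n).enorm.pow_const _) (fun n => ?_) ?_ ?_
  · simpa using h
  · filter_upwards [hbound n] with x hx
    gcongr
    rw [enorm_le_iff_norm_le]
    exact hx.trans (le_abs_self _)
  · rw [← eLpNorm_two_rpow_two]
    exact ENNReal.rpow_ne_top_of_nonneg (by norm_num) hb.2.ne
  · filter_upwards [hlim] with x hx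
    have h1 : Tendsto (fun n => ‖F n x‖ₑ) atTop (𝓝 0) := by
      simpa using hx.enorm
    have := (ENNReal.continuous_rpow_const (y := 2)).continuousAt.tendsto.comp h1
    simpa [Function.comp_def] using this

theorem tendsto_eLpNorm_two_of_norm_le_mul {α Z Z' : Type*} [MeasurableSpace α]
    [NormedAddCommGroup Z] [NormedAddCommGroup Z'] {ν : Measure α} {F : ℕ → α → Z}
    {F' : ℕ → α → Z'} (C : ℝ) (hbound : ∀ n, ∀ x, ‖F n x‖ ≤ C * ‖F' n x‖)
    (h : Tendsto (fun n => eLpNorm (F' n) 2 ν) atTop (𝓝 0)) :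
    Tendsto (fun n => eLpNorm (F n) 2 ν) atTop (𝓝 0) := by
  have h1 : Tendsto (fun n => ENNReal.ofReal C * eLpNorm (F' n) 2 ν) atTop (𝓝 0) := by
    simpa using ENNReal.Tendsto.const_mul h (Or.inr ENNReal.ofReal_ne_top) (a := ENNReal.ofReal C)
  exact tendsto_of_tendsto_of_tendsto_of_le_of_le tendsto_const_nhds h1 (fun n => zero_le)
    (fun n => eLpNorm_le_mul_eLpNorm_of_ae_le_mul (ae_of_all _ (hbound n)) 2)

/-- Formal derivative of `ψ • f(w)` when `w` has weak derivatives `g`. -/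
def prodDeriv {ι : Type*} (e : ι → E) (ψ : E → ℝ) (f : X → Y) (w : E → X) (g : ι → E → X) (i : ι)
    (z : E) : Y :=
  fderiv ℝ ψ z (e i) • f (w z) + ψ z • fderiv ℝ f (w z) (g i z)

theorem exists_norm_le_of_continuous {f : X → Y} (hf : Continuous f) (M : ℝ) :
    ∃ C, 0 ≤ C ∧ ∀ x, ‖x‖ ≤ M → ‖f x‖ ≤ C := by
  obtain ⟨C, hC⟩ := (isCompact_closedBall (0 : X) M).exists_bound_of_continuousOn hf.continuousOn
  exact ⟨max C 0, le_max_right _ _, fun x hx => (hC x (by simpa using hx)).trans (le_max_left _ _)⟩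

theorem memLp_of_continuous_compactSupport {ψ : E → Y} (h : Continuous ψ)
    (hc : HasCompactSupport ψ) (p : ℝ≥0∞) : MemLp ψ p μ :=
  h.memLp_of_hasCompactSupport hc

theorem aestronglyMeasurable_clm_apply {α : Type*} [MeasurableSpace α] {ν : Measure α}
    {L : α → X →L[ℝ] Y} {v : α → X} (hL : AEStronglyMeasurable L ν)
    (hv : AEStronglyMeasurable v ν) : AEStronglyMeasurable (fun z => L z (v z)) ν :=
  (isBoundedBilinearMap_apply (𝕜 := ℝ) (E := X) (F := Y)).continuous.comp_aestronglyMeasurable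
    (hL.prodMk hv)

theorem aestronglyMeasurable_prodDeriv {ι : Type*} {e : ι → E} {ψ : E → ℝ} {f : X → Y} {w : E → X}
    {g : ι → E → X} (hψ : ContDiff ℝ ∞ ψ) (hf : ContDiff ℝ ∞ f) (hw : AEStronglyMeasurable w μ)
    (i : ι) (hg : AEStronglyMeasurable (g i) μ) :
    AEStronglyMeasurable (prodDeriv e ψ f w g i) μ := by
  refine AEStronglyMeasurable.add ?_ ?_
  · exact (((hψ.continuous_fderiv (by simp)).clm_apply continuous_const).aestronglyMeasurable).smul
      (hf.continuous.comp_aestronglyMeasurable hw)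
  · exact hψ.continuous.aestronglyMeasurable.smul (aestronglyMeasurable_clm_apply
      ((hf.continuous_fderiv (by simp)).comp_aestronglyMeasurable hw) hg)

theorem memLp_prodDeriv {ι : Type*} {e : ι → E} {ψ : E → ℝ} {f : X → Y} {w : E → X}
    {g : ι → E → X} (hψ : ContDiff ℝ ∞ ψ) (hψc : HasCompactSupport ψ) (hf : ContDiff ℝ ∞ f)
    (hw : AEStronglyMeasurable w μ) {M : ℝ} (hM : ∀ z, ‖w z‖ ≤ M)
    (i : ι) (hg : MemLp (g i) 2 μ) :
    MemLp (prodDeriv e ψ f w g i) 2 μ := by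
  obtain ⟨C, hC0, hC⟩ := exists_norm_le_of_continuous hf.continuous M
  obtain ⟨C', hC0', hC'⟩ := exists_norm_le_of_continuous (hf.continuous_fderiv (by simp)) M
  have hdc : Continuous (fun z => fderiv ℝ ψ z (e i)) :=
    (hψ.continuous_fderiv (by simp)).clm_apply continuous_const
  have h1 : MemLp (fun z => fderiv ℝ ψ z (e i)) 2 μ :=
    memLp_of_continuous_compactSupport hdc (hψc.fderiv_apply ℝ (e i)) 2
  obtain ⟨B, hB⟩ := hψc.exists_bound_of_continuous hψ.continuous
  refine MemLp.mono' (g := fun z => C * ‖fderiv ℝ ψ z (e i)‖ + B * C' * ‖g i z‖)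
    ((h1.norm.const_mul C).add (hg.norm.const_mul (B * C')))
    (aestronglyMeasurable_prodDeriv hψ hf hw i hg.1) (ae_of_all _ fun z => ?_)
  refine (norm_add_le _ _).trans (add_le_add ?_ ?_)
  · rw [norm_smul, mul_comm]
    exact mul_le_mul_of_nonneg_right (hC _ (hM z)) (norm_nonneg _)
  · rw [norm_smul, mul_assoc]
    exact mul_le_mul (hB z) ((ContinuousLinearMap.le_opNorm _ _).trans
      (mul_le_mul_of_nonneg_right (hC' _ (hM z)) (norm_nonneg _))) (norm_nonneg _)
      ((norm_nonneg _).trans (hB z))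

variable [CompleteSpace Y]

/-- The natural test function ψ f(w) is not smooth, whereas the weak formulation accepts smooth
functions only. The approximations are ψ f(W_n) with W_n mollifications of w. Since w is bounded, f
and its derivative matter on a ball only, and no growth condition on f is needed. -/
theorem HasWeakDerivs.exists_smooth_approx_comp {ι : Type*} {U : Set E} {e : ι → E} {w : E → X}
    {g : ι → E → X} (h : HasWeakDerivs μ U e w g) (hU : IsOpen U) (hw : MemLp w 2 μ)
    (hg : ∀ i, MemLp (g i) 2 μ) {M : ℝ} (hM : ∀ z, ‖w z‖ ≤ M) {ψ : E → ℝ} (hψ : ContDiff ℝ ∞ ψ)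
    (hψc : HasCompactSupport ψ) (hψU : tsupport ψ ⊆ U) {f : X → Y} (hf : ContDiff ℝ ∞ f) :
    ∃ φ : ℕ → E → Y, (∀ n, ContDiff ℝ ∞ (φ n)) ∧ (∀ n, tsupport (φ n) ⊆ tsupport ψ) ∧
      (∃ C, ∀ n z, ‖φ n z‖ ≤ C) ∧
      (∀ᵐ z ∂μ, Tendsto (fun n => φ n z) atTop (𝓝 (ψ z • f (w z)))) ∧
      ∀ i, Tendsto (fun n => eLpNorm ((fun z => fderiv ℝ (φ n) z (e i)) -
        prodDeriv e ψ f w g i) 2 μ) atTop (𝓝 0) := by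
  have : CompleteSpace X := FiniteDimensional.complete ℝ X
  obtain ⟨W, D, hWs, hWM, hWlim, hDc, hDlim, hWD⟩ :=
    h.exists_smooth_approx hU hψc hψU hw hg hM
  obtain ⟨C, hC0, hC⟩ := exists_norm_le_of_continuous hf.continuous M
  obtain ⟨C', hC0', hC'⟩ := exists_norm_le_of_continuous (hf.continuous_fderiv (by simp)) M
  obtain ⟨B, hB⟩ := hψc.exists_bound_of_continuous hψ.continuous
  have hB0 : 0 ≤ B := (norm_nonneg _).trans (hB 0)
  have hdψ : Continuous (fderiv ℝ ψ) := hψ.continuous_fderiv (by simp)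
  have hdf : Continuous (fderiv ℝ f) := hf.continuous_fderiv (by simp)
  refine ⟨fun n z => ψ z • f (W n z), fun n => hψ.smul (hf.comp (hWs n)),
    fun n => tsupport_smul_subset_left _ _, ⟨B * C, fun n z => ?_⟩, ?_, fun i => ?_⟩
  · rw [norm_smul]
    exact mul_le_mul (hB z) (hC _ (hWM n z)) (norm_nonneg _) hB0
  · filter_upwards [hWlim] with z hz
    exact ((hf.continuous.tendsto _).comp hz).const_smul _
  · have hfd : ∀ n z, fderiv ℝ (fun z => ψ z • f (W n z)) z (e i) =
        fderiv ℝ ψ z (e i) • f (W n z) + ψ z • fderiv ℝ f (W n z) (D n i z) := by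
      intro n z
      have d1 : DifferentiableAt ℝ ψ z := hψ.differentiable (by simp) z
      have d2 : DifferentiableAt ℝ (W n) z := (hWs n).differentiable (by simp) z
      have d3 : DifferentiableAt ℝ f (W n z) := hf.differentiable (by simp) _
      have d4 : HasFDerivAt (fun z => f (W n z)) ((fderiv ℝ f (W n z)).comp (fderiv ℝ (W n) z)) z :=
        d3.hasFDerivAt.comp z d2.hasFDerivAt
      have d5 := d1.hasFDerivAt.smul d4
      rw [show (fun z => ψ z • f (W n z)) = ψ • (fun z => f (W n z)) from rfl, d5.fderiv]
      simp only [add_apply, smul_apply,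
        ContinuousLinearMap.comp_apply, ContinuousLinearMap.smulRight_apply]
      rw [add_comm]
      congr 1
      -- Off the support of ψ the derivative of `W n` is not known to be `D n i`, but it is
      -- multiplied by zero.
      by_cases hz : z ∈ tsupport ψ
      · rw [hWD n z hz i]
      · simp [image_eq_zero_of_notMem_tsupport hz]
    -- The error splits according to which factor is replaced. In `T3` the coefficient converges
    -- only almost everywhere against an L² function, so it needs dominated convergence; `T2` is a
    -- bounded factor times an L² null sequence.
    set T1 : ℕ → E → Y := fun n z => fderiv ℝ ψ z (e i) • (f (W n z) - f (w z)) with hT1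
    set T2 : ℕ → E → Y := fun n z => ψ z • fderiv ℝ f (W n z) ((D n i - g i) z) with hT2
    set T3 : ℕ → E → Y := fun n z => ψ z • ((fderiv ℝ f (W n z) - fderiv ℝ f (w z)) (g i z)) with hT3
    have hsum : ∀ n, ((fun z => fderiv ℝ (fun z => ψ z • f (W n z)) z (e i)) -
        prodDeriv e ψ f w g i) = T1 n + T2 n + T3 n := by
      intro n
      funext z
      simp only [Pi.sub_apply, Pi.add_apply, hfd, prodDeriv, hT1, hT2, hT3, map_sub,
        sub_apply, smul_sub]
      abel
    have hWm : ∀ n, AEStronglyMeasurable (W n) μ := fun n => (hWs n).continuous.aestronglyMeasurable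
    have m1 : ∀ n, AEStronglyMeasurable (T1 n) μ := fun n =>
      ((hdψ.clm_apply continuous_const).aestronglyMeasurable).smul
        ((hf.continuous.comp_aestronglyMeasurable (hWm n)).sub
          (hf.continuous.comp_aestronglyMeasurable hw.1))
    have m2 : ∀ n, AEStronglyMeasurable (T2 n) μ := fun n =>
      hψ.continuous.aestronglyMeasurable.smul (aestronglyMeasurable_clm_apply
        (hdf.comp_aestronglyMeasurable (hWm n)) ((hDc n i).aestronglyMeasurable.sub (hg i).1))
    have m3 : ∀ n, AEStronglyMeasurable (T3 n) μ := fun n =>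
      hψ.continuous.aestronglyMeasurable.smul (aestronglyMeasurable_clm_apply
        ((hdf.comp_aestronglyMeasurable (hWm n)).sub (hdf.comp_aestronglyMeasurable hw.1)) (hg i).1)
    have l1 : Tendsto (fun n => eLpNorm (T1 n) 2 μ) atTop (𝓝 0) := by
      refine tendsto_eLpNorm_two_of_dominated (b := fun z => 2 * C * ‖fderiv ℝ ψ z (e i)‖) m1
        ((memLp_of_continuous_compactSupport (hdψ.clm_apply continuous_const)
          (hψc.fderiv_apply ℝ (e i)) 2).norm.const_mul _) (fun n => ae_of_all _ fun z => ?_) ?_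
      · simp only [hT1]
        rw [norm_smul, mul_comm]
        refine mul_le_mul_of_nonneg_right ((norm_sub_le _ _).trans ?_) (norm_nonneg _)
        linarith [hC _ (hWM n z), hC _ (hM z)]
      · filter_upwards [hWlim] with z hz
        have := (((hf.continuous.tendsto _).comp hz).sub_const (f (w z))).const_smul
          (fderiv ℝ ψ z (e i))
        simpa using this
    have l2 : Tendsto (fun n => eLpNorm (T2 n) 2 μ) atTop (𝓝 0) := by
      refine tendsto_eLpNorm_two_of_norm_le_mul (B * C') (fun n z => ?_) (hDlim i)
      simp only [hT2]
      rw [norm_smul, mul_assoc]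
      exact mul_le_mul (hB z) ((ContinuousLinearMap.le_opNorm _ _).trans
        (mul_le_mul_of_nonneg_right (hC' _ (hWM n z)) (norm_nonneg _))) (norm_nonneg _) hB0
    have l3 : Tendsto (fun n => eLpNorm (T3 n) 2 μ) atTop (𝓝 0) := by
      refine tendsto_eLpNorm_two_of_dominated (b := fun z => B * (2 * C') * ‖g i z‖) m3
        ((hg i).norm.const_mul _) (fun n => ae_of_all _ fun z => ?_) ?_
      · simp only [hT3]
        rw [norm_smul, mul_assoc]
        refine mul_le_mul (hB z) ((ContinuousLinearMap.le_opNorm _ _).trans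
          (mul_le_mul_of_nonneg_right ((norm_sub_le _ _).trans ?_) (norm_nonneg _)))
          (norm_nonneg _) hB0
        linarith [hC' _ (hWM n z), hC' _ (hM z)]
      · filter_upwards [hWlim] with z hz
        have h4 : Tendsto (fun n => fderiv ℝ f (W n z) - fderiv ℝ f (w z)) atTop (𝓝 0) := by
          simpa using ((hdf.tendsto _).comp hz).sub_const (fderiv ℝ f (w z))
        have h5 := (((ContinuousLinearMap.apply ℝ Y (g i z)).continuous.tendsto _).comp h4).const_smul (ψ z)
        simpa [hT3] using h5
    have l4 := (l1.add l2).add l3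
    simp only [add_zero] at l4
    refine tendsto_of_tendsto_of_tendsto_of_le_of_le tendsto_const_nhds l4 (fun n => zero_le)
      (fun n => ?_)
    simp only [hsum]
    refine (eLpNorm_add_le ((m1 n).add (m2 n)) (m3 n) (by norm_num)).trans ?_
    gcongr
    exact eLpNorm_add_le (m1 n) (m2 n) (by norm_num)

end ChainRule

/-! ### Energy inequality without a time derivative -/

section Energy

variable {E : Type*} [NormedAddCommGroup E] [NormedSpace ℝ E] [FiniteDimensional ℝ E]
  [MeasurableSpace E] [BorelSpace E] {μ : Measure E} [μ.IsAddHaarMeasure]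
  {X : Type*} [NormedAddCommGroup X] [InnerProductSpace ℝ X] [FiniteDimensional ℝ X]

theorem locallyIntegrable_of_norm_le {Y : Type*} [NormedAddCommGroup Y] {f : E → Y}
    (hf : AEStronglyMeasurable f μ) {M : ℝ} (hM : ∀ z, ‖f z‖ ≤ M) : LocallyIntegrable f μ :=
  (memLp_top_of_bound hf M (ae_of_all _ hM)).locallyIntegrable le_top

theorem abs_integral_inner_le {α : Type*} [MeasurableSpace α] {ν : Measure α} {a b : α → X}
    (ha : MemLp a 2 ν) (hb : MemLp b 2 ν) :
    |∫ z, inner ℝ (a z) (b z) ∂ν| ≤ (eLpNorm a 2 ν).toReal * (eLpNorm b 2 ν).toReal := by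
  have h := abs_real_inner_le_norm (ha.toLp a) (hb.toLp b)
  rw [L2.inner_def, Lp.norm_toLp, Lp.norm_toLp] at h
  refine le_of_eq_of_le (congrArg _ (integral_congr_ae ?_)) h
  filter_upwards [ha.coeFn_toLp, hb.coeFn_toLp] with z h1 h2
  rw [h1, h2]

theorem integrable_inner_of_memLp {α : Type*} [MeasurableSpace α] {ν : Measure α} {a b : α → X}
    (ha : MemLp a 2 ν) (hb : MemLp b 2 ν) : Integrable (fun z => (inner ℝ (a z) (b z) : ℝ)) ν :=
  (L2.integrable_inner (𝕜 := ℝ) (ha.toLp a) (hb.toLp b)).congr (by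
    filter_upwards [ha.coeFn_toLp, hb.coeFn_toLp] with z h1 h2
    rw [h1, h2])

/-- Along the line spanned by τ this is a convolution of φ with the reflection of f, so local
integrability of f suffices to differentiate. -/
theorem hasDerivAt_integral_translate {Y Z : Type*} [NormedAddCommGroup Y] [NormedSpace ℝ Y]
    [NormedAddCommGroup Z] [NormedSpace ℝ Z] (L : Y →L[ℝ] Z →L[ℝ] ℝ) {f : E → Y} {φ : E → Z}
    (hf : LocallyIntegrable f μ) (hφ : ContDiff ℝ 1 φ) (hφc : HasCompactSupport φ) (τ : E) (s : ℝ) :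
    HasDerivAt (fun h : ℝ => ∫ z, L (f z) (φ (z + h • τ)) ∂μ)
      (∫ z, L (f z) (fderiv ℝ φ (z + s • τ) τ) ∂μ) s := by
  have hf' : LocallyIntegrable (fun z => f (-z)) μ := by
    rw [locallyIntegrable_iff] at hf ⊢
    intro K hK
    have := (Measure.measurePreserving_neg μ).integrableOn_comp_preimage
      (MeasurableEquiv.neg E).measurableEmbedding (f := f) (s := -K)
    have h2 : (Neg.neg ⁻¹' (-K) : Set E) = K := by ext; simp
    rw [h2] at this
    exact this.2 (hf _ hK.neg)
  have h1 := hφc.hasFDerivAt_convolution_right (L := L) (μ := μ) hf' hφ (s • τ)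
  have h2 : HasDerivAt (fun h : ℝ => h • τ) τ s := by
    simpa using (hasDerivAt_id s).smul_const τ
  have h3 := h1.comp_hasDerivAt s h2
  have e : ∀ (x : E), (convolution (fun z => f (-z)) φ L μ) x = ∫ z, L (f z) (φ (z + x)) ∂μ := by
    intro x
    rw [convolution_def, ← integral_neg_eq_self]
    simp [add_comm]
  have hce : ConvolutionExistsAt (fun z => f (-z)) (fderiv ℝ φ) (s • τ)
      (L.precompR E : Y →L[ℝ] (E →L[ℝ] Z) →L[ℝ] E →L[ℝ] ℝ) μ :=
    (hφc.fderiv ℝ).convolutionExists_right _ hf' (hφ.continuous_fderiv one_ne_zero) _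
  rw [convolution_def, ContinuousLinearMap.integral_apply hce.integrable,
    ← integral_neg_eq_self] at h3
  simp only [ContinuousLinearMap.precompR_apply, ContinuousLinearMap.compL_apply, ContinuousLinearMap.comp_apply, neg_neg, sub_neg_eq_add] at h3
  simp only [Function.comp_def, e] at h3
  simpa only [add_comm] using h3

/-- `u` solves `∂_τ u = ∑ ∂_{e i} (V i)` in `U` in the distributional sense. -/
def IsDistribSolution {ι : Type*} [Fintype ι] (μ : Measure E) (U : Set E) (τ : E) (e : ι → E)
    (u : E → X) (V : ι → E → X) : Prop :=
  ∀ φ : E → X, ContDiff ℝ ∞ φ → HasCompactSupport φ → tsupport φ ⊆ U →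
    ∫ z, (inner ℝ (u z) (fderiv ℝ φ z τ) : ℝ) ∂μ =
      ∑ i, ∫ z, (inner ℝ (V i z) (fderiv ℝ φ z (e i)) : ℝ) ∂μ

/-- The shifted test function is still admissible, so the equation trades its τ-derivative for
spatial ones. A change of variables moves the shift onto `V`, where translation is continuous in L².
-/
theorem IsDistribSolution.hasDerivAt {ι : Type*} [Fintype ι] {U : Set E} {τ : E}
    {e : ι → E} {u : E → X} {V : ι → E → X} (h : IsDistribSolution μ U τ e u V)
    (hu : LocallyIntegrable u μ) {φ : E → X} (hφ : ContDiff ℝ ∞ φ) (hφc : HasCompactSupport φ)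
    {s : ℝ} (hs : (fun z => z + s • τ) ⁻¹' tsupport φ ⊆ U) :
    HasDerivAt (fun h : ℝ => ∫ z, (inner ℝ (u z) (φ (z + h • τ)) : ℝ) ∂μ)
      (∑ i, ∫ z, (inner ℝ (V i (z - s • τ)) (fderiv ℝ φ z (e i)) : ℝ) ∂μ) s := by
  have h1 := hasDerivAt_integral_translate (μ := μ) (innerSL ℝ) hu
    (hφ.of_le (by exact_mod_cast le_top)) hφc τ s
  have hc : HasCompactSupport (fun z => φ (z + s • τ)) :=
    hφc.comp_homeomorph (Homeomorph.addRight (s • τ))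
  have hsub : tsupport (fun z => φ (z + s • τ)) ⊆ U := by
    refine Subset.trans ?_ hs
    exact closure_minimal (fun z hz => subset_tsupport _ hz)
      ((isClosed_tsupport φ).preimage (by fun_prop))
  have h2 := h (fun z => φ (z + s • τ)) (hφ.comp (contDiff_id.add contDiff_const)) hc hsub
  have hfd : ∀ z, fderiv ℝ (fun z => φ (z + s • τ)) z = fderiv ℝ φ (z + s • τ) := fun z =>
    fderiv_comp_add_right _
  simp only [hfd] at h2
  replace h1 : HasDerivAt (fun h : ℝ => ∫ z, (inner ℝ (u z) (φ (z + h • τ)) : ℝ) ∂μ)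
      (∫ z, (inner ℝ (u z) (fderiv ℝ φ (z + s • τ) τ) : ℝ) ∂μ) s := h1
  rw [h2] at h1
  convert h1 using 1
  refine Finset.sum_congr rfl fun i _ => ?_
  have := integral_add_right_eq_self (μ := μ)
    (fun z => (inner ℝ (V i (z - s • τ)) (fderiv ℝ φ z (e i)) : ℝ)) (s • τ)
  rw [← this]
  simp only [add_sub_cancel_right]

/-- Formally the equation is tested with ψ g(w), and `hconv` says that g(w) is a subgradient of P at
u. Rigorously, the pairing of u with test functions shifted by sτ is differentiated in s. Its
derivative is close to the flux term; its increment is bounded, by convexity, by that of the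
integral of P(u) against the shifted ψ; dividing by s and letting s → 0 gives the claim. -/
theorem IsDistribSolution.energy_le {ι : Type*} [Fintype ι] {U : Set E} {τ : E}
    {e : ι → E} {u w : E → X} {V G : ι → E → X} (h : IsDistribSolution μ U τ e u V)
    (hgrad : HasWeakDerivs μ U e w G) (hU : IsOpen U)
    (hu : AEStronglyMeasurable u μ) {M : ℝ} (huM : ∀ z, ‖u z‖ ≤ M)
    (hw : MemLp w 2 μ) {M' : ℝ} (hwM : ∀ z, ‖w z‖ ≤ M') (hV : ∀ i, MemLp (V i) 2 μ)
    (hG : ∀ i, MemLp (G i) 2 μ) {g : X → X} (hg : ContDiff ℝ ∞ g) {P : X → ℝ} (hP : Continuous P)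
    (hconv : ∀ z z', P (u z) - P (u z') ≤ inner ℝ (u z - u z') (g (w z)))
    {ψ : E → ℝ} (hψ : ContDiff ℝ ∞ ψ) (hψc : HasCompactSupport ψ) (hψU : tsupport ψ ⊆ U)
    (hψ0 : ∀ z, 0 ≤ ψ z) :
    ∑ i, ∫ z, (inner ℝ (V i z) (prodDeriv e ψ g w G i z) : ℝ) ∂μ ≤
      ∫ z, P (u z) * fderiv ℝ ψ z τ ∂μ := by
  obtain ⟨φ, hφ, hφs, ⟨C, hφC⟩, hφlim, hφD⟩ :=
    hgrad.exists_smooth_approx_comp hU hw hG hwM hψ hψc hψU hg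
  have hφc : ∀ n, HasCompactSupport (φ n) := fun n =>
    HasCompactSupport.of_support_subset_isCompact hψc ((subset_tsupport _).trans (hφs n))
  have hul : LocallyIntegrable u μ := locallyIntegrable_of_norm_le hu huM
  obtain ⟨CP, -, hCP⟩ := exists_norm_le_of_continuous hP M
  have hPu : LocallyIntegrable (fun z => P (u z)) μ :=
    locallyIntegrable_of_norm_le (hP.comp_aestronglyMeasurable hu) (fun z => hCP _ (huM z))
  -- translations by small times stay inside
  obtain ⟨h₀, hh₀, hsmall⟩ : ∃ h₀ > 0, ∀ s : ℝ, |s| ≤ h₀ →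
      (fun z => z + s • τ) ⁻¹' tsupport ψ ⊆ U := by
    obtain ⟨δ, hδ, hδU⟩ := hψc.exists_cthickening_subset_open hU hψU
    refine ⟨δ / (‖τ‖ + 1), by positivity, fun s hs z hz => hδU ?_⟩
    refine Metric.mem_cthickening_of_dist_le z (z + s • τ) δ _ hz ?_
    rw [dist_self_add_right, norm_smul, Real.norm_eq_abs]
    calc |s| * ‖τ‖ ≤ δ / (‖τ‖ + 1) * (‖τ‖ + 1) := by gcongr; linarith
      _ = δ := by field_simp
  have hD : ∀ i, MemLp (prodDeriv e ψ g w G i) 2 μ := fun i =>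
    memLp_prodDeriv hψ hψc hg hw.1 hwM i (hG i)
  have hdφ : ∀ n i, MemLp (fun z => fderiv ℝ (φ n) z (e i)) 2 μ := fun n i =>
    memLp_of_continuous_compactSupport (((hφ n).continuous_fderiv (by simp)).clm_apply
      continuous_const) ((hφc n).fderiv_apply ℝ (e i)) 2
  have htr : ∀ i (s : ℝ), MemLp (fun z => V i (z - s • τ)) 2 μ := fun i s =>
    (hV i).comp_measurePreserving (measurePreserving_sub_right μ (s • τ))
  have htrn : ∀ i (s : ℝ), eLpNorm (fun z => V i (z - s • τ)) 2 μ = eLpNorm (V i) 2 μ :=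
    fun i s => eLpNorm_comp_measurePreserving (hV i).1 (measurePreserving_sub_right μ (s • τ))
  set I : ℝ := ∑ i, ∫ z, (inner ℝ (V i z) (prodDeriv e ψ g w G i z) : ℝ) ∂μ with hI
  refine le_of_forall_pos_le_add fun δ hδ => ?_
  -- the modulus of continuity of the translations
  have hω : Tendsto (fun s : ℝ => ∑ i, (eLpNorm (fun z => V i (z - s • τ) - V i z) 2 μ).toReal *
      (eLpNorm (prodDeriv e ψ g w G i) 2 μ).toReal) (𝓝 0) (𝓝 0) := by
    have : Tendsto (fun s : ℝ => s • τ) (𝓝 0) (𝓝 0) := by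
      have : Continuous (fun s : ℝ => s • τ) := by fun_prop
      simpa using this.tendsto 0
    have h1 : ∀ i, Tendsto (fun s : ℝ => (eLpNorm (fun z => V i (z - s • τ) - V i z) 2 μ).toReal *
      (eLpNorm (prodDeriv e ψ g w G i) 2 μ).toReal) (𝓝 0) (𝓝 0) := fun i => by
      have := ((ENNReal.tendsto_toReal ENNReal.zero_ne_top).comp
        ((tendsto_eLpNorm_translate_sub (hV i)).comp this)).mul_const
        (eLpNorm (prodDeriv e ψ g w G i) 2 μ).toReal
      simpa using this
    simpa using tendsto_finsetSum Finset.univ fun i _ => h1 i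
  obtain ⟨h₁, hh₁, hω1⟩ := Metric.eventually_nhds_iff_ball.1
    (hω.eventually (gt_mem_nhds (half_pos hδ)))
  have hn : Tendsto (fun n => ∑ i, (eLpNorm (V i) 2 μ).toReal *
      (eLpNorm ((fun z => fderiv ℝ (φ n) z (e i)) - prodDeriv e ψ g w G i) 2 μ).toReal)
      atTop (𝓝 0) := by
    have h1 : ∀ i, Tendsto (fun n => (eLpNorm (V i) 2 μ).toReal *
      (eLpNorm ((fun z => fderiv ℝ (φ n) z (e i)) - prodDeriv e ψ g w G i) 2 μ).toReal)
      atTop (𝓝 0) := fun i => by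
      have := ((ENNReal.tendsto_toReal ENNReal.zero_ne_top).comp (hφD i)).const_mul
        (eLpNorm (V i) 2 μ).toReal
      simpa using this
    simpa using tendsto_finsetSum Finset.univ fun i _ => h1 i
  have hn1 := hn.eventually (gt_mem_nhds (half_pos hδ))
  -- The error δ is shared equally between the translation modulus of `V` and the gradient error of
  -- `φ n`. The estimate is uniform in s, as the mean value inequality requires.
  have hclose : ∀ᶠ n in atTop, ∀ s : ℝ, |s| < h₁ →
      I - δ ≤ ∑ i, ∫ z, (inner ℝ (V i (z - s • τ)) (fderiv ℝ (φ n) z (e i)) : ℝ) ∂μ := by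
    filter_upwards [hn1] with n hn s hs
    have hs' := hω1 s (by simpa using hs)
    have key : ∀ i, ∫ z, (inner ℝ (V i z) (prodDeriv e ψ g w G i z) : ℝ) ∂μ -
        (eLpNorm (fun z => V i (z - s • τ) - V i z) 2 μ).toReal *
          (eLpNorm (prodDeriv e ψ g w G i) 2 μ).toReal -
        (eLpNorm (V i) 2 μ).toReal *
          (eLpNorm ((fun z => fderiv ℝ (φ n) z (e i)) - prodDeriv e ψ g w G i) 2 μ).toReal ≤
        ∫ z, (inner ℝ (V i (z - s • τ)) (fderiv ℝ (φ n) z (e i)) : ℝ) ∂μ := by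
      intro i
      have a1 := abs_integral_inner_le ((htr i s).sub (hV i)) (hD i)
      have a2 := abs_integral_inner_le (htr i s) ((hdφ n i).sub (hD i))
      rw [htrn] at a2
      have e1 : ∫ z, (inner ℝ (V i (z - s • τ)) (fderiv ℝ (φ n) z (e i)) : ℝ) ∂μ =
          ∫ z, (inner ℝ (V i z) (prodDeriv e ψ g w G i z) : ℝ) ∂μ +
          ∫ z, (inner ℝ (((fun z => V i (z - s • τ)) - V i) z) (prodDeriv e ψ g w G i z) : ℝ) ∂μ +
          ∫ z, (inner ℝ (V i (z - s • τ))
            (((fun z => fderiv ℝ (φ n) z (e i)) - prodDeriv e ψ g w G i) z) : ℝ) ∂μ := by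
        have i1 := integrable_inner_of_memLp (hV i) (hD i)
        have i2 := integrable_inner_of_memLp ((htr i s).sub (hV i)) (hD i)
        rw [← integral_add i1 i2, ← integral_add (by exact i1.add i2)
          (integrable_inner_of_memLp (htr i s) ((hdφ n i).sub (hD i)))]
        refine integral_congr_ae (ae_of_all _ fun z => ?_)
        simp only [Pi.sub_apply, inner_sub_left, inner_sub_right]
        ring
      rw [e1]
      have b1 := neg_abs_le (∫ z, (inner ℝ (((fun z => V i (z - s • τ)) - V i) z)
        (prodDeriv e ψ g w G i z) : ℝ) ∂μ)
      have b2 := neg_abs_le (∫ z, (inner ℝ (V i (z - s • τ))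
            (((fun z => fderiv ℝ (φ n) z (e i)) - prodDeriv e ψ g w G i) z) : ℝ) ∂μ)
      have b3 : (eLpNorm (fun z => V i (z - s • τ) - V i z) 2 μ) =
        eLpNorm ((fun z => V i (z - s • τ)) - V i) 2 μ := rfl
      rw [b3]
      linarith
    have := Finset.sum_le_sum fun i (_ : i ∈ Finset.univ) => key i
    rw [Finset.sum_sub_distrib, Finset.sum_sub_distrib] at this
    linarith
  -- the mean value inequality and the limit of the approximations
  set φ₀ : E → X := fun z => ψ z • g (w z) with hφ₀
  have hφ₀m : AEStronglyMeasurable φ₀ μ :=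
    hψ.continuous.aestronglyMeasurable.smul (hg.continuous.comp_aestronglyMeasurable hw.1)
  obtain ⟨Cg, hCg0, hCg⟩ := exists_norm_le_of_continuous hg.continuous M'
  have hφ₀i : ∀ (a : E → X), AEStronglyMeasurable a μ → (∀ z, ‖a z‖ ≤ M) →
      Integrable (fun z => (inner ℝ (a z) (φ₀ z) : ℝ)) μ := by
    intro a ha haM
    have i1 : Integrable ψ μ := hψ.continuous.integrable_of_hasCompactSupport hψc
    refine Integrable.mono' (i1.norm.const_mul (M * Cg)) (ha.inner hφ₀m) (ae_of_all _ fun z => ?_)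
    refine (norm_inner_le_norm _ _).trans ?_
    simp only [hφ₀]
    rw [norm_smul, mul_assoc, mul_comm Cg]
    exact mul_le_mul (haM z) (mul_le_mul_of_nonneg_left (hCg _ (hwM z)) (norm_nonneg _))
      (by positivity) ((norm_nonneg _).trans (haM z))
  have htru : ∀ s : ℝ, AEStronglyMeasurable (fun z => u (z - s • τ)) μ := fun s =>
    hu.comp_measurePreserving (measurePreserving_sub_right μ (s • τ))
  have hFlim : ∀ s : ℝ, Tendsto (fun n => ∫ z, (inner ℝ (u z) (φ n (z + s • τ)) : ℝ) ∂μ) atTop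
      (𝓝 (∫ z, (inner ℝ (u (z - s • τ)) (φ₀ z) : ℝ) ∂μ)) := by
    intro s
    have e1 : ∀ n, ∫ z, (inner ℝ (u z) (φ n (z + s • τ)) : ℝ) ∂μ =
        ∫ z, (inner ℝ (u (z - s • τ)) (φ n z) : ℝ) ∂μ := by
      intro n
      rw [← integral_add_right_eq_self (fun z => (inner ℝ (u (z - s • τ)) (φ n z) : ℝ)) (s • τ)]
      simp
    simp only [e1]
    have hb : Integrable ((tsupport ψ).indicator (fun _ => M * C)) μ :=
      (integrable_indicator_iff (isClosed_tsupport ψ).measurableSet).2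
        (integrableOn_const hψc.measure_lt_top.ne)
    refine tendsto_integral_of_dominated_convergence _ (fun n => (htru s).inner
      (hφ n).continuous.aestronglyMeasurable) hb (fun n => ae_of_all _ fun z => ?_) ?_
    · refine (norm_inner_le_norm _ _).trans ?_
      by_cases hz : z ∈ tsupport ψ
      · rw [indicator_of_mem hz]
        exact mul_le_mul (huM _) (hφC n z) (norm_nonneg _) ((norm_nonneg _).trans (huM z))
      · rw [indicator_of_notMem hz,
          image_eq_zero_of_notMem_tsupport (fun hz' => hz (hφs n hz'))]
        simp
    · filter_upwards [hφlim] with z hz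
      exact tendsto_const_nhds.inner hz
  have hPt : ∀ s : ℝ, AEStronglyMeasurable (fun z => P (u (z - s • τ))) μ := fun s =>
    hP.comp_aestronglyMeasurable (htru s)
  have hPi : ∀ s : ℝ, Integrable (fun z => P (u (z - s • τ)) * ψ z) μ := by
    intro s
    have i1 : Integrable ψ μ := hψ.continuous.integrable_of_hasCompactSupport hψc
    exact i1.bdd_mul (hPt s) (ae_of_all _ fun z => hCP _ (huM _))
  have hineq : ∀ s : ℝ, 0 < s → s ≤ h₀ → s < h₁ →
      s * (I - δ) ≤ (∫ z, P (u z) * ψ (z + s • τ) ∂μ) - ∫ z, P (u z) * ψ z ∂μ := by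
    intro s hs0 hs1 hs2
    have hMV : ∀ᶠ n in atTop, (I - δ) * (s - 0) ≤ (∫ z, (inner ℝ (u z) (φ n (z + s • τ)) : ℝ) ∂μ) -
        ∫ z, (inner ℝ (u z) (φ n (z + (0 : ℝ) • τ)) : ℝ) ∂μ := by
      filter_upwards [hclose] with n hn
      have hder : ∀ x ∈ Icc (0 : ℝ) s, HasDerivAt
          (fun h : ℝ => ∫ z, (inner ℝ (u z) (φ n (z + h • τ)) : ℝ) ∂μ)
          (∑ i, ∫ z, (inner ℝ (V i (z - x • τ)) (fderiv ℝ (φ n) z (e i)) : ℝ) ∂μ) x := by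
        intro x hx
        refine h.hasDerivAt hul (hφ n) (hφc n) ((preimage_mono (hφs n)).trans (hsmall x ?_))
        rw [abs_of_nonneg hx.1]; exact hx.2.trans hs1
      refine (convex_Icc 0 s).mul_sub_le_image_sub_of_le_deriv
        (fun x hx => (hder x hx).continuousAt.continuousWithinAt)
        (fun x hx => (hder x (interior_subset hx)).differentiableAt.differentiableWithinAt)
        (fun x hx => ?_) 0 ⟨le_rfl, hs0.le⟩ s ⟨hs0.le, le_rfl⟩ hs0.le
      rw [(hder x (interior_subset hx)).deriv]
      have hx' := interior_subset hx
      exact hn x (by rw [abs_of_nonneg hx'.1]; exact hx'.2.trans_lt hs2)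
    have hlim := (hFlim s).sub (hFlim 0)
    have h1 := le_of_tendsto_of_tendsto tendsto_const_nhds hlim hMV
    simp only [zero_smul, sub_zero] at h1
    rw [← integral_sub (hφ₀i _ (htru s) (fun z => huM _)) (hφ₀i _ hu huM)] at h1
    -- Convexity enters here, comparing the values of u at z and at the shifted point; no regularity
    -- of u along τ is involved.
    have h2 : ∫ z, ((inner ℝ (u (z - s • τ)) (φ₀ z) : ℝ) - inner ℝ (u z) (φ₀ z)) ∂μ ≤
        ∫ z, (P (u (z - s • τ)) * ψ z - P (u z) * ψ z) ∂μ := by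
      have hPi0 := hPi 0
      simp only [zero_smul, sub_zero] at hPi0
      refine integral_mono ((hφ₀i _ (htru s) (fun z => huM _)).sub (hφ₀i _ hu huM))
        ((hPi s).sub hPi0) fun z => ?_
      have h3 := mul_le_mul_of_nonneg_left (hconv z (z - s • τ)) (hψ0 z)
      simp only [hφ₀, inner_smul_right, inner_sub_left] at h3 ⊢
      linarith
    have hPi0 := hPi 0
    simp only [zero_smul, sub_zero] at hPi0
    rw [integral_sub (hPi s) hPi0] at h2
    have h4 : ∫ z, P (u z) * ψ (z + s • τ) ∂μ = ∫ z, P (u (z - s • τ)) * ψ z ∂μ := by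
      rw [← integral_add_right_eq_self (fun z => P (u (z - s • τ)) * ψ z) (s • τ)]
      simp
    rw [h4]
    linarith
  have hder := hasDerivAt_integral_translate (μ := μ) (ContinuousLinearMap.mul ℝ ℝ) hPu
    (hψ.of_le (by exact_mod_cast le_top)) hψc τ 0
  simp only [ContinuousLinearMap.mul_apply', zero_smul, add_zero] at hder
  -- The increment inequality is available for s > 0 only, so the right-hand difference quotient is
  -- used.
  have hslope := (hasDerivAt_iff_tendsto_slope_zero.1 hder).mono_left
    (nhdsWithin_mono 0 (fun x (hx : x ∈ Ioi (0 : ℝ)) => ne_of_gt hx))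
  have : I - δ ≤ ∫ z, P (u z) * fderiv ℝ ψ z τ ∂μ := by
    refine ge_of_tendsto hslope ?_
    filter_upwards [Ioo_mem_nhdsGT (lt_min hh₀ hh₁)] with s hs
    have := hineq s hs.1 ((hs.2.trans_le (min_le_left _ _)).le) (hs.2.trans_le (min_le_right _ _))
    simp only [zero_add, zero_smul, add_zero, smul_eq_mul]
    rw [inv_mul_eq_div, le_div_iff₀ hs.1]
    linarith
  linarith

end Energy

/-! ### Parabolic Sobolev inequality -/

section Sobolev

instance isAddHaarMeasure_volume_spaceTime {N : ℕ} :
    (volume : Measure (SpaceTime N)).IsAddHaarMeasure :=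
  inferInstanceAs ((volume : Measure (Space N)).prod (volume : Measure ℝ)).IsAddHaarMeasure

/-- The spatial coordinate directions in space-time. -/
def spaceDir (N : ℕ) (α : Fin N) : SpaceTime N := (EuclideanSpace.single α 1, 0)

/-- The time direction in space-time. -/
def timeDir (N : ℕ) : SpaceTime N := (0, 1)

theorem norm_clm_le_sum {N : ℕ} (L : Space N →L[ℝ] ℝ) :
    ‖L‖ ≤ ∑ i, ‖L (EuclideanSpace.single i 1)‖ := by
  refine L.opNorm_le_bound (Finset.sum_nonneg fun i _ => norm_nonneg _) fun x => ?_
  have hx : x = ∑ i, x i • (EuclideanSpace.single i (1 : ℝ)) := by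
    have := (EuclideanSpace.basisFun (Fin N) ℝ).sum_repr x
    simpa using this.symm
  conv_lhs => rw [hx]
  rw [map_sum, Finset.sum_mul]
  refine (norm_sum_le _ _).trans (Finset.sum_le_sum fun i _ => ?_)
  rw [map_smul, norm_smul, mul_comm]
  exact mul_le_mul_of_nonneg_left (PiLp.norm_apply_le x i) (norm_nonneg _)

/-- The Sobolev exponent `2^* = 2 N / (N - 2)`. -/
def sobolevExp (N : ℕ) : NNReal := Real.toNNReal (2 * N / ((N : ℝ) - 2))

theorem coe_sobolevExp {N : ℕ} (hN : 2 < N) : (sobolevExp N : ℝ) = 2 * N / ((N : ℝ) - 2) := by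
  have : (2 : ℝ) < N := by exact_mod_cast hN
  exact Real.coe_toNNReal _ (div_nonneg (by positivity) (by linarith))

/-- The Gagliardo-Nirenberg-Sobolev inequality on a time slice, for test functions. -/
theorem eLpNorm_slice_le {N : ℕ} (hN : 2 < N) :
    ∃ C : NNReal, ∀ φ : SpaceTime N → ℝ, ContDiff ℝ ∞ φ → HasCompactSupport φ → ∀ t : ℝ,
      eLpNorm (fun x => φ (x, t)) (sobolevExp N) volume ≤
        C * ∑ i, eLpNorm (fun x => fderiv ℝ φ (x, t) (spaceDir N i)) 2 volume := by
  refine ⟨SNormLESNormFDerivOfEqConst ℝ (volume : Measure (Space N)) 2, fun φ hφ hφc t => ?_⟩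
  have hN' : (2 : ℝ) < N := by exact_mod_cast hN
  have hsl : ContDiff ℝ ∞ (fun x : Space N => φ (x, t)) :=
    hφ.comp (contDiff_id.prodMk contDiff_const)
  have hslc : HasCompactSupport (fun x : Space N => φ (x, t)) := by
    refine HasCompactSupport.of_support_subset_isCompact (hφc.image continuous_fst) fun x hx => ?_
    exact ⟨(x, t), subset_tsupport _ hx, rfl⟩
  have h1 := eLpNorm_le_eLpNorm_fderiv_of_eq (F := ℝ) (volume : Measure (Space N))
    (hsl.of_le (by exact_mod_cast le_top)) hslc (p := 2) (p' := sobolevExp N) (by norm_num)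
    (by simp; lia) (by
      rw [coe_sobolevExp hN]
      simp only [finrank_euclideanSpace, Fintype.card_fin]
      push_cast
      have : (N : ℝ) - 2 ≠ 0 := by linarith
      field_simp)
  refine h1.trans (mul_le_mul_right ?_ _)
  have hd : ∀ x, fderiv ℝ (fun x : Space N => φ (x, t)) x =
      (fderiv ℝ φ (x, t)).comp (ContinuousLinearMap.inl ℝ (Space N) ℝ) := by
    intro x
    have a1 := (hφ.differentiable (by simp) (x, t)).hasFDerivAt
    have a2 : HasFDerivAt (fun x : Space N => (x, t)) (ContinuousLinearMap.inl ℝ (Space N) ℝ) x :=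
      hasFDerivAt_prodMk_left x t
    exact (a1.comp x a2).fderiv
  calc eLpNorm (fderiv ℝ fun x => φ (x, t)) (2 : NNReal) volume
      ≤ eLpNorm (fun x => ∑ i, ‖fderiv ℝ φ (x, t) (spaceDir N i)‖) 2 volume := by
        refine eLpNorm_mono fun x => ?_
        rw [Real.norm_of_nonneg (Finset.sum_nonneg fun i _ => norm_nonneg _), hd]
        exact norm_clm_le_sum _
    _ ≤ ∑ i, eLpNorm (fun x => ‖fderiv ℝ φ (x, t) (spaceDir N i)‖) 2 volume := by
        have := eLpNorm_sum_le (μ := volume) (p := 2) (s := Finset.univ)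
          (f := fun i (x : Space N) => ‖fderiv ℝ φ (x, t) (spaceDir N i)‖) (fun i _ => ?_)
          (by norm_num)
        · refine le_of_eq_of_le ?_ this
          congr 1
          ext x; simp
        · have : Continuous (fderiv ℝ φ) := hφ.continuous_fderiv (by simp)
          exact Continuous.aestronglyMeasurable (by fun_prop)
    _ = _ := by simp only [eLpNorm_norm]

/-- A sequence converging to `0` in `L¹` has a subsequence converging a.e. -/
theorem exists_subseq_tendsto_ae_of_lintegral {α : Type*} [MeasurableSpace α] {ν : Measure α}
    {h : ℕ → α → ℝ≥0∞} (hm : ∀ n, AEMeasurable (h n) ν)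
    (hlim : Tendsto (fun n => ∫⁻ x, h n x ∂ν) atTop (𝓝 0)) :
    ∃ ns : ℕ → ℕ, StrictMono ns ∧ ∀ᵐ x ∂ν, Tendsto (fun k => h (ns k) x) atTop (𝓝 0) := by
  obtain ⟨ns, hns, hle⟩ := extraction_forall_of_eventually
    (P := fun k n => ∫⁻ x, h n x ∂ν ≤ (2⁻¹ : ℝ≥0∞) ^ k) (fun k =>
      ENNReal.tendsto_nhds_zero.1 hlim _ (pos_iff_ne_zero.2 (pow_ne_zero _ (by simp))))
  refine ⟨ns, hns, ?_⟩
  -- The subsequence was chosen with summable integrals, so the series is finite almost everywhere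
  -- and its terms tend to zero.
  have h1 : ∫⁻ x, ∑' k, h (ns k) x ∂ν ≠ ⊤ := by
    rw [lintegral_tsum fun k => hm _]
    refine ne_top_of_le_ne_top ?_ (ENNReal.tsum_le_tsum hle)
    rw [ENNReal.tsum_geometric]
    simp
  filter_upwards [ae_lt_top' (AEMeasurable.tsum fun k => hm (ns k)) h1] with x hx
  exact ENNReal.tendsto_atTop_zero_of_tsum_ne_top hx.ne

variable {N : ℕ} {X : Type*} [NormedAddCommGroup X] [NormedSpace ℝ X] [FiniteDimensional ℝ X]

theorem ae_ae_slice {p : SpaceTime N → Prop} (h : ∀ᵐ z, p z) :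
    ∀ᵐ t : ℝ, ∀ᵐ x : Space N, p (x, t) := by
  have h1 : ∀ᵐ z ∂((volume : Measure ℝ).prod (volume : Measure (Space N))), p z.swap := by
    rw [Measure.volume_eq_prod, ← Measure.prod_swap] at h
    exact ae_of_ae_map measurable_swap.aemeasurable h
  exact Measure.ae_ae_of_ae_prod h1

theorem ae_aestronglyMeasurable_slice {Y : Type*} [TopologicalSpace Y]
    {v : SpaceTime N → Y} (h : AEStronglyMeasurable v) :
    ∀ᵐ t : ℝ, AEStronglyMeasurable (fun x : Space N => v (x, t)) := by
  rw [Measure.volume_eq_prod] at h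
  exact h.prod_swap.prodMk_left

theorem lintegral_eq_slices {h : SpaceTime N → ℝ≥0∞} (hm : AEMeasurable h) :
    ∫⁻ z, h z = ∫⁻ t : ℝ, ∫⁻ x : Space N, h (x, t) := by
  rw [Measure.volume_eq_prod] at hm ⊢
  exact lintegral_prod_symm _ hm

theorem aemeasurable_lintegral_slice {h : SpaceTime N → ℝ≥0∞} (hm : AEMeasurable h) :
    AEMeasurable (fun t : ℝ => ∫⁻ x : Space N, h (x, t)) := by
  rw [Measure.volume_eq_prod] at hm
  exact hm.prod_swap.lintegral_prod_right'

/-- The slice inequality holds for the smooth approximations. Along a subsequence their gradients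
converge in L² on almost every slice, and Fatou's lemma handles the left side. The function f(w) is
scalar, so the constant can be chosen before the target space `X`. -/
theorem sobolev_slice (hN : 2 < N) : ∃ C : NNReal, ∀ (X : Type) [NormedAddCommGroup X]
    [NormedSpace ℝ X] [FiniteDimensional ℝ X] (U : Set (SpaceTime N)) (w : SpaceTime N → X)
    (G : Fin N → SpaceTime N → X) (M : ℝ) (ξ : SpaceTime N → ℝ) (f : X → ℝ),
    HasWeakDerivs volume U (spaceDir N) w G → IsOpen U → MemLp w 2 → (∀ i, MemLp (G i) 2) →
    (∀ z, ‖w z‖ ≤ M) → ContDiff ℝ ∞ ξ → HasCompactSupport ξ → tsupport ξ ⊆ U → ContDiff ℝ ∞ f →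
    ∀ᵐ t : ℝ, eLpNorm (fun x => ξ (x, t) • f (w (x, t))) (sobolevExp N) volume ≤
      C * ∑ i, eLpNorm (fun x => prodDeriv (spaceDir N) ξ f w G i (x, t)) 2 volume := by
  obtain ⟨C, hC⟩ := eLpNorm_slice_le hN
  refine ⟨C, fun X _ _ _ U w G M ξ f h hU hw hG hM hξ hξc hξU hf => ?_⟩
  obtain ⟨φ, hφ, hφs, -, hφlim, hφD⟩ := h.exists_smooth_approx_comp hU hw hG hM hξ hξc hξU hf
  have hφc : ∀ n, HasCompactSupport (φ n) := fun n =>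
    HasCompactSupport.of_support_subset_isCompact hξc ((subset_tsupport _).trans (hφs n))
  set D := prodDeriv (spaceDir N) ξ f w G with hD
  have hDm : ∀ i, AEStronglyMeasurable (D i) := fun i =>
    aestronglyMeasurable_prodDeriv hξ hf hw.1 i (hG i).1
  have hφm : ∀ n i, AEStronglyMeasurable (fun z => fderiv ℝ (φ n) z (spaceDir N i)) := fun n i =>
    (((hφ n).continuous_fderiv (by simp)).clm_apply continuous_const).aestronglyMeasurable
  have hdm : ∀ n i, AEMeasurable (fun z => ‖fderiv ℝ (φ n) z (spaceDir N i) - D i z‖ₑ ^ (2 : ℝ)) :=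
    fun n i => ((hφm n i).sub (hDm i)).enorm.pow_const _
  obtain ⟨ns, hns, hlim⟩ := exists_subseq_tendsto_ae_of_lintegral (ν := (volume : Measure ℝ))
    (h := fun n t => ∑ i, ∫⁻ x, ‖fderiv ℝ (φ n) (x, t) (spaceDir N i) - D i (x, t)‖ₑ ^ (2 : ℝ))
    (fun n => Finset.aemeasurable_fun_sum _ fun i _ => aemeasurable_lintegral_slice (hdm n i)) (by
      have h1 : ∀ n, ∫⁻ t : ℝ, ∑ i, ∫⁻ x,
          ‖fderiv ℝ (φ n) (x, t) (spaceDir N i) - D i (x, t)‖ₑ ^ (2 : ℝ) =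
          ∑ i, ∫⁻ z, ‖fderiv ℝ (φ n) z (spaceDir N i) - D i z‖ₑ ^ (2 : ℝ) := fun n => by
        rw [lintegral_finsetSum' _ fun i _ => aemeasurable_lintegral_slice (hdm n i)]
        exact Finset.sum_congr rfl fun i _ => (lintegral_eq_slices (hdm n i)).symm
      simp only [h1]
      have h2 := tendsto_finsetSum Finset.univ fun i _ => tendsto_eLpNorm_two_iff.1 (hφD i)
      simpa using h2)
  filter_upwards [hlim, ae_ae_slice hφlim, ae_all_iff.2 fun i => ae_aestronglyMeasurable_slice
    (hDm i)] with t ht1 ht2 ht3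
  have hfat := Lp.eLpNorm_lim_le_liminf_eLpNorm (p := (sobolevExp N : ℝ≥0∞))
    (f := fun k x => φ (ns k) (x, t)) (μ := (volume : Measure (Space N)))
    (fun k => ((hφ _).continuous.comp (by fun_prop : Continuous fun x : Space N =>
      (x, t))).aestronglyMeasurable) (fun x => ξ (x, t) • f (w (x, t)))
    (by filter_upwards [ht2] with x hx using hx.comp hns.tendsto_atTop)
  refine hfat.trans ?_
  have hbd : ∀ k, eLpNorm (fun x => φ (ns k) (x, t)) (sobolevExp N) volume ≤
      C * ∑ i, (eLpNorm (fun x => D i (x, t)) 2 volume +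
        eLpNorm (fun x => fderiv ℝ (φ (ns k)) (x, t) (spaceDir N i) - D i (x, t)) 2 volume) := by
    intro k
    refine (hC (φ (ns k)) (hφ _) (hφc _) t).trans ?_
    gcongr with i
    have hcm : AEStronglyMeasurable
        (fun x : Space N => fderiv ℝ (φ (ns k)) (x, t) (spaceDir N i)) volume :=
      ((((hφ (ns k)).continuous_fderiv (by simp)).clm_apply continuous_const).comp
        (by fun_prop : Continuous fun x : Space N => (x, t))).aestronglyMeasurable
    have := eLpNorm_add_le (p := 2) (ht3 i) (hcm.sub (ht3 i)) (by norm_num)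
    refine le_of_eq_of_le ?_ this
    congr 1
    ext x; simp
  have hto : Tendsto (fun k => (C : ℝ≥0∞) * ∑ i, (eLpNorm (fun x => D i (x, t)) 2 volume +
      eLpNorm (fun x => fderiv ℝ (φ (ns k)) (x, t) (spaceDir N i) - D i (x, t)) 2 volume)) atTop
      (𝓝 (C * ∑ i, (eLpNorm (fun x => D i (x, t)) 2 volume + 0))) := by
    refine ENNReal.Tendsto.const_mul (tendsto_finsetSum _ fun i _ => tendsto_const_nhds.add ?_)
      (Or.inr ENNReal.coe_ne_top)
    refine tendsto_eLpNorm_two_iff.2 (tendsto_of_tendsto_of_tendsto_of_le_of_le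
      tendsto_const_nhds ht1 (fun k => zero_le) fun k => ?_)
    exact Finset.single_le_sum (f := fun i => ∫⁻ x,
      ‖fderiv ℝ (φ (ns k)) (x, t) (spaceDir N i) - D i (x, t)‖ₑ ^ (2 : ℝ))
      (fun i _ => zero_le) (Finset.mem_univ i)
  simp only [add_zero] at hto
  exact (liminf_le_liminf (Eventually.of_forall hbd)).trans hto.liminf_eq.le

/-- Hölder's inequality with conjugate exponents N/(N-2) and N/2: the first turns the square into
the Sobolev power, the second turns 2γ/N into γ. -/
theorem lintegral_interpolation {α : Type*} [MeasurableSpace α] {ν : Measure α} (hN : 2 < N)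
    {v : α → ℝ} (hv : AEStronglyMeasurable v ν) {γ : ℝ} (hγ : 0 ≤ γ) :
    ∫⁻ x, ‖v x‖ₑ ^ (2 + 2 * γ / N) ∂ν ≤
      (eLpNorm v (sobolevExp N) ν) ^ (2 : ℝ) * (∫⁻ x, ‖v x‖ₑ ^ γ ∂ν) ^ (2 / (N : ℝ)) := by
  have hN' : (2 : ℝ) < N := by exact_mod_cast hN
  have hN2 : (N : ℝ) - 2 ≠ 0 := by linarith
  have hpq : (N / ((N : ℝ) - 2)).HolderConjugate (N / 2) := by
    rw [Real.holderConjugate_iff]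
    constructor
    · rw [lt_div_iff₀ (by linarith)]; linarith
    · field_simp; ring
  have h := ENNReal.lintegral_mul_le_Lp_mul_Lq ν hpq
    (f := fun x => ‖v x‖ₑ ^ (2 : ℝ)) (g := fun x => ‖v x‖ₑ ^ (2 * γ / N))
    (hv.enorm.pow_const _) (hv.enorm.pow_const _)
  have e1 : ∀ x, ((fun x => ‖v x‖ₑ ^ (2 : ℝ)) * fun x => ‖v x‖ₑ ^ (2 * γ / N)) x =
      ‖v x‖ₑ ^ (2 + 2 * γ / N) := fun x => by
    simp only [Pi.mul_apply]
    rw [← ENNReal.rpow_add_of_nonneg _ _ (by norm_num) (by positivity)]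
  simp only [e1, ← ENNReal.rpow_mul] at h
  have hs0 : (sobolevExp N : ℝ≥0∞) ≠ 0 := by
    rw [ENNReal.coe_ne_zero, ← NNReal.coe_ne_zero, coe_sobolevExp hN]
    have : (0 : ℝ) < N := by linarith
    positivity
  rw [eLpNorm_eq_lintegral_rpow_enorm_toReal hs0 ENNReal.coe_ne_top, ← ENNReal.rpow_mul]
  simp only [ENNReal.coe_toReal, coe_sobolevExp hN]
  convert h using 3
  · congr! 3
    ring
  · field_simp
  · congr! 3
    field_simp
  · field_simp

/-- The parabolic Sobolev inequality for truncations. -/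
theorem parabolic_sobolev (hN : 2 < N) : ∃ C : ℝ≥0∞, C ≠ ⊤ ∧ ∀ (X : Type) [NormedAddCommGroup X]
    [NormedSpace ℝ X] [FiniteDimensional ℝ X] (U : Set (SpaceTime N)) (w : SpaceTime N → X)
    (G : Fin N → SpaceTime N → X) (M : ℝ) (ξ : SpaceTime N → ℝ) (f : X → ℝ) (γ : ℝ) (R : ℝ≥0∞),
    HasWeakDerivs volume U (spaceDir N) w G → IsOpen U → MemLp w 2 → (∀ i, MemLp (G i) 2) →
    (∀ z, ‖w z‖ ≤ M) → ContDiff ℝ ∞ ξ → HasCompactSupport ξ → tsupport ξ ⊆ U → ContDiff ℝ ∞ f →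
    0 ≤ γ → (∀ᵐ t : ℝ, ∫⁻ x, ‖ξ (x, t) • f (w (x, t))‖ₑ ^ γ ≤ R) →
    ∫⁻ z, ‖ξ z • f (w z)‖ₑ ^ (2 + 2 * γ / N) ≤
      C * R ^ (2 / (N : ℝ)) * ∑ i, ∫⁻ z, ‖prodDeriv (spaceDir N) ξ f w G i z‖ₑ ^ (2 : ℝ) := by
  obtain ⟨C, hC⟩ := sobolev_slice hN
  refine ⟨(C : ℝ≥0∞) ^ (2 : ℝ) * N, by finiteness, fun X _ _ _ U w G M ξ f γ R h hU hw hG hM hξ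
    hξc hξU hf hγ hR => ?_⟩
  have hS := hC X U w G M ξ f h hU hw hG hM hξ hξc hξU hf
  have hvm : AEStronglyMeasurable (fun z => ξ z • f (w z)) :=
    hξ.continuous.aestronglyMeasurable.smul (hf.continuous.comp_aestronglyMeasurable hw.1)
  have hDm : ∀ i, AEMeasurable
      (fun z => ‖prodDeriv (spaceDir N) ξ f w G i z‖ₑ ^ (2 : ℝ)) := fun i =>
    (aestronglyMeasurable_prodDeriv hξ hf hw.1 i (hG i).1).enorm.pow_const _
  rw [lintegral_eq_slices (hvm.enorm.pow_const _)]
  calc _ ≤ ∫⁻ t : ℝ, (C : ℝ≥0∞) ^ (2 : ℝ) * N * R ^ (2 / (N : ℝ)) * ∑ i, ∫⁻ x,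
        ‖prodDeriv (spaceDir N) ξ f w G i (x, t)‖ₑ ^ (2 : ℝ) := by
        refine lintegral_mono_ae ?_
        filter_upwards [hR, hS, ae_aestronglyMeasurable_slice hvm] with t h1 h2 h3
        refine (lintegral_interpolation hN h3 hγ).trans ?_
        have h4 : eLpNorm (fun x => ξ (x, t) • f (w (x, t))) (sobolevExp N) volume ^ (2 : ℝ) ≤
            (C : ℝ≥0∞) ^ (2 : ℝ) * (N * ∑ i, ∫⁻ x,
              ‖prodDeriv (spaceDir N) ξ f w G i (x, t)‖ₑ ^ (2 : ℝ)) := by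
          refine (ENNReal.rpow_le_rpow h2 (by norm_num)).trans ?_
          rw [ENNReal.mul_rpow_of_nonneg _ _ (by norm_num)]
          gcongr
          simp only [← eLpNorm_two_rpow_two]
          -- The factor N comes from squaring a sum of N terms.
          have := ENNReal.rpow_sum_le_const_mul_sum_rpow (Finset.univ : Finset (Fin N))
            (fun i => eLpNorm (fun x => prodDeriv (spaceDir N) ξ f w G i (x, t)) 2 volume)
            (p := 2) (by norm_num)
          refine this.trans_eq ?_
          congr 1
          norm_num
        calc _ ≤ _ := mul_le_mul' h4 (ENNReal.rpow_le_rpow h1 (by positivity))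
          _ = _ := by ring
    _ = _ := by
        rw [lintegral_const_mul'' _ (Finset.aemeasurable_fun_sum _ fun i _ =>
          aemeasurable_lintegral_slice (hDm i)),
          lintegral_finsetSum' _ fun i _ => aemeasurable_lintegral_slice (hDm i)]
        congr 1
        exact Finset.sum_congr rfl fun i _ => (lintegral_eq_slices (hDm i)).symm

end Sobolev

/-! ### Smooth truncation of powers -/

section Truncation

/-- The transition function is locally constant off the unit interval, and there compactness bounds
its derivative. -/
theorem exists_smoothTransition_deriv_le :
    ∃ L : ℝ, 1 ≤ L ∧ ∀ x, |deriv Real.smoothTransition x| ≤ L := by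
  have hc : Continuous (deriv Real.smoothTransition) :=
    (Real.smoothTransition.contDiff (n := 1)).continuous_deriv (by simp)
  obtain ⟨L, hL⟩ := isCompact_Icc.exists_bound_of_continuousOn
    (hc.continuousOn (s := Icc (0 : ℝ) 1))
  refine ⟨max L 1, le_max_right _ _, fun x => ?_⟩
  by_cases h0 : x < 0
  · have : Real.smoothTransition =ᶠ[𝓝 x] fun _ => 0 := by
      filter_upwards [Iio_mem_nhds h0] with y hy
      exact Real.smoothTransition.zero_of_nonpos (le_of_lt hy)
    rw [this.deriv_eq, deriv_const, abs_zero]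
    exact le_max_of_le_right zero_le_one
  by_cases h1 : 1 < x
  · have : Real.smoothTransition =ᶠ[𝓝 x] fun _ => 1 := by
      filter_upwards [Ioi_mem_nhds h1] with y hy
      exact Real.smoothTransition.one_of_one_le (le_of_lt hy)
    rw [this.deriv_eq, deriv_const, abs_zero]
    exact le_max_of_le_right zero_le_one
  · exact (hL x ⟨not_lt.1 h0, not_lt.1 h1⟩).trans (le_max_left _ _)

/-- A bound for the derivative of `Real.smoothTransition`. -/
def transitionBound : ℝ := exists_smoothTransition_deriv_le.choose

theorem one_le_transitionBound : 1 ≤ transitionBound :=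
  exists_smoothTransition_deriv_le.choose_spec.1

theorem abs_deriv_smoothTransition_le (x : ℝ) :
    |deriv Real.smoothTransition x| ≤ transitionBound :=
  exists_smoothTransition_deriv_le.choose_spec.2 x

theorem deriv_smoothTransition_nonneg (x : ℝ) : 0 ≤ deriv Real.smoothTransition x :=
  Real.smoothTransition.monotone.deriv_nonneg

/-- A smooth monotone function which is `0` below `k` and `1` above `k'`. -/
def cutoff (k k' q : ℝ) : ℝ := Real.smoothTransition ((q - k) / (k' - k))

variable {k k' q : ℝ}

theorem cutoff_nonneg : 0 ≤ cutoff k k' q := Real.smoothTransition.nonneg _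

theorem cutoff_le_one : cutoff k k' q ≤ 1 := Real.smoothTransition.le_one _

theorem cutoff_eq_zero (hk : k < k') (h : q ≤ k) : cutoff k k' q = 0 :=
  Real.smoothTransition.zero_of_nonpos (div_nonpos_of_nonpos_of_nonneg (by linarith) (by linarith))

theorem cutoff_eq_one (hk : k < k') (h : k' ≤ q) : cutoff k k' q = 1 :=
  Real.smoothTransition.one_of_one_le (by rw [le_div_iff₀ (by linarith)]; linarith)

theorem contDiff_cutoff : ContDiff ℝ ∞ (cutoff k k') :=
  (Real.smoothTransition.contDiff (n := ⊤)).comp ((contDiff_id.sub contDiff_const).div_const _)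

theorem deriv_cutoff : deriv (cutoff k k') q =
    deriv Real.smoothTransition ((q - k) / (k' - k)) / (k' - k) := by
  have h1 : HasDerivAt (fun q : ℝ => (q - k) / (k' - k)) (1 / (k' - k)) q :=
    ((hasDerivAt_id q).sub_const k).div_const _
  have h2 : HasDerivAt Real.smoothTransition _ ((q - k) / (k' - k)) :=
    ((Real.smoothTransition.contDiff (n := 1)).differentiable one_ne_zero _).hasDerivAt
  rw [show cutoff k k' = Real.smoothTransition ∘ fun q : ℝ => (q - k) / (k' - k) from rfl,
    (h2.comp q h1).deriv]
  ring

theorem hasDerivAt_cutoff : HasDerivAt (cutoff k k') (deriv (cutoff k k') q) q :=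
  ((contDiff_cutoff (k := k) (k' := k')).differentiable (by simp) q).hasDerivAt

theorem deriv_cutoff_nonneg (hk : k < k') : 0 ≤ deriv (cutoff k k') q := by
  rw [deriv_cutoff]
  exact div_nonneg (deriv_smoothTransition_nonneg _) (by linarith)

theorem abs_deriv_cutoff_le (hk : k < k') :
    |deriv (cutoff k k') q| ≤ transitionBound / (k' - k) := by
  rw [deriv_cutoff, abs_div, abs_of_pos (sub_pos.2 hk)]
  exact div_le_div_of_nonneg_right (abs_deriv_smoothTransition_le _) (by linarith)

theorem deriv_cutoff_eq_zero_of_lt (hk : k < k') (h : k' < q) : deriv (cutoff k k') q = 0 := by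
  have : cutoff k k' =ᶠ[𝓝 q] fun _ => 1 := by
    filter_upwards [Ioi_mem_nhds h] with y hy using cutoff_eq_one hk (le_of_lt hy)
  rw [this.deriv_eq, deriv_const]

/-- Where the derivative is nonzero, q is at most k'. The resulting bound depends only on the ratio
of the two levels. -/
theorem mul_deriv_cutoff_le (hk0 : 0 < k) (hk : k < k') :
    q * deriv (cutoff k k') q ≤ transitionBound * (k' / (k' - k)) := by
  have hT := one_le_transitionBound
  by_cases h : k' < q
  · rw [deriv_cutoff_eq_zero_of_lt hk h, mul_zero]
    exact mul_nonneg (by linarith) (div_nonneg (by linarith) (by linarith))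
  · have h1 := (le_abs_self _).trans (abs_deriv_cutoff_le (q := q) hk)
    calc q * deriv (cutoff k k') q ≤ k' * (transitionBound / (k' - k)) :=
          mul_le_mul (not_lt.1 h) h1 (deriv_cutoff_nonneg hk) (by linarith)
      _ = _ := by ring

/-- The truncated power `χ(q)² q^c`. -/
def truncPow (k k' c q : ℝ) : ℝ := cutoff k k' q ^ 2 * q ^ c

theorem truncPow_eventuallyEq_zero {c : ℝ} (hk : k < k') (h : q < k) :
    truncPow k k' c =ᶠ[𝓝 q] fun _ => 0 := by
  filter_upwards [Iio_mem_nhds h] with y hy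
  simp [truncPow, cutoff_eq_zero hk (le_of_lt hy)]

/-- The power is singular only at 0, and the cutoff vanishes below the positive level k. -/
theorem contDiff_truncPow {c : ℝ} (hk0 : 0 < k) (hk : k < k') : ContDiff ℝ ∞ (truncPow k k' c) := by
  rw [contDiff_iff_contDiffAt]
  intro q
  by_cases h : q < k
  · exact contDiffAt_const.congr_of_eventuallyEq (truncPow_eventuallyEq_zero hk h)
  · have hq : q ≠ 0 := by linarith
    exact ((contDiff_cutoff.contDiffAt).pow 2).mul (Real.contDiffAt_rpow_const_of_ne hq)

theorem hasDerivAt_truncPow {c : ℝ} (hq : 0 < q) : HasDerivAt (truncPow k k' c)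
    (2 * cutoff k k' q * deriv (cutoff k k') q * q ^ c + cutoff k k' q ^ 2 * (c * q ^ (c - 1)))
    q := by
  have h1 := (hasDerivAt_cutoff (k := k) (k' := k') (q := q)).pow 2
  have h2 := Real.hasDerivAt_rpow_const (p := c) (Or.inl hq.ne')
  refine HasDerivAt.congr_deriv (f := truncPow k k' c) (h1.mul h2) ?_
  simp

theorem deriv_truncPow_eq_zero {c : ℝ} (hk : k < k') (h : q < k) :
    deriv (truncPow k k' c) q = 0 := by
  rw [(truncPow_eventuallyEq_zero hk h).deriv_eq, deriv_const]

theorem deriv_truncPow_nonneg {c : ℝ} (hk0 : 0 < k) (hk : k < k') (hc : 0 ≤ c) :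
    0 ≤ deriv (truncPow k k' c) q := by
  by_cases h : q < k
  · rw [deriv_truncPow_eq_zero hk h]
  · have hq : 0 < q := by linarith
    rw [(hasDerivAt_truncPow hq).deriv]
    have := cutoff_nonneg (k := k) (k' := k') (q := q)
    have := deriv_cutoff_nonneg (q := q) hk
    positivity

/-- This is why the cutoff is squared: one factor χ survives differentiation. Terms containing the
derivative can then be absorbed by an energy weighted with χ². -/
theorem mul_deriv_truncPow_le {c : ℝ} (hk0 : 0 < k) (hk : k < k') (hc : 0 ≤ c) (hq : 0 ≤ q) :
    q * deriv (truncPow k k' c) q ≤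
      cutoff k k' q * q ^ c * (2 * (transitionBound * (k' / (k' - k))) + c) := by
  have h0 := cutoff_nonneg (k := k) (k' := k') (q := q)
  have h1 := cutoff_le_one (k := k) (k' := k') (q := q)
  have hT := one_le_transitionBound
  have hK : 0 ≤ transitionBound * (k' / (k' - k)) :=
    mul_nonneg (by linarith) (div_nonneg (by linarith) (by linarith))
  by_cases h : q < k
  · rw [deriv_truncPow_eq_zero hk h, mul_zero]
    positivity
  · have hq : 0 < q := by linarith
    rw [(hasDerivAt_truncPow hq).deriv]
    have h2 := mul_deriv_cutoff_le (q := q) hk0 hk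
    have h3 : q * q ^ (c - 1) = q ^ c := by
      rw [Real.rpow_sub_one hq.ne']; field_simp
    calc _ = cutoff k k' q * q ^ c * (2 * (q * deriv (cutoff k k') q)) +
          cutoff k k' q * (cutoff k k' q * c) * (q * q ^ (c - 1)) := by ring
      _ = cutoff k k' q * q ^ c * (2 * (q * deriv (cutoff k k') q) + cutoff k k' q * c) := by
          rw [h3]; ring
      _ ≤ _ := by
          gcongr
          exact mul_le_of_le_one_left hc h1

variable {X : Type*} [NormedAddCommGroup X] [InnerProductSpace ℝ X]

theorem hasFDerivAt_comp_norm_sq {Γ : ℝ → ℝ} (hΓ : ContDiff ℝ ∞ Γ) (w : X) :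
    HasFDerivAt (fun w : X => Γ (‖w‖ ^ 2)) ((deriv Γ (‖w‖ ^ 2)) • (2 • innerSL ℝ w)) w := by
  have h1 : HasFDerivAt (fun w : X => ‖w‖ ^ 2) (2 • innerSL ℝ w) w :=
    (hasStrictFDerivAt_norm_sq w).hasFDerivAt
  exact ((hΓ.differentiable (by simp) _).hasDerivAt).comp_hasFDerivAt w h1

theorem fderiv_comp_norm_sq {Γ : ℝ → ℝ} (hΓ : ContDiff ℝ ∞ Γ) (w v : X) :
    fderiv ℝ (fun w : X => Γ (‖w‖ ^ 2)) w v = 2 * deriv Γ (‖w‖ ^ 2) * inner ℝ w v := by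
  rw [(hasFDerivAt_comp_norm_sq hΓ w).fderiv]
  simp
  ring

theorem fderiv_comp_norm_sq_smul {Γ : ℝ → ℝ} (hΓ : ContDiff ℝ ∞ Γ) (w v : X) :
    fderiv ℝ (fun w : X => Γ (‖w‖ ^ 2) • w) w v =
      Γ (‖w‖ ^ 2) • v + (2 * deriv Γ (‖w‖ ^ 2) * inner ℝ w v) • w := by
  have h := (hasFDerivAt_comp_norm_sq hΓ w).smul (hasFDerivAt_id w)
  have h' : HasFDerivAt (fun w : X => Γ (‖w‖ ^ 2) • w) _ w := h
  rw [h'.fderiv]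
  simp
  ring_nf

theorem contDiff_comp_norm_sq {Γ : ℝ → ℝ} (hΓ : ContDiff ℝ ∞ Γ) :
    ContDiff ℝ ∞ (fun w : X => Γ (‖w‖ ^ 2)) :=
  hΓ.comp (contDiff_norm_sq ℝ)

end Truncation

/-! ### The convex radial potential -/

section Potential

/-- The derivative of `radialPotential`. -/
def radialDensity (k k' m r a : ℝ) : ℝ := cutoff k k' (a ^ (2 * m)) ^ 2 * a ^ (r - 1)

/-- The potential `∫₀^a χ(s^{2m})² s^{r-1} ds`. -/
def radialPotential (k k' m r a : ℝ) : ℝ := ∫ s in (0 : ℝ)..a, radialDensity k k' m r s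

variable {k k' m r a : ℝ}

theorem continuous_radialDensity (hm : 0 < m) (hr : 1 ≤ r) :
    Continuous (radialDensity k k' m r) := by
  refine ((contDiff_cutoff.continuous.comp (Real.continuous_rpow_const (by positivity))).pow 2).mul
    (Real.continuous_rpow_const (by linarith))

theorem hasDerivAt_radialPotential (hm : 0 < m) (hr : 1 ≤ r) :
    HasDerivAt (radialPotential k k' m r) (radialDensity k k' m r a) a :=
  (continuous_radialDensity hm hr).integral_hasStrictDerivAt 0 a |>.hasDerivAt

theorem radialDensity_nonneg (ha : 0 ≤ a) : 0 ≤ radialDensity k k' m r a :=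
  mul_nonneg (sq_nonneg _) (Real.rpow_nonneg ha _)

theorem cutoff_mono (hk : k < k') {x y : ℝ} (h : x ≤ y) : cutoff k k' x ≤ cutoff k k' y :=
  Real.smoothTransition.monotone (div_le_div_of_nonneg_right (by linarith) (by linarith))

theorem radialDensity_mono (hk : k < k') (hm : 0 < m) (hr : 1 ≤ r) {x y : ℝ} (hx : 0 ≤ x)
    (h : x ≤ y) : radialDensity k k' m r x ≤ radialDensity k k' m r y := by
  refine mul_le_mul (pow_le_pow_left₀ cutoff_nonneg (cutoff_mono hk ?_) 2)
    (Real.rpow_le_rpow hx h (by linarith)) (Real.rpow_nonneg hx _) (sq_nonneg _)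
  exact Real.rpow_le_rpow hx h (by linarith)

theorem radialPotential_nonneg (ha : 0 ≤ a) : 0 ≤ radialPotential k k' m r a :=
  intervalIntegral.integral_nonneg ha fun _ hs => radialDensity_nonneg hs.1

/-- A primitive of a nondecreasing function lies above its tangents; the density is nondecreasing
because r ≥ 1. -/
theorem radialPotential_sub_le (hk : k < k') (hm : 0 < m) (hr : 1 ≤ r) {x y : ℝ} (hx : 0 ≤ x)
    (hy : 0 ≤ y) : radialPotential k k' m r x - radialPotential k k' m r y ≤
      (x - y) * radialDensity k k' m r x := by
  have hi : ∀ a b, IntervalIntegrable (radialDensity k k' m r) volume a b := fun a b =>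
    (continuous_radialDensity hm hr).intervalIntegrable a b
  rw [radialPotential, radialPotential, intervalIntegral.integral_interval_sub_left (hi _ _) (hi _ _)]
  rcases le_total y x with h | h
  · have := intervalIntegral.integral_mono_on (f := radialDensity k k' m r)
      (g := fun _ => radialDensity k k' m r x) h (hi _ _) (by simp) (fun s hs =>
        radialDensity_mono hk hm hr (hy.trans hs.1) hs.2)
    simpa using this
  · have := intervalIntegral.integral_mono_on (g := radialDensity k k' m r)
      (f := fun _ => radialDensity k k' m r x) h (by simp) (hi _ _) (fun s hs =>
        radialDensity_mono hk hm hr hx hs.1)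
    rw [intervalIntegral.integral_symm]
    simp only [intervalIntegral.integral_const, smul_eq_mul] at this
    linarith

theorem radialPotential_le (hk : k < k') (hm : 0 < m) (hr : 1 ≤ r) (ha : 0 ≤ a) :
    radialPotential k k' m r a ≤ if k < a ^ (2 * m) then a ^ r else 0 := by
  have h := radialPotential_sub_le hk hm hr ha le_rfl
  have h0 : radialPotential k k' m r 0 = 0 := by simp [radialPotential]
  rw [h0, sub_zero, sub_zero] at h
  refine h.trans ?_
  rw [radialDensity]
  split_ifs with hka
  · rcases ha.eq_or_lt with rfl | ha'
    · simp; positivity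
    · have h1 : a * a ^ (r - 1) = a ^ r := by rw [Real.rpow_sub_one ha'.ne']; field_simp
      calc _ = cutoff k k' (a ^ (2 * m)) ^ 2 * (a * a ^ (r - 1)) := by ring
        _ ≤ 1 * (a * a ^ (r - 1)) := by
            gcongr
            exact pow_le_one₀ cutoff_nonneg cutoff_le_one
        _ = _ := by rw [h1, one_mul]
  · rw [cutoff_eq_zero hk (not_lt.1 hka)]; simp

/-- Both sides vanish at 0, and the difference of right and left side is nondecreasing.
Differentiating χ⁴ leaves χ³, from which the density χ² a^{r-1} splits off; the derivative of χ is
controlled by `mul_deriv_cutoff_le`. The fourth power is the one that arises from `sobolevField` in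
`sobolevField_rpow_le`. -/
theorem le_radialPotential (hk0 : 0 < k) (hk : k < k') (hm : 0 < m) (hr : 1 ≤ r) (ha : 0 ≤ a) :
    cutoff k k' (a ^ (2 * m)) ^ 4 * a ^ r ≤
      (8 * m * (transitionBound * (k' / (k' - k))) + r) * radialPotential k k' m r a := by
  set C := 8 * m * (transitionBound * (k' / (k' - k))) + r with hC
  have hcont : ContinuousOn (fun a => C * radialPotential k k' m r a -
      cutoff k k' (a ^ (2 * m)) ^ 4 * a ^ r) (Ici 0) := by
    refine Continuous.continuousOn ?_
    have h1 : Continuous (radialPotential k k' m r) := continuous_iff_continuousAt.2 fun x =>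
      (hasDerivAt_radialPotential hm hr).continuousAt
    exact (h1.const_mul C |>.congr fun _ => rfl).sub (((contDiff_cutoff.continuous.comp
      (Real.continuous_rpow_const (by positivity))).pow 4).mul
      (Real.continuous_rpow_const (by linarith)))
  have hmono : MonotoneOn (fun a => C * radialPotential k k' m r a -
      cutoff k k' (a ^ (2 * m)) ^ 4 * a ^ r) (Ici 0) := by
    have hd : ∀ x ∈ interior (Ici (0 : ℝ)), HasDerivAt (fun a => C * radialPotential k k' m r a -
        cutoff k k' (a ^ (2 * m)) ^ 4 * a ^ r) (C * radialDensity k k' m r x -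
        (4 * cutoff k k' (x ^ (2 * m)) ^ 3 * (deriv (cutoff k k') (x ^ (2 * m)) *
        (2 * m * x ^ (2 * m - 1))) * x ^ r + cutoff k k' (x ^ (2 * m)) ^ 4 * (r * x ^ (r - 1)))) x := by
      intro x hx
      rw [interior_Ici] at hx
      have hx0 : x ≠ 0 := ne_of_gt hx
      have a1 := (hasDerivAt_radialPotential (k := k) (k' := k') (a := x) hm hr).const_mul C
      have a2 : HasDerivAt (fun x : ℝ => x ^ (2 * m)) (2 * m * x ^ (2 * m - 1)) x :=
        Real.hasDerivAt_rpow_const (Or.inl hx0)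
      have a3 : HasDerivAt (cutoff k k' ∘ fun x : ℝ => x ^ (2 * m)) _ x :=
        HasDerivAt.comp x hasDerivAt_cutoff a2
      have a4 := (a3.pow 4).mul (Real.hasDerivAt_rpow_const (p := r) (Or.inl hx0))
      have a5 := a1.sub a4
      refine HasDerivAt.congr_deriv (by exact a5) ?_
      simp [Function.comp_def]
    refine monotoneOn_of_deriv_nonneg (convex_Ici 0) hcont
      (fun x hx => (hd x hx).differentiableAt.differentiableWithinAt) fun x hx => ?_
    rw [(hd x hx).deriv]
    rw [interior_Ici] at hx
    have hx0 : (0 : ℝ) < x := hx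
    have e1 : x ^ (2 * m - 1) * x ^ r = x ^ (2 * m) * x ^ (r - 1) := by
      rw [← Real.rpow_add hx0, ← Real.rpow_add hx0]; congr 1; ring
    set c := cutoff k k' (x ^ (2 * m))
    set c' := deriv (cutoff k k') (x ^ (2 * m))
    have hc0 : 0 ≤ c := cutoff_nonneg
    have hc1 : c ≤ 1 := cutoff_le_one
    have hcd : x ^ (2 * m) * c' ≤ transitionBound * (k' / (k' - k)) :=
      mul_deriv_cutoff_le hk0 hk
    have hcd0 : 0 ≤ x ^ (2 * m) * c' := mul_nonneg (by positivity) (deriv_cutoff_nonneg hk)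
    have hden : radialDensity k k' m r x = c ^ 2 * x ^ (r - 1) := rfl
    have e2 : 4 * c ^ 3 * (c' * (2 * m * x ^ (2 * m - 1))) * x ^ r + c ^ 4 * (r * x ^ (r - 1)) =
        (8 * m * (c * (x ^ (2 * m) * c')) + c ^ 2 * r) * (c ^ 2 * x ^ (r - 1)) := by
      linear_combination (8 * m * c ^ 3 * c') * e1
    rw [hden, e2, ← sub_mul]
    refine mul_nonneg (sub_nonneg.2 ?_) (by positivity)
    have h3 : c * (x ^ (2 * m) * c') ≤ transitionBound * (k' / (k' - k)) :=
      (mul_le_of_le_one_left hcd0 hc1).trans hcd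
    have h4 : c ^ 2 * r ≤ r := mul_le_of_le_one_left (by linarith) (pow_le_one₀ hc0 hc1)
    rw [hC]
    gcongr
  have := hmono (mem_Ici.2 le_rfl) (mem_Ici.2 ha) ha
  simp only [radialPotential, intervalIntegral.integral_same, mul_zero,
    Real.zero_rpow (by linarith : r ≠ 0), sub_zero] at this
  simpa [radialPotential] using this

variable {d : ℕ}

theorem norm_vecPow (hm : 0 < m) (v : Space d) : ‖vecPow m v‖ = ‖v‖ ^ m := by
  rw [vecPow, norm_smul, Real.norm_of_nonneg (by positivity)]
  rcases eq_or_ne v 0 with rfl | hv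
  · simp [Real.zero_rpow hm.ne']
  · have : ‖v‖ ≠ 0 := norm_ne_zero_iff.2 hv
    rw [Real.rpow_sub_one this]; field_simp

theorem norm_vecPow_sq (hm : 0 < m) (v : Space d) : ‖vecPow m v‖ ^ 2 = ‖v‖ ^ (2 * m) := by
  rw [norm_vecPow hm, ← Real.rpow_natCast, ← Real.rpow_mul (norm_nonneg _)]
  congr 1; push_cast; ring

/-- The gradient of `radialPotential ‖u‖` expressed through `vecPow m u`. -/
theorem truncPow_smul_vecPow (hm : 0 < m) (v : Space d) (hv : v ≠ 0) :
    truncPow k k' ((r - 1 - m) / (2 * m)) (‖vecPow m v‖ ^ 2) • vecPow m v =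
      (radialDensity k k' m r ‖v‖ / ‖v‖) • v := by
  have h0 : 0 < ‖v‖ := norm_pos_iff.2 hv
  rw [norm_vecPow_sq hm, truncPow, radialDensity, vecPow, smul_smul]
  congr 1
  rw [← Real.rpow_mul h0.le, mul_assoc, ← Real.rpow_add h0, mul_div_assoc]
  congr 1
  rw [← Real.rpow_sub_one h0.ne']
  congr 1
  field_simp
  ring

/-- By `truncPow_smul_vecPow` the field is the radial derivative times the unit vector of v, so
Cauchy–Schwarz reduces the claim to the one-dimensional tangent inequality. At v = 0 field and
potential both vanish and nonnegativity is enough. -/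
theorem radialPotential_convex (hk : k < k') (hm : 0 < m) (hr : 1 ≤ r)
    (v v' : Space d) :
    radialPotential k k' m r ‖v‖ - radialPotential k k' m r ‖v'‖ ≤
      inner ℝ (v - v')
        (truncPow k k' ((r - 1 - m) / (2 * m)) (‖vecPow m v‖ ^ 2) • vecPow m v) := by
  rcases eq_or_ne v 0 with rfl | hv
  · have h1 : vecPow m (0 : Space d) = 0 := by simp [vecPow]
    rw [h1, smul_zero, inner_zero_right, norm_zero]
    have := radialPotential_nonneg (k := k) (k' := k') (m := m) (r := r) (norm_nonneg v')
    simp only [radialPotential, intervalIntegral.integral_same] at this ⊢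
    linarith
  · rw [truncPow_smul_vecPow hm v hv, inner_smul_right, inner_sub_left, real_inner_self_eq_norm_sq]
    have h0 : 0 < ‖v‖ := norm_pos_iff.2 hv
    refine (radialPotential_sub_le hk hm hr h0.le (norm_nonneg v')).trans ?_
    have h2 : inner ℝ v' v ≤ ‖v'‖ * ‖v‖ := real_inner_le_norm v' v
    have h3 := radialDensity_nonneg (k := k) (k' := k') (m := m) (r := r) h0.le
    rw [div_mul_eq_mul_div, le_div_iff₀ h0]
    nlinarith [mul_le_mul_of_nonneg_left h2 h3]

end Potential

/-! ### Pointwise lower bound for the flux against the test function -/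

section Caccioppoli

theorem neg_young_le {x y a b ε : ℝ} (hε : 0 < ε) (h : |x| ≤ 2 * (|a| * |b|))  (hy : 0 ≤ y) :
    -(y * (ε * a ^ 2 + ε⁻¹ * b ^ 2)) ≤ y * x := by
  have h1 : 2 * (|a| * |b|) ≤ ε * a ^ 2 + ε⁻¹ * b ^ 2 := by
    have h2 : 0 ≤ ε⁻¹ * (ε * |a| - |b|) ^ 2 := by positivity
    have h3 : ε⁻¹ * (ε * |a| - |b|) ^ 2 = ε * |a| ^ 2 + ε⁻¹ * |b| ^ 2 - 2 * (|a| * |b|) := by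
      field_simp; ring
    rw [h3, sq_abs, sq_abs] at h2
    linarith
  rw [← mul_neg]
  exact mul_le_mul_of_nonneg_left (by linarith [neg_abs_le x]) hy

/-- Young's inequality for one spatial component. The pairings of a with g, and of a and g with w,
are left alone, because ellipticity and the diagonal condition have a sign only after summation over
the components. Through `hTK` the pairing of f with the gradient part carries a factor χ, which
joins ‖g‖ so that the loss is a multiple of χ²‖g‖². -/
theorem flux_component_lower_bound {X : Type*} [NormedAddCommGroup X] [InnerProductSpace ℝ X]
    {ν L ξ θ d χ Q T K : ℝ} (hν : 0 < ν) (hL : 0 < L) (hθ : 0 ≤ θ) (hχ : 0 ≤ χ) (hχ1 : χ ≤ 1)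
    (hQ : 0 ≤ Q) (hT : 0 ≤ T) (a f g w : X) (hTK : 2 * (‖w‖ ^ 2 * T) ≤ χ * Q * K) :
    ξ ^ 2 * θ * (χ ^ 2 * Q) * inner ℝ a g + 2 * ξ ^ 2 * θ * T * (inner ℝ a w * inner ℝ g w) -
      ν / (4 * L ^ 2) * (ξ ^ 2 * θ * (χ ^ 2 * Q) * ‖a‖ ^ 2) -
      ν / 4 * (ξ ^ 2 * θ * (χ ^ 2 * Q) * ‖g‖ ^ 2) -
      (4 * L ^ 2 / ν + 1) * (θ * (χ ^ 2 * Q) * ‖w‖ ^ 2 * d ^ 2) -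
      (1 + (1 + K) ^ 2 / ν) * (ξ ^ 2 * θ * Q * ‖f‖ ^ 2) ≤
    inner ℝ (a + f) ((2 * ξ * θ * d) • (χ ^ 2 * Q) • w +
      (ξ ^ 2 * θ) • ((χ ^ 2 * Q) • g + (2 * T * inner ℝ w g) • w)) := by
  have hΓ : 0 ≤ χ ^ 2 * Q := by positivity
  have habs : ∀ v : X, |2 * (ξ * d * inner ℝ v w)| ≤ 2 * (|ξ * ‖v‖| * |d * ‖w‖|) := by
    intro v
    have := abs_real_inner_le_norm v w
    rw [abs_mul, abs_mul, abs_mul, abs_mul, abs_mul, abs_norm, abs_norm, abs_two]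
    calc 2 * (|ξ| * |d| * |inner ℝ v w|) ≤ 2 * (|ξ| * |d| * (‖v‖ * ‖w‖)) := by gcongr
      _ = _ := by ring
  -- This weight makes the a-term cost a quarter of the ellipticity constant once the growth bound
  -- is inserted.
  have t1 := neg_young_le (y := θ * (χ ^ 2 * Q)) (ε := ν / (4 * L ^ 2)) (by positivity) (habs a)
    (by positivity)
  have t2 := neg_young_le (y := θ * (χ ^ 2 * Q)) (ε := 1) (by positivity) (habs f) (by positivity)
  have t2' : θ * (χ ^ 2 * Q) * (ξ ^ 2 * ‖f‖ ^ 2) ≤ ξ ^ 2 * θ * Q * ‖f‖ ^ 2 := by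
    have : χ ^ 2 ≤ 1 := pow_le_one₀ hχ hχ1
    calc _ = χ ^ 2 * (ξ ^ 2 * θ * Q * ‖f‖ ^ 2) := by ring
      _ ≤ 1 * (ξ ^ 2 * θ * Q * ‖f‖ ^ 2) := by gcongr
      _ = _ := one_mul _
  have t3 : -((ξ ^ 2 * θ * Q) * (ν / 4 * (χ * ‖g‖) ^ 2 + (ν / 4)⁻¹ * ((1 + K) / 2 * ‖f‖) ^ 2)) ≤
      ξ ^ 2 * θ * ((χ ^ 2 * Q) * inner ℝ f g + 2 * T * inner ℝ w g * inner ℝ f w) := by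
    have hmain : |(χ ^ 2 * Q) * inner ℝ f g + 2 * T * inner ℝ w g * inner ℝ f w| ≤
        Q * (χ * (1 + K) * (‖f‖ * ‖g‖)) := by
      have i1 := abs_real_inner_le_norm f g
      have i2 := abs_real_inner_le_norm w g
      have i3 := abs_real_inner_le_norm f w
      calc _ ≤ |(χ ^ 2 * Q) * inner ℝ f g| + |2 * T * inner ℝ w g * inner ℝ f w| := abs_add_le _ _
        _ = (χ ^ 2 * Q) * |inner ℝ f g| + 2 * T * |inner ℝ w g| * |inner ℝ f w| := by
            rw [abs_mul, abs_mul (2 * T * inner ℝ w g), abs_mul (2 * T), abs_of_nonneg hΓ,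
              abs_of_nonneg (by positivity : 0 ≤ 2 * T)]
        _ ≤ (χ ^ 2 * Q) * (‖f‖ * ‖g‖) + 2 * T * (‖w‖ * ‖g‖) * (‖f‖ * ‖w‖) := by gcongr
        _ = (χ ^ 2 * Q + 2 * (‖w‖ ^ 2 * T)) * (‖f‖ * ‖g‖) := by ring
        _ ≤ (χ * Q + χ * Q * K) * (‖f‖ * ‖g‖) := by
            gcongr
            calc χ ^ 2 = χ * χ := sq χ
              _ ≤ χ * 1 := by gcongr
              _ = χ := mul_one χ
        _ = _ := by ring
    have h1 : -(Q * (χ * (1 + K) * (‖f‖ * ‖g‖))) ≤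
        (χ ^ 2 * Q) * inner ℝ f g + 2 * T * inner ℝ w g * inner ℝ f w := by
      linarith [neg_abs_le ((χ ^ 2 * Q) * inner ℝ f g + 2 * T * inner ℝ w g * inner ℝ f w)]
    have h2 : 0 ≤ (ν / 4)⁻¹ * (ν / 4 * (χ * ‖g‖) - (1 + K) / 2 * ‖f‖) ^ 2 := by positivity
    have h3 : (ν / 4)⁻¹ * (ν / 4 * (χ * ‖g‖) - (1 + K) / 2 * ‖f‖) ^ 2 =
        (ν / 4 * (χ * ‖g‖) ^ 2 + (ν / 4)⁻¹ * ((1 + K) / 2 * ‖f‖) ^ 2) -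
          (χ * (1 + K) * (‖f‖ * ‖g‖)) := by field_simp; ring
    rw [h3] at h2
    have h4 := mul_le_mul_of_nonneg_left h1 (by positivity : 0 ≤ ξ ^ 2 * θ)
    have h5 := mul_nonneg (by positivity : 0 ≤ ξ ^ 2 * θ * Q) h2
    linarith
  have e1 : (ν / (4 * L ^ 2))⁻¹ = 4 * L ^ 2 / ν := by rw [inv_div]
  have e2 : (ν / 4)⁻¹ * ((1 + K) / 2 * ‖f‖) ^ 2 = (1 + K) ^ 2 / ν * ‖f‖ ^ 2 := by
    field_simp; ring
  rw [e2] at t3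
  rw [e1] at t1
  simp only [inner_add_left, inner_add_right, inner_smul_right, inv_one, one_mul, mul_pow] at *
  rw [real_inner_comm w g]
  linarith

/-- A bounded solution on an open set of space-time, together with its data; all functions are
defined on the whole space-time and only the equations are localized. -/
structure LocalSolution {N d : ℕ} (m ν L M : ℝ) (U : Set (SpaceTime N))
    (u : SpaceTime N → Space d) (A F G : Fin N → SpaceTime N → Space d) : Prop where
  isOpen : IsOpen U
  measurable : AEStronglyMeasurable u
  bound : ∀ z, ‖u z‖ ≤ M
  memLp_pow : MemLp (fun z => vecPow m (u z)) 2
  memLp_A : ∀ i, MemLp (A i) 2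
  memLp_F : ∀ i, MemLp (F i) 2
  memLp_G : ∀ i, MemLp (G i) 2
  weak : IsDistribSolution volume U (timeDir N) (spaceDir N) u (fun i => A i + F i)
  grad : HasWeakDerivs volume U (spaceDir N) (fun z => vecPow m (u z)) G
  ellipticity : ∀ᵐ z, ν * ∑ i, ‖G i z‖ ^ 2 ≤ ∑ i, (inner ℝ (A i z) (G i z) : ℝ)
  growth : ∀ᵐ z, ∑ i, ‖A i z‖ ^ 2 ≤ L ^ 2 * ∑ i, ‖G i z‖ ^ 2
  diagonal : ∀ᵐ z, 0 ≤ ∑ i, (inner ℝ (A i z) (vecPow m (u z)) : ℝ) *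
    (inner ℝ (G i z) (vecPow m (u z)) : ℝ)

variable {N d : ℕ} {m ν L M r k k' : ℝ} {U : Set (SpaceTime N)} {u : SpaceTime N → Space d}
  {A F G : Fin N → SpaceTime N → Space d}

/-- The constant measuring the steepness of the truncation. -/
def steepness (k k' : ℝ) : ℝ := transitionBound * (k' / (k' - k))

theorem one_le_steepness (hk0 : 0 < k) (hk : k < k') : 1 ≤ steepness k k' := by
  have h1 := one_le_transitionBound
  have h2 : 1 ≤ k' / (k' - k) := by rw [le_div_iff₀ (by linarith)]; linarith
  calc (1 : ℝ) = 1 * 1 := (mul_one 1).symm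
    _ ≤ _ := mul_le_mul h1 h2 zero_le_one (by linarith)

/-- `|u|^c` on the set where `|u|^{2m} > k`, and `0` elsewhere. -/
def levelPow (m k c : ℝ) {d : ℕ} (v : Space d) : ℝ := if k < ‖v‖ ^ (2 * m) then ‖v‖ ^ c else 0

theorem levelPow_nonneg {c : ℝ} (v : Space d) : 0 ≤ levelPow m k c v := by
  rw [levelPow]; split_ifs <;> positivity

/-- The right-hand side density of the energy estimate. -/
def energyDensity (m r ν L k k' : ℝ) (u : SpaceTime N → Space d)
    (F : Fin N → SpaceTime N → Space d) (ξ : SpaceTime N → ℝ) (z : SpaceTime N) : ℝ :=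
  levelPow m k r (u z) * max (2 * ξ z * fderiv ℝ ξ z (timeDir N)) 0 +
  (4 * L ^ 2 / ν + 1) * (levelPow m k (r + m - 1) (u z) * ∑ i, fderiv ℝ ξ z (spaceDir N i) ^ 2) +
  (1 + (1 + 2 * (2 * steepness k k' + (r - 1 - m) / (2 * m))) ^ 2 / ν) *
    (ξ z ^ 2 * levelPow m k (r - 1 - m) (u z) * ∑ i, ‖F i z‖ ^ 2)

/-- The vector field of the test function. -/
def testField (m r k k' : ℝ) {d : ℕ} (w : Space d) : Space d :=
  truncPow k k' ((r - 1 - m) / (2 * m)) (‖w‖ ^ 2) • w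

theorem contDiff_testField (hk0 : 0 < k) (hk : k < k') :
    ContDiff ℝ ∞ (testField m r k k' (d := d)) :=
  (contDiff_comp_norm_sq (contDiff_truncPow hk0 hk)).smul contDiff_id

theorem truncPow_eq_levelPow {c : ℝ} (hm : 0 < m) (hk : k < k') (v : Space d) :
    truncPow k k' c (‖vecPow m v‖ ^ 2) =
      cutoff k k' (‖v‖ ^ (2 * m)) ^ 2 * levelPow m k (2 * m * c) v := by
  rw [norm_vecPow_sq hm, truncPow, levelPow, ← Real.rpow_mul (norm_nonneg v)]
  split_ifs with h
  · rfl
  · rw [cutoff_eq_zero hk (not_lt.1 h)]; simp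

theorem fderiv_sq_mul {ξ θ : SpaceTime N → ℝ} (hξ : ContDiff ℝ ∞ ξ) (hθ : ContDiff ℝ ∞ θ)
    (z e : SpaceTime N) : fderiv ℝ (fun z => ξ z ^ 2 * θ z) z e =
      2 * ξ z * θ z * fderiv ℝ ξ z e + ξ z ^ 2 * fderiv ℝ θ z e := by
  have h1 := (hξ.differentiable (by simp) z).hasFDerivAt.pow 2
  have h2 := (hθ.differentiable (by simp) z).hasFDerivAt
  have h3 : HasFDerivAt (fun z => ξ z ^ 2 * θ z) _ z := h1.mul h2
  rw [h3.fderiv]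
  simp
  ring

/-- After summation, ellipticity provides ν and Young's inequality spends two quarters of it. The
diagonal sum is multiplied by the derivative of the truncated power, nonnegative because r ≥ 1 + m
makes its exponent nonnegative. The factor θ has no spatial gradient; it serves to isolate time
slices, so its time derivative is kept apart on the right. -/
theorem flux_lower_bound (hm : 0 < m) (hr : 1 + m ≤ r) (hν : 0 < ν) (hL : 0 < L) (hk0 : 0 < k)
    (hk : k < k') {ξ θ : SpaceTime N → ℝ} (hξ : ContDiff ℝ ∞ ξ) (hθ : ContDiff ℝ ∞ θ)
    (hθ0 : ∀ z, 0 ≤ θ z) (hθ1 : ∀ z, θ z ≤ 1) (hθs : ∀ z i, fderiv ℝ θ z (spaceDir N i) = 0)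
    (z : SpaceTime N)
    (h1 : ν * ∑ i, ‖G i z‖ ^ 2 ≤ ∑ i, (inner ℝ (A i z) (G i z) : ℝ))
    (h2 : ∑ i, ‖A i z‖ ^ 2 ≤ L ^ 2 * ∑ i, ‖G i z‖ ^ 2)
    (h3 : 0 ≤ ∑ i, (inner ℝ (A i z) (vecPow m (u z)) : ℝ) *
      (inner ℝ (G i z) (vecPow m (u z)) : ℝ)) :
    ν / 2 * (ξ z ^ 2 * θ z * (cutoff k k' (‖u z‖ ^ (2 * m)) ^ 2 *
        levelPow m k (r - 1 - m) (u z) * ∑ i, ‖G i z‖ ^ 2)) +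
      radialPotential k k' m r ‖u z‖ * fderiv ℝ (fun z => ξ z ^ 2 * θ z) z (timeDir N) -
      energyDensity m r ν L k k' u F ξ z ≤
    ∑ i, (inner ℝ (A i z + F i z) (prodDeriv (spaceDir N) (fun z => ξ z ^ 2 * θ z)
      (testField m r k k') (fun z => vecPow m (u z)) G i z) : ℝ) +
      radialPotential k k' m r ‖u z‖ * (ξ z ^ 2 * fderiv ℝ θ z (timeDir N)) := by
  set b := (r - 1 - m) / (2 * m) with hb
  have hb0 : 0 ≤ b := div_nonneg (by linarith) (by linarith)
  have hmb : 2 * m * b = r - 1 - m := by rw [hb]; field_simp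
  set w := vecPow m (u z) with hw
  set q := ‖u z‖ ^ (2 * m) with hq
  have hwq : ‖w‖ ^ 2 = q := norm_vecPow_sq hm _
  have hq0 : 0 ≤ q := by positivity
  set χ := cutoff k k' q with hχ
  set Q := levelPow m k (r - 1 - m) (u z) with hQ
  set T := deriv (truncPow k k' b) q with hT
  have hQ0 : 0 ≤ Q := levelPow_nonneg _
  have hχ0 : 0 ≤ χ := cutoff_nonneg
  have hχ1 : χ ≤ 1 := cutoff_le_one
  have hT0 : 0 ≤ T := deriv_truncPow_nonneg hk0 hk hb0
  have hS := one_le_steepness hk0 hk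
  set K := 2 * (2 * steepness k k' + b) with hK
  have hTK : 2 * (‖w‖ ^ 2 * T) ≤ χ * Q * K := by
    have := mul_deriv_truncPow_le hk0 hk hb0 hq0
    rw [hwq, hK]
    have hχQ : χ * q ^ b = χ * Q := by
      rw [hQ, levelPow]
      split_ifs with h
      · rw [hq, ← Real.rpow_mul (norm_nonneg _), hmb]
      · rw [hχ, cutoff_eq_zero hk (not_lt.1 h)]; simp
    rw [← hχ, hχQ] at this
    change q * T ≤ χ * Q * (2 * steepness k k' + b) at this
    linarith
  have hΓ : truncPow k k' b (‖w‖ ^ 2) = χ ^ 2 * Q := by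
    rw [truncPow_eq_levelPow hm hk, hmb]
  have hcomp := fun i => flux_component_lower_bound (X := Space d) (ξ := ξ z)
    (d := fderiv ℝ ξ z (spaceDir N i)) (K := K) hν hL (hθ0 z) hχ0 hχ1 hQ0 hT0 (A i z) (F i z)
    (G i z) w hTK
  have hD : ∀ i, prodDeriv (spaceDir N) (fun z => ξ z ^ 2 * θ z)
      (testField m r k k') (fun z => vecPow m (u z)) G i z =
      (2 * ξ z * θ z * fderiv ℝ ξ z (spaceDir N i)) • (χ ^ 2 * Q) • w +
      (ξ z ^ 2 * θ z) • ((χ ^ 2 * Q) • G i z + (2 * T * inner ℝ w (G i z)) • w) := by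
    intro i
    rw [prodDeriv, fderiv_sq_mul hξ hθ, hθs, mul_zero, add_zero]
    unfold testField
    rw [fderiv_comp_norm_sq_smul (contDiff_truncPow hk0 hk)]
    rw [← hb, ← hw, hΓ, hwq]
  simp only [hD]
  have hsum := Finset.sum_le_sum fun i (_ : i ∈ Finset.univ) => hcomp i
  simp only [Finset.sum_sub_distrib, Finset.sum_add_distrib, ← Finset.mul_sum] at hsum
  -- the individual terms
  have hΓ0 : 0 ≤ χ ^ 2 * Q := by positivity
  have hψ0 : 0 ≤ ξ z ^ 2 * θ z := mul_nonneg (sq_nonneg _) (hθ0 z)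
  have p1 : ξ z ^ 2 * θ z * (χ ^ 2 * Q) * (ν * ∑ i, ‖G i z‖ ^ 2) ≤
      ξ z ^ 2 * θ z * (χ ^ 2 * Q) * ∑ i, (inner ℝ (A i z) (G i z) : ℝ) :=
    mul_le_mul_of_nonneg_left h1 (by positivity)
  have p2 : 0 ≤ 2 * ξ z ^ 2 * θ z * T * ∑ i, (inner ℝ (A i z) w : ℝ) * (inner ℝ (G i z) w : ℝ) :=
    mul_nonneg (by have := hθ0 z; positivity) h3
  have p3 : ν / (4 * L ^ 2) * (ξ z ^ 2 * θ z * (χ ^ 2 * Q) * ∑ i, ‖A i z‖ ^ 2) ≤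
      ν / 4 * (ξ z ^ 2 * θ z * (χ ^ 2 * Q) * ∑ i, ‖G i z‖ ^ 2) := by
    calc _ ≤ ν / (4 * L ^ 2) * (ξ z ^ 2 * θ z * (χ ^ 2 * Q) * (L ^ 2 * ∑ i, ‖G i z‖ ^ 2)) := by
          gcongr
      _ = _ := by field_simp
  have hu0 := norm_nonneg (u z)
  have hP0 := radialPotential_nonneg (k := k) (k' := k') (m := m) (r := r) hu0
  have hPle : radialPotential k k' m r ‖u z‖ ≤ levelPow m k r (u z) :=
    radialPotential_le hk hm (by linarith) hu0
  -- The potential is nonnegative, so only the positive part of the time derivative of ξ² costs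
  -- anything.
  have p4 : radialPotential k k' m r ‖u z‖ * (θ z * (2 * ξ z * fderiv ℝ ξ z (timeDir N))) ≤
      levelPow m k r (u z) * max (2 * ξ z * fderiv ℝ ξ z (timeDir N)) 0 := by
    refine (mul_le_mul_of_nonneg_left ?_ hP0).trans
      (mul_le_mul_of_nonneg_right hPle (le_max_right _ _))
    calc _ ≤ θ z * max (2 * ξ z * fderiv ℝ ξ z (timeDir N)) 0 :=
          mul_le_mul_of_nonneg_left (le_max_left _ _) (hθ0 z)
      _ ≤ _ := mul_le_of_le_one_left (le_max_right _ _) (hθ1 z)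
  have hqQ : χ ^ 2 * Q * ‖w‖ ^ 2 ≤ levelPow m k (r + m - 1) (u z) := by
    rw [hwq, hQ, levelPow, levelPow]
    split_ifs with h
    · have hupos : 0 < ‖u z‖ := by
        refine lt_of_le_of_ne hu0 fun h0 => ?_
        rw [← h0, Real.zero_rpow (by positivity)] at h
        linarith
      rw [mul_assoc, hq, ← Real.rpow_add hupos]
      have : r - 1 - m + 2 * m = r + m - 1 := by ring
      rw [this]
      exact mul_le_of_le_one_left (by positivity) (pow_le_one₀ hχ0 hχ1)
    · simp
  have p5 : θ z * (χ ^ 2 * Q) * ‖w‖ ^ 2 * ∑ i, fderiv ℝ ξ z (spaceDir N i) ^ 2 ≤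
      levelPow m k (r + m - 1) (u z) * ∑ i, fderiv ℝ ξ z (spaceDir N i) ^ 2 := by
    refine mul_le_mul_of_nonneg_right ?_ (Finset.sum_nonneg fun i _ => sq_nonneg _)
    rw [mul_assoc]
    exact (mul_le_of_le_one_left (by positivity) (hθ1 z)).trans hqQ
  have p6 : ξ z ^ 2 * θ z * Q * ∑ i, ‖F i z‖ ^ 2 ≤ ξ z ^ 2 * Q * ∑ i, ‖F i z‖ ^ 2 := by
    refine mul_le_mul_of_nonneg_right ?_ (Finset.sum_nonneg fun i _ => sq_nonneg _)
    exact mul_le_mul_of_nonneg_right (mul_le_of_le_one_right (sq_nonneg _) (hθ1 z)) hQ0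
  have p5' := mul_le_mul_of_nonneg_left p5 (by positivity : 0 ≤ 4 * L ^ 2 / ν + 1)
  have p6' := mul_le_mul_of_nonneg_left p6 (by positivity : 0 ≤ 1 + (1 + K) ^ 2 / ν)
  rw [fderiv_sq_mul hξ hθ, energyDensity]
  have e4 : ν / 2 * (ξ z ^ 2 * θ z * (χ ^ 2 * Q * ∑ i, ‖G i z‖ ^ 2)) =
    ξ z ^ 2 * θ z * (χ ^ 2 * Q) * (ν * ∑ i, ‖G i z‖ ^ 2) -
      2 * (ν / 4 * (ξ z ^ 2 * θ z * (χ ^ 2 * Q) * ∑ i, ‖G i z‖ ^ 2)) := by ring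
  rw [← hb, ← hK, e4]
  linarith

end Caccioppoli

/-! ### Time cutoffs for slice estimates -/

section TimeCutoff

/-- A smooth decreasing time cutoff whose derivative is minus a bump function. -/
theorem exists_time_cutoff (j : ContDiffBump (0 : ℝ)) (s : ℝ) : ∃ θ : ℝ → ℝ, ContDiff ℝ ∞ θ ∧
    (∀ t, 0 ≤ θ t) ∧ (∀ t, θ t ≤ 1) ∧ ∀ t, deriv θ t = -j.normed volume (s - t) := by
  set J : ℝ → ℝ := fun t => j.normed volume (s - t) with hJ
  have hJc : ContDiff ℝ ∞ J := (j.contDiff_normed (n := ⊤)).comp (contDiff_const.sub contDiff_id)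
  have hJi : Integrable J := j.integrable_normed.comp_sub_left s
  have hJ1 : ∫ t, J t = 1 := by
    rw [hJ, integral_sub_left_eq_self (fun t => j.normed volume t) volume s, j.integral_normed]
  have hJ0 : ∀ t, 0 ≤ J t := fun t => j.nonneg_normed _
  have hrep : ∀ t, ∫ x in Ioi t, J x = (∫ x in Ioi 0, J x) - ∫ x in (0 : ℝ)..t, J x := by
    intro t
    rw [← intervalIntegral.integral_Ioi_sub_Ioi' hJi.integrableOn hJi.integrableOn]
    ring
  have hder : ∀ t, HasDerivAt (fun t => ∫ x in Ioi t, J x) (-J t) t := by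
    intro t
    have h1 : HasDerivAt (fun t => ∫ x in (0 : ℝ)..t, J x) (J t) t :=
      (hJc.continuous.integral_hasStrictDerivAt 0 t).hasDerivAt
    have h2 := h1.const_sub (∫ x in Ioi 0, J x)
    exact h2.congr_of_eventuallyEq (Eventually.of_forall hrep)
  refine ⟨fun t => ∫ x in Ioi t, J x, ?_, fun t => setIntegral_nonneg measurableSet_Ioi
    fun x _ => hJ0 x, fun t => ?_, fun t => (hder t).deriv⟩
  · rw [contDiff_infty_iff_deriv]
    refine ⟨fun t => (hder t).differentiableAt, ?_⟩
    rw [show deriv (fun t => ∫ x in Ioi t, J x) = fun t => -J t from funext fun t => (hder t).deriv]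
    exact hJc.neg
  · rw [← hJ1]
    exact setIntegral_le_integral hJi (ae_of_all _ hJ0)

/-- Lebesgue differentiation. Testing with smooth averages avoids sharp cutoffs at a given time, so
no continuity in time is used. -/
theorem ae_le_of_convolution_le {f : ℝ → ℝ} (hf : LocallyIntegrable f) {R : ℝ}
    (h : ∀ (j : ContDiffBump (0 : ℝ)) (s : ℝ), ∫ t, j.normed volume (s - t) * f t ≤ R) :
    ∀ᵐ t, f t ≤ R := by
  have h1 := ContDiffBump.ae_convolution_tendsto_right_of_locallyIntegrable (K := 2)
      (tendsto_shrinkingBump_rOut (E := ℝ) one_pos)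
      (Eventually.of_forall (shrinkingBump_rOut_le_rIn one_pos)) hf
  filter_upwards [h1] with s hs
  refine le_of_tendsto' hs fun n => ?_
  rw [convolution_eq_swap]
  simpa using h (shrinkingBump ℝ 1 one_pos n) s

end TimeCutoff

/-! ### Energy estimates -/

section EnergyEstimates

variable {N d : ℕ} {m ν L M r k k' : ℝ} {U : Set (SpaceTime N)} {u : SpaceTime N → Space d}
  {A F G : Fin N → SpaceTime N → Space d} {ξ : SpaceTime N → ℝ}

theorem measurable_levelPow {c : ℝ} : Measurable (levelPow m k c : Space d → ℝ) := by
  unfold levelPow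
  exact Measurable.ite (measurableSet_lt measurable_const (by fun_prop)) (by fun_prop)
    measurable_const

theorem abs_levelPow_le {c : ℝ} (hc : 0 ≤ c) {v : Space d} (hv : ‖v‖ ≤ M) :
    ‖levelPow m k c v‖ ≤ M ^ c := by
  have : 0 ≤ M := (norm_nonneg v).trans hv
  rw [Real.norm_of_nonneg (levelPow_nonneg v), levelPow]
  split_ifs
  · exact Real.rpow_le_rpow (norm_nonneg v) hv hc
  · positivity

theorem LocalSolution.aestronglyMeasurable_levelPow (h : LocalSolution m ν L M U u A F G) (c : ℝ) :
    AEStronglyMeasurable (fun z => levelPow m k c (u z)) :=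
  (measurable_levelPow.comp_aemeasurable h.measurable.aemeasurable).aestronglyMeasurable

theorem integrable_sum_sq {H : Fin N → SpaceTime N → Space d} (hH : ∀ i, MemLp (H i) 2) :
    Integrable (fun z => ∑ i, ‖H i z‖ ^ 2) :=
  integrable_finsetSum _ fun i _ => (hH i).integrable_norm_pow (by norm_num)

theorem LocalSolution.integrable_energyDensity (h : LocalSolution m ν L M U u A F G)
    (hm : 0 < m) (hr : 1 + m ≤ r) (hξ : ContDiff ℝ ∞ ξ) (hξc : HasCompactSupport ξ) :
    Integrable (energyDensity m r ν L k k' u F ξ) := by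
  have hdc : ∀ e, Continuous (fun z => fderiv ℝ ξ z e) := fun e =>
    (hξ.continuous_fderiv (by simp)).clm_apply continuous_const
  have hb : ∀ {c : ℝ}, 0 ≤ c → ∀ g : SpaceTime N → ℝ, Integrable g →
      Integrable (fun z => levelPow m k c (u z) * g z) := fun {c} hc g hg =>
    hg.bdd_mul (h.aestronglyMeasurable_levelPow c)
      (ae_of_all _ fun z => abs_levelPow_le hc (h.bound z))
  obtain ⟨B, hB⟩ := hξc.exists_bound_of_continuous hξ.continuous
  refine ((hb (by linarith) _ ?_).add ((hb (by linarith) _ ?_).const_mul _)).add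
    (Integrable.const_mul ?_ _)
  · have hcont : Continuous (fun z => max (2 * ξ z * fderiv ℝ ξ z (timeDir N)) 0) :=
      ((continuous_const.mul hξ.continuous).mul (hdc _)).max continuous_const
    refine hcont.integrable_of_hasCompactSupport (hξc.mono fun z hz => ?_)
    intro h0
    simp [h0] at hz
  · refine integrable_finsetSum _ fun i _ => ?_
    have hcont : Continuous (fun z => fderiv ℝ ξ z (spaceDir N i) ^ 2) := (hdc _).pow 2
    refine hcont.integrable_of_hasCompactSupport ((hξc.fderiv_apply ℝ (spaceDir N i)).mono
      fun z hz => ?_)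
    intro h0
    exact hz (by simp [h0])
  · have h1 := hb (c := r - 1 - m) (by linarith) _ (integrable_sum_sq h.memLp_F)
    have h2 := h1.bdd_mul (f := fun z => ξ z ^ 2) (c := B ^ 2)
      (hξ.continuous.pow 2).aestronglyMeasurable (ae_of_all _ fun z => by
        rw [norm_pow]; exact pow_le_pow_left₀ (norm_nonneg _) (hB z) 2)
    refine h2.congr (ae_of_all _ fun z => ?_)
    simp only [mul_assoc]

/-- `IsDistribSolution.energy_le` for the radial potential and the weight ξ²θ, combined with the
integrated pointwise bound. Since r ≥ 1 + m, all powers of the bounded function u have nonnegative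
exponents, so every term is integrable. -/
theorem LocalSolution.energy_inequality (h : LocalSolution m ν L M U u A F G)
    (hm : 0 < m) (hr : 1 + m ≤ r) (hν : 0 < ν) (hL : 0 < L) (hk0 : 0 < k) (hk : k < k')
    (hξ : ContDiff ℝ ∞ ξ) (hξc : HasCompactSupport ξ) (hξU : tsupport ξ ⊆ U)
    {θ : SpaceTime N → ℝ} (hθ : ContDiff ℝ ∞ θ) (hθ0 : ∀ z, 0 ≤ θ z) (hθ1 : ∀ z, θ z ≤ 1)
    (hθs : ∀ z i, fderiv ℝ θ z (spaceDir N i) = 0) :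
    ν / 2 * ∫ z, (ξ z ^ 2 * θ z * (cutoff k k' (‖u z‖ ^ (2 * m)) ^ 2 *
        levelPow m k (r - 1 - m) (u z) * ∑ i, ‖G i z‖ ^ 2)) ≤
      (∫ z, energyDensity m r ν L k k' u F ξ z) +
      ∫ z, radialPotential k k' m r ‖u z‖ * (ξ z ^ 2 * fderiv ℝ θ z (timeDir N)) := by
  set ψ : SpaceTime N → ℝ := fun z => ξ z ^ 2 * θ z with hψ
  have hψs : ContDiff ℝ ∞ ψ := (hξ.pow 2).mul hθ
  have hψt : tsupport ψ ⊆ tsupport ξ := by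
    refine closure_mono fun z hz => ?_
    intro h0
    exact hz (by simp [hψ, h0])
  have hψc : HasCompactSupport ψ :=
    HasCompactSupport.of_support_subset_isCompact hξc ((subset_tsupport _).trans hψt)
  set w : SpaceTime N → Space d := fun z => vecPow m (u z) with hw
  have hwM : ∀ z, ‖w z‖ ≤ M ^ m := fun z => by
    rw [hw, norm_vecPow hm]; exact Real.rpow_le_rpow (norm_nonneg _) (h.bound z) hm.le
  have hPc : Continuous (radialPotential k k' m r) := continuous_iff_continuousAt.2 fun x =>
    (hasDerivAt_radialPotential hm (by linarith)).continuousAt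
  have hPuc : Continuous (fun v : Space d => radialPotential k k' m r ‖v‖) :=
    hPc.comp continuous_norm
  have hg := contDiff_testField (m := m) (r := r) (d := d) hk0 hk
  have hV : ∀ i, MemLp (A i + F i) 2 := fun i => (h.memLp_A i).add (h.memLp_F i)
  have key := h.weak.energy_le h.grad h.isOpen h.measurable h.bound h.memLp_pow hwM hV h.memLp_G
    hg hPuc (fun z z' => radialPotential_convex hk hm (by linarith) (u z) (u z')) hψs hψc
    (hψt.trans hξU) (fun z => mul_nonneg (sq_nonneg _) (hθ0 z))
  -- integrability
  obtain ⟨CP, -, hCP⟩ := exists_norm_le_of_continuous hPuc M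
  have hPm : AEStronglyMeasurable (fun z => radialPotential k k' m r ‖u z‖) :=
    hPuc.comp_aestronglyMeasurable h.measurable
  have hPi : ∀ g : SpaceTime N → ℝ, Continuous g → HasCompactSupport g →
      Integrable (fun z => radialPotential k k' m r ‖u z‖ * g z) := fun g hgc hgs =>
    (hgc.integrable_of_hasCompactSupport hgs).bdd_mul hPm (ae_of_all _ fun z => hCP _ (h.bound z))
  have hdψ : Continuous (fun z => fderiv ℝ ψ z (timeDir N)) :=
    (hψs.continuous_fderiv (by simp)).clm_apply continuous_const
  have i1 := hPi _ hdψ (hψc.fderiv_apply ℝ (timeDir N))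
  have hdθ : Continuous (fun z => ξ z ^ 2 * fderiv ℝ θ z (timeDir N)) :=
    (hξ.continuous.pow 2).mul ((hθ.continuous_fderiv (by simp)).clm_apply continuous_const)
  have i2 := hPi _ hdθ (hξc.mono fun z hz => by
    intro h0; exact hz (by simp [h0]))
  have i3 := h.integrable_energyDensity (k := k) (k' := k') hm hr hξ hξc
  have hD : ∀ i, MemLp (prodDeriv (spaceDir N) ψ (testField m r k k') w G i) 2 := fun i =>
    memLp_prodDeriv hψs hψc hg h.memLp_pow.1 hwM i (h.memLp_G i)
  have i4 : ∀ i, Integrable (fun z => (inner ℝ ((A i + F i) z)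
      (prodDeriv (spaceDir N) ψ (testField m r k k') w G i z) : ℝ)) := fun i =>
    integrable_inner_of_memLp (hV i) (hD i)
  obtain ⟨B, hB⟩ := hψc.exists_bound_of_continuous hψs.continuous
  have i5 : Integrable (fun z => ξ z ^ 2 * θ z * (cutoff k k' (‖u z‖ ^ (2 * m)) ^ 2 *
        levelPow m k (r - 1 - m) (u z) * ∑ i, ‖G i z‖ ^ 2)) := by
    have hcm : AEStronglyMeasurable (fun z => cutoff k k' (‖u z‖ ^ (2 * m)) ^ 2) :=
      (((contDiff_cutoff (k := k) (k' := k')).continuous.comp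
        (Real.continuous_rpow_const (by positivity))).pow 2).comp_aestronglyMeasurable
          h.measurable.norm
    have j1 := (integrable_sum_sq h.memLp_G).bdd_mul (c := 1 * M ^ (r - 1 - m))
      (hcm.mul (h.aestronglyMeasurable_levelPow (k := k) (r - 1 - m))) (ae_of_all _ fun z => by
        simp only [Pi.mul_apply]
        rw [norm_mul]
        refine mul_le_mul ?_ (abs_levelPow_le (by linarith) (h.bound z)) (norm_nonneg _) zero_le_one
        rw [norm_pow, Real.norm_of_nonneg cutoff_nonneg]
        exact pow_le_one₀ cutoff_nonneg cutoff_le_one)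
    exact j1.bdd_mul hψs.continuous.aestronglyMeasurable (ae_of_all _ hB)
  have hpt : ∀ᵐ z, ν / 2 * (ξ z ^ 2 * θ z * (cutoff k k' (‖u z‖ ^ (2 * m)) ^ 2 *
        levelPow m k (r - 1 - m) (u z) * ∑ i, ‖G i z‖ ^ 2)) +
      radialPotential k k' m r ‖u z‖ * fderiv ℝ ψ z (timeDir N) -
      energyDensity m r ν L k k' u F ξ z ≤
      ∑ i, (inner ℝ ((A i + F i) z) (prodDeriv (spaceDir N) ψ
      (testField m r k k') w G i z) : ℝ) +
      radialPotential k k' m r ‖u z‖ * (ξ z ^ 2 * fderiv ℝ θ z (timeDir N)) := by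
    filter_upwards [h.ellipticity, h.growth, h.diagonal] with z h1 h2 h3
    exact flux_lower_bound hm hr hν hL hk0 hk hξ hθ hθ0 hθ1 hθs z h1 h2 h3
  have i5' := i5.const_mul (ν / 2)
  have hint := integral_mono_ae (by exact (i5'.add i1).sub i3)
    (by exact (integrable_finsetSum Finset.univ fun i _ => i4 i).add i2) hpt
  rw [integral_sub (by exact i5'.add i1) i3, integral_add i5' i1, integral_add
    (integrable_finsetSum Finset.univ fun i _ => i4 i) i2, integral_finsetSum _ fun i _ => i4 i,
    integral_const_mul] at hint
  linarith

/-- Energy estimate for the gradient. -/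
theorem LocalSolution.integral_gradient_le (h : LocalSolution m ν L M U u A F G)
    (hm : 0 < m) (hr : 1 + m ≤ r) (hν : 0 < ν) (hL : 0 < L) (hk0 : 0 < k) (hk : k < k')
    (hξ : ContDiff ℝ ∞ ξ) (hξc : HasCompactSupport ξ) (hξU : tsupport ξ ⊆ U) :
    ν / 2 * ∫ z, (ξ z ^ 2 * (cutoff k k' (‖u z‖ ^ (2 * m)) ^ 2 *
        levelPow m k (r - 1 - m) (u z) * ∑ i, ‖G i z‖ ^ 2)) ≤
      ∫ z, energyDensity m r ν L k k' u F ξ z := by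
  have := h.energy_inequality hm hr hν hL hk0 hk hξ hξc hξU (θ := fun _ => 1) contDiff_const
    (fun _ => zero_le_one) (fun _ => le_rfl) (fun z i => by simp)
  simpa using this

/-- Energy estimate on time slices. -/
theorem LocalSolution.ae_integral_slice_le (h : LocalSolution m ν L M U u A F G)
    (hm : 0 < m) (hr : 1 + m ≤ r) (hν : 0 < ν) (hL : 0 < L) (hk0 : 0 < k) (hk : k < k')
    (hξ : ContDiff ℝ ∞ ξ) (hξc : HasCompactSupport ξ) (hξU : tsupport ξ ⊆ U) :
    ∀ᵐ t : ℝ, ∫⁻ x, ENNReal.ofReal (radialPotential k k' m r ‖u (x, t)‖ * ξ (x, t) ^ 2) ≤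
      ENNReal.ofReal (∫ z, energyDensity m r ν L k k' u F ξ z) := by
  have hPc : Continuous (radialPotential k k' m r) := continuous_iff_continuousAt.2 fun x =>
    (hasDerivAt_radialPotential hm (by linarith)).continuousAt
  have hPuc : Continuous (fun v : Space d => radialPotential k k' m r ‖v‖) :=
    hPc.comp continuous_norm
  obtain ⟨CP, -, hCP⟩ := exists_norm_le_of_continuous hPuc M
  have hPm : AEStronglyMeasurable (fun z => radialPotential k k' m r ‖u z‖) :=
    hPuc.comp_aestronglyMeasurable h.measurable
  have hi : Integrable (fun z => radialPotential k k' m r ‖u z‖ * ξ z ^ 2) :=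
    ((hξ.continuous.pow 2).integrable_of_hasCompactSupport (hξc.mono fun z hz => by
      intro h0; exact hz (by simp [h0]))).bdd_mul hPm (ae_of_all _ fun z => hCP _ (h.bound z))
  have hi' := hi
  rw [Measure.volume_eq_prod] at hi'
  set f : ℝ → ℝ := fun t => ∫ x : Space N, radialPotential k k' m r ‖u (x, t)‖ * ξ (x, t) ^ 2
    with hf
  have hfi : Integrable f := hi'.integral_prod_right
  have hfR : ∀ᵐ t, f t ≤ ∫ z, energyDensity m r ν L k k' u F ξ z := by
    refine ae_le_of_convolution_le hfi.locallyIntegrable fun j s => ?_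
    -- For this θ the last term of the energy inequality is minus a bump average of the slice
    -- integrals. Dropping the gradient term bounds all such averages by one number.
    obtain ⟨θ, hθ, hθ0, hθ1, hθd⟩ := exists_time_cutoff j s
    have hfd : ∀ (z e : SpaceTime N), fderiv ℝ (fun z : SpaceTime N => θ z.2) z e =
        e.2 * -j.normed volume (s - z.2) := by
      intro z e
      have a1 : HasDerivAt θ (-j.normed volume (s - z.2)) z.2 := by
        rw [← hθd]; exact (hθ.differentiable (by simp) _).hasDerivAt
      have a2 : HasFDerivAt (fun z : SpaceTime N => z.2)
        (ContinuousLinearMap.snd ℝ (Space N) ℝ) z := hasFDerivAt_snd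
      have a3 : HasFDerivAt (fun z : SpaceTime N => θ z.2) _ z := a1.comp_hasFDerivAt z a2
      rw [a3.fderiv]
      simp [mul_comm]
    have key := h.energy_inequality hm hr hν hL hk0 hk hξ hξc hξU
      (θ := fun z : SpaceTime N => θ z.2) (hθ.comp contDiff_snd) (fun z => hθ0 _) (fun z => hθ1 _)
      (fun z i => by rw [hfd]; simp [spaceDir])
    have hnn : 0 ≤ ν / 2 * ∫ z, (ξ z ^ 2 * θ z.2 * (cutoff k k' (‖u z‖ ^ (2 * m)) ^ 2 *
        levelPow m k (r - 1 - m) (u z) * ∑ i, ‖G i z‖ ^ 2)) := by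
      refine mul_nonneg (by positivity) (integral_nonneg fun z => ?_)
      exact mul_nonneg (mul_nonneg (sq_nonneg _) (hθ0 _)) (mul_nonneg (mul_nonneg (sq_nonneg _)
        (levelPow_nonneg _)) (Finset.sum_nonneg fun i _ => sq_nonneg _))
    have hfub : ∫ z : SpaceTime N, j.normed volume (s - z.2) *
        (radialPotential k k' m r ‖u z‖ * ξ z ^ 2) = ∫ t, j.normed volume (s - t) * f t := by
      obtain ⟨B, hB⟩ := j.hasCompactSupport_normed.exists_bound_of_continuous
        (j.continuous_normed (μ := volume))
      have hji : Integrable (fun z : SpaceTime N => j.normed volume (s - z.2) *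
          (radialPotential k k' m r ‖u z‖ * ξ z ^ 2)) :=
        hi.bdd_mul (j.continuous_normed.comp (by fun_prop)).aestronglyMeasurable
          (ae_of_all _ fun z => hB _)
      rw [Measure.volume_eq_prod] at hji ⊢
      rw [integral_prod_symm _ hji]
      simp only [hf, integral_const_mul]
    have e : ∫ z, radialPotential k k' m r ‖u z‖ *
        (ξ z ^ 2 * fderiv ℝ (fun z : SpaceTime N => θ z.2) z (timeDir N)) =
        -∫ z : SpaceTime N, j.normed volume (s - z.2) *
        (radialPotential k k' m r ‖u z‖ * ξ z ^ 2) := by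
      rw [← integral_neg]
      refine integral_congr_ae (ae_of_all _ fun z => ?_)
      simp only [hfd, timeDir]
      ring
    rw [← hfub]
    linarith
  filter_upwards [hfR, hi'.prod_left_ae] with t h1 h2
  rw [← ofReal_integral_eq_lintegral_ofReal h2 (ae_of_all _ fun x =>
    mul_nonneg (radialPotential_nonneg (norm_nonneg _)) (sq_nonneg _))]
  exact ENNReal.ofReal_le_ofReal h1

end EnergyEstimates

/-! ### Gain of integrability -/

section HigherIntegrability

variable {N d : ℕ} {m ν L M r k k' : ℝ} {U : Set (SpaceTime N)} {u : SpaceTime N → Space d}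
  {A F G : Fin N → SpaceTime N → Space d} {ξ : SpaceTime N → ℝ}

theorem levelPow_mul_rpow {c s : ℝ} (hs : s ≠ 0) (v : Space d) :
    levelPow m k c v ^ s = levelPow m k (c * s) v := by
  rw [levelPow, levelPow]
  split_ifs
  · rw [← Real.rpow_mul (norm_nonneg v)]
  · exact Real.zero_rpow hs

/-- The scalar truncation to which the Sobolev inequality is applied. -/
def sobolevField (m r k k' : ℝ) {d : ℕ} (w : Space d) : ℝ :=
  truncPow k k' ((r + m - 1) / (4 * m)) (‖w‖ ^ 2)

theorem contDiff_sobolevField (hk0 : 0 < k) (hk : k < k') :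
    ContDiff ℝ ∞ (sobolevField m r k k' (d := d)) :=
  contDiff_comp_norm_sq (contDiff_truncPow hk0 hk)

theorem sobolevField_vecPow (hm : 0 < m) (hk : k < k') (v : Space d) :
    sobolevField m r k k' (vecPow m v) =
      cutoff k k' (‖v‖ ^ (2 * m)) ^ 2 * levelPow m k ((r + m - 1) / 2) v := by
  rw [sobolevField, truncPow_eq_levelPow hm hk]
  congr 2
  field_simp
  ring

theorem sobolevField_vecPow_nonneg (hm : 0 < m) (hk : k < k') (v : Space d) :
    0 ≤ sobolevField m r k k' (vecPow m v) := by
  rw [sobolevField_vecPow hm hk]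
  exact mul_nonneg (sq_nonneg _) (levelPow_nonneg _)

theorem sq_sobolevField_vecPow_le (hm : 0 < m) (hk : k < k') (v : Space d) :
    sobolevField m r k k' (vecPow m v) ^ 2 ≤ levelPow m k (r + m - 1) v := by
  rw [sobolevField_vecPow hm hk, mul_pow]
  have h1 : levelPow m k ((r + m - 1) / 2) v ^ 2 = levelPow m k (r + m - 1) v := by
    rw [← Real.rpow_natCast, levelPow_mul_rpow (by norm_num)]
    congr 1
    push_cast
    ring
  rw [h1]
  refine mul_le_of_le_one_left (levelPow_nonneg v) ?_
  rw [← pow_mul]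
  exact pow_le_one₀ cutoff_nonneg cutoff_le_one

/-- The exponent c is chosen so that q^{2c} = q |v|^{r-1-m}: after division by q, the weight is that
of the gradient in the energy estimate. The division is harmless, since the derivative vanishes for
q < k. -/
theorem fderiv_sobolevField_sq_le (hm : 0 < m) (hr : 1 - m ≤ r) (hk0 : 0 < k) (hk : k < k')
    (v g : Space d) : fderiv ℝ (sobolevField m r k k') (vecPow m v) g ^ 2 ≤
      4 * (2 * steepness k k' + (r + m - 1) / (4 * m)) ^ 2 *
        (cutoff k k' (‖v‖ ^ (2 * m)) ^ 2 * levelPow m k (r - 1 - m) v * ‖g‖ ^ 2) := by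
  set c := (r + m - 1) / (4 * m) with hc
  have hc0 : 0 ≤ c := div_nonneg (by linarith) (by linarith)
  set q := ‖v‖ ^ (2 * m) with hq
  have hwq : ‖vecPow m v‖ ^ 2 = q := norm_vecPow_sq hm _
  set T := deriv (truncPow k k' c) q with hT
  have hS := one_le_steepness hk0 hk
  have hf : fderiv ℝ (sobolevField m r k k') (vecPow m v) g =
      2 * T * inner ℝ (vecPow m v) g := by
    unfold sobolevField
    rw [fderiv_comp_norm_sq (contDiff_truncPow hk0 hk), hwq]
  have hin : (inner ℝ (vecPow m v) g : ℝ) ^ 2 ≤ q * ‖g‖ ^ 2 := by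
    rw [← hwq, ← mul_pow, ← sq_abs]
    exact pow_le_pow_left₀ (abs_nonneg _) (abs_real_inner_le_norm _ _) 2
  have hR0 : 0 ≤ cutoff k k' q ^ 2 * levelPow m k (r - 1 - m) v :=
    mul_nonneg (sq_nonneg _) (levelPow_nonneg _)
  have hTq : T ^ 2 * q ≤ (2 * steepness k k' + c) ^ 2 *
      (cutoff k k' q ^ 2 * levelPow m k (r - 1 - m) v) := by
    by_cases h : q < k
    · rw [hT, deriv_truncPow_eq_zero hk h]
      simpa using mul_nonneg (sq_nonneg _) hR0
    · have hq0 : 0 < q := by linarith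
      have hv0 : 0 < ‖v‖ := by
        refine lt_of_le_of_ne (norm_nonneg v) fun h0 => ?_
        rw [hq, ← h0, Real.zero_rpow (by positivity)] at hq0
        exact lt_irrefl _ hq0
      have h1 : q * T ≤ cutoff k k' q * q ^ c * (2 * steepness k k' + c) :=
        mul_deriv_truncPow_le hk0 hk hc0 hq0.le
      have hT0 : 0 ≤ T := deriv_truncPow_nonneg hk0 hk hc0
      have h2 := pow_le_pow_left₀ (by positivity) h1 2
      have h3 : (cutoff k k' q * q ^ c) ^ 2 =
          q * (cutoff k k' q ^ 2 * levelPow m k (r - 1 - m) v) := by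
        by_cases h : k < q
        · have e : levelPow m k (r - 1 - m) v = ‖v‖ ^ (r - 1 - m) := if_pos h
          rw [e, mul_pow, mul_left_comm]
          congr 1
          rw [hq, ← Real.rpow_mul hv0.le, ← Real.rpow_natCast, ← Real.rpow_mul hv0.le,
            ← Real.rpow_add hv0]
          congr 1
          rw [hc]
          push_cast
          field_simp
          ring
        · rw [cutoff_eq_zero hk (not_lt.1 h)]; simp
      rw [mul_pow _ (2 * steepness k k' + c), h3] at h2
      have h4 : q * (T ^ 2 * q) ≤ q * ((2 * steepness k k' + c) ^ 2 *
        (cutoff k k' q ^ 2 * levelPow m k (r - 1 - m) v)) := by linarith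
      exact le_of_mul_le_mul_left h4 hq0
  rw [hf]
  calc (2 * T * inner ℝ (vecPow m v) g) ^ 2 = 4 * T ^ 2 * (inner ℝ (vecPow m v) g : ℝ) ^ 2 := by ring
    _ ≤ 4 * T ^ 2 * (q * ‖g‖ ^ 2) := by gcongr
    _ = 4 * (T ^ 2 * q) * ‖g‖ ^ 2 := by ring
    _ ≤ 4 * ((2 * steepness k k' + c) ^ 2 *
      (cutoff k k' q ^ 2 * levelPow m k (r - 1 - m) v)) * ‖g‖ ^ 2 := by gcongr
    _ = _ := by ring

theorem prodDeriv_sobolevField_sq_le (hm : 0 < m) (hr : 1 - m ≤ r) (hk0 : 0 < k) (hk : k < k')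
    (i : Fin N) (z : SpaceTime N) :
    prodDeriv (spaceDir N) ξ (sobolevField m r k k') (fun z => vecPow m (u z)) G i z ^ 2 ≤
      2 * (levelPow m k (r + m - 1) (u z) * fderiv ℝ ξ z (spaceDir N i) ^ 2) +
      8 * (2 * steepness k k' + (r + m - 1) / (4 * m)) ^ 2 *
        (ξ z ^ 2 * (cutoff k k' (‖u z‖ ^ (2 * m)) ^ 2 * levelPow m k (r - 1 - m) (u z) *
          ‖G i z‖ ^ 2)) := by
  rw [prodDeriv, smul_eq_mul, smul_eq_mul]
  have h1 := sq_sobolevField_vecPow_le (r := r) hm hk (u z)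
  have h2 := fderiv_sobolevField_sq_le hm hr hk0 hk (u z) (G i z)
  have h3 := mul_le_mul_of_nonneg_left h1 (sq_nonneg (fderiv ℝ ξ z (spaceDir N i)))
  have h4 := mul_le_mul_of_nonneg_left h2 (sq_nonneg (ξ z))
  refine (add_sq_le).trans ?_
  simp only [mul_pow]
  linarith

/-- The exponent 2r/(r+m-1) turns |v|^{(r+m-1)/2} into |v|^r. It is at least 2 because m ≤ 1, so the
powers of s and of the cutoff are dominated by s² and χ⁴, and `le_radialPotential` applies. -/
theorem sobolevField_rpow_le (hm : 0 < m) (hm1 : m ≤ 1) (hr : 1 ≤ r) (hk0 : 0 < k) (hk : k < k')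
    {s : ℝ} (hs0 : 0 ≤ s) (hs1 : s ≤ 1) (v : Space d) :
    (s * sobolevField m r k k' (vecPow m v)) ^ (2 * r / (r + m - 1)) ≤
      (8 * m * steepness k k' + r) * (radialPotential k k' m r ‖v‖ * s ^ 2) := by
  have hrm : 0 < r + m - 1 := by linarith
  have hγ : 2 ≤ 2 * r / (r + m - 1) := by rw [le_div_iff₀ hrm]; linarith
  set γ := 2 * r / (r + m - 1) with hγd
  have hf0 := sobolevField_vecPow_nonneg (r := r) hm hk v
  have hv0 := norm_nonneg v
  have h1 : s ^ γ ≤ s ^ 2 := by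
    rw [← Real.rpow_natCast]
    exact Real.rpow_le_rpow_of_exponent_ge' hs0 hs1 (by norm_num) (by exact_mod_cast hγ)
  have h2 : sobolevField m r k k' (vecPow m v) ^ γ ≤
      cutoff k k' (‖v‖ ^ (2 * m)) ^ 4 * ‖v‖ ^ r := by
    rw [sobolevField_vecPow hm hk, Real.mul_rpow (sq_nonneg _) (levelPow_nonneg _)]
    have c0 : 0 ≤ cutoff k k' (‖v‖ ^ (2 * m)) := cutoff_nonneg
    have c1 : cutoff k k' (‖v‖ ^ (2 * m)) ≤ 1 := cutoff_le_one
    refine mul_le_mul ?_ ?_ (Real.rpow_nonneg (levelPow_nonneg _) _) (by positivity)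
    · rw [show cutoff k k' (‖v‖ ^ (2 * m)) ^ 4 = (cutoff k k' (‖v‖ ^ (2 * m)) ^ 2) ^ (2 : ℝ) by
        norm_cast; rw [← pow_mul]]
      exact Real.rpow_le_rpow_of_exponent_ge' (sq_nonneg _) (pow_le_one₀ c0 c1) (by norm_num) hγ
    · rw [levelPow_mul_rpow (by positivity)]
      have : (r + m - 1) / 2 * γ = r := by rw [hγd]; field_simp
      rw [this, levelPow]
      split_ifs
      · exact le_rfl
      · positivity
  have h3 := le_radialPotential hk0 hk hm hr hv0
  rw [Real.mul_rpow hs0 hf0]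
  calc _ ≤ s ^ 2 * ((8 * m * steepness k k' + r) * radialPotential k k' m r ‖v‖) :=
        mul_le_mul h1 (h2.trans h3) (Real.rpow_nonneg hf0 _) (sq_nonneg _)
    _ = _ := by ring

/-- The part with the gradient of ξ is already contained in the energy density, thanks to the
summand 1 in its second coefficient. The part with `G` is the left side of
`LocalSolution.integral_gradient_le`. -/
theorem LocalSolution.sum_lintegral_prodDeriv_le (h : LocalSolution m ν L M U u A F G)
    (hm : 0 < m) (hr : 1 + m ≤ r) (hν : 0 < ν) (hL : 0 < L) (hk0 : 0 < k) (hk : k < k')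
    (hξ : ContDiff ℝ ∞ ξ) (hξc : HasCompactSupport ξ) (hξU : tsupport ξ ⊆ U) :
    ∑ i, ∫⁻ z, ‖prodDeriv (spaceDir N) ξ (sobolevField m r k k') (fun z => vecPow m (u z))
        G i z‖ₑ ^ (2 : ℝ) ≤
      ENNReal.ofReal ((2 + 16 * (2 * steepness k k' + (r + m - 1) / (4 * m)) ^ 2 / ν) *
        ∫ z, energyDensity m r ν L k k' u F ξ z) := by
  set c := 8 * (2 * steepness k k' + (r + m - 1) / (4 * m)) ^ 2 with hc
  have hc0 : 0 ≤ c := by positivity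
  have hwM : ∀ z, ‖vecPow m (u z)‖ ≤ M ^ m := fun z => by
    rw [norm_vecPow hm]; exact Real.rpow_le_rpow (norm_nonneg _) (h.bound z) hm.le
  have hmem : ∀ i, MemLp (prodDeriv (spaceDir N) ξ (sobolevField m r k k')
      (fun z => vecPow m (u z)) G i) 2 := fun i =>
    memLp_prodDeriv hξ hξc (contDiff_sobolevField hk0 hk) h.memLp_pow.1 hwM i (h.memLp_G i)
  have hint : ∀ i, Integrable (fun z => prodDeriv (spaceDir N) ξ (sobolevField m r k k')
      (fun z => vecPow m (u z)) G i z ^ 2) := fun i => (hmem i).integrable_sq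
  have e1 : ∀ i, ∫⁻ z, ‖prodDeriv (spaceDir N) ξ (sobolevField m r k k')
      (fun z => vecPow m (u z)) G i z‖ₑ ^ (2 : ℝ) = ENNReal.ofReal
      (∫ z, prodDeriv (spaceDir N) ξ (sobolevField m r k k') (fun z => vecPow m (u z)) G i z ^ 2) := by
    intro i
    rw [ofReal_integral_eq_lintegral_ofReal (hint i) (ae_of_all _ fun z => sq_nonneg _)]
    refine lintegral_congr fun z => ?_
    rw [← sq_abs, ENNReal.ofReal_pow (abs_nonneg _), ← Real.enorm_eq_ofReal_abs]
    norm_cast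
  simp only [e1]
  rw [← ENNReal.ofReal_sum_of_nonneg fun i _ => integral_nonneg fun z => sq_nonneg _,
    ← integral_finsetSum _ fun i _ => hint i]
  refine ENNReal.ofReal_le_ofReal ?_
  have hgrad := h.integral_gradient_le hm hr hν hL hk0 hk hξ hξc hξU
  -- integrability of the two parts of the upper bound
  have hdc : ∀ e, Continuous (fun z => fderiv ℝ ξ z e) := fun e =>
    (hξ.continuous_fderiv (by simp)).clm_apply continuous_const
  have i1 : Integrable (fun z => levelPow m k (r + m - 1) (u z) *
      ∑ i, fderiv ℝ ξ z (spaceDir N i) ^ 2) := by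
    refine Integrable.bdd_mul ?_ (h.aestronglyMeasurable_levelPow _)
      (ae_of_all _ fun z => abs_levelPow_le (by linarith) (h.bound z))
    refine integrable_finsetSum _ fun i _ => ?_
    have hcont : Continuous (fun z => fderiv ℝ ξ z (spaceDir N i) ^ 2) := (hdc _).pow 2
    refine hcont.integrable_of_hasCompactSupport ((hξc.fderiv_apply ℝ (spaceDir N i)).mono
      fun z hz => ?_)
    intro h0
    exact hz (by simp [h0])
  obtain ⟨B, hB⟩ := hξc.exists_bound_of_continuous hξ.continuous
  have i2 : Integrable (fun z => ξ z ^ 2 * (cutoff k k' (‖u z‖ ^ (2 * m)) ^ 2 *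
        levelPow m k (r - 1 - m) (u z) * ∑ i, ‖G i z‖ ^ 2)) := by
    have hcm : AEStronglyMeasurable (fun z => cutoff k k' (‖u z‖ ^ (2 * m)) ^ 2) :=
      (((contDiff_cutoff (k := k) (k' := k')).continuous.comp
        (Real.continuous_rpow_const (by positivity))).pow 2).comp_aestronglyMeasurable
          h.measurable.norm
    have j1 := (integrable_sum_sq h.memLp_G).bdd_mul (c := 1 * M ^ (r - 1 - m))
      (hcm.mul (h.aestronglyMeasurable_levelPow (k := k) (r - 1 - m))) (ae_of_all _ fun z => by
        simp only [Pi.mul_apply]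
        rw [norm_mul]
        refine mul_le_mul ?_ (abs_levelPow_le (by linarith) (h.bound z)) (norm_nonneg _) zero_le_one
        rw [norm_pow, Real.norm_of_nonneg cutoff_nonneg]
        exact pow_le_one₀ cutoff_nonneg cutoff_le_one)
    exact j1.bdd_mul (c := B ^ 2) (hξ.continuous.pow 2).aestronglyMeasurable (ae_of_all _ fun z => by
      rw [norm_pow]; exact pow_le_pow_left₀ (norm_nonneg _) (hB z) 2)
  have i3 := h.integrable_energyDensity (k := k) (k' := k') hm hr hξ hξc
  have hD1 : ∫ z, levelPow m k (r + m - 1) (u z) * ∑ i, fderiv ℝ ξ z (spaceDir N i) ^ 2 ≤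
      ∫ z, energyDensity m r ν L k k' u F ξ z := by
    refine integral_mono i1 i3 fun z => ?_
    have t1 : 0 ≤ levelPow m k r (u z) * max (2 * ξ z * fderiv ℝ ξ z (timeDir N)) 0 :=
      mul_nonneg (levelPow_nonneg _) (le_max_right _ _)
    have t2 : 0 ≤ levelPow m k (r + m - 1) (u z) * ∑ i, fderiv ℝ ξ z (spaceDir N i) ^ 2 :=
      mul_nonneg (levelPow_nonneg _) (Finset.sum_nonneg fun i _ => sq_nonneg _)
    have t3 : 0 ≤ (1 + (1 + 2 * (2 * steepness k k' + (r - 1 - m) / (2 * m))) ^ 2 / ν) *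
        (ξ z ^ 2 * levelPow m k (r - 1 - m) (u z) * ∑ i, ‖F i z‖ ^ 2) :=
      mul_nonneg (by positivity) (mul_nonneg (mul_nonneg (sq_nonneg _) (levelPow_nonneg _))
        (Finset.sum_nonneg fun i _ => sq_nonneg _))
    have t4 : 0 ≤ 4 * L ^ 2 / ν * (levelPow m k (r + m - 1) (u z) *
        ∑ i, fderiv ℝ ξ z (spaceDir N i) ^ 2) := mul_nonneg (by positivity) t2
    simp only [energyDensity]
    linarith
  calc _ ≤ ∫ z, (2 * (levelPow m k (r + m - 1) (u z) * ∑ i, fderiv ℝ ξ z (spaceDir N i) ^ 2) +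
        c * (ξ z ^ 2 * (cutoff k k' (‖u z‖ ^ (2 * m)) ^ 2 *
        levelPow m k (r - 1 - m) (u z) * ∑ i, ‖G i z‖ ^ 2))) := by
        refine integral_mono (integrable_finsetSum _ fun i _ => hint i)
          ((i1.const_mul 2).add (i2.const_mul c)) fun z => ?_
        refine (Finset.sum_le_sum fun i _ => prodDeriv_sobolevField_sq_le hm (by linarith) hk0 hk i
          z).trans_eq ?_
        rw [Finset.sum_add_distrib]
        simp only [← Finset.mul_sum, hc]
    _ = 2 * (∫ z, levelPow m k (r + m - 1) (u z) * ∑ i, fderiv ℝ ξ z (spaceDir N i) ^ 2) +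
        2 * c / ν * (ν / 2 * ∫ z, ξ z ^ 2 * (cutoff k k' (‖u z‖ ^ (2 * m)) ^ 2 *
        levelPow m k (r - 1 - m) (u z) * ∑ i, ‖G i z‖ ^ 2)) := by
        rw [integral_add (i1.const_mul 2) (i2.const_mul c), integral_const_mul, integral_const_mul]
        field_simp
    _ ≤ 2 * (∫ z, energyDensity m r ν L k k' u F ξ z) +
        2 * c / ν * ∫ z, energyDensity m r ν L k k' u F ξ z := by
        gcongr
    _ = _ := by rw [hc]; ring

/-- Gain of integrability by the parabolic Sobolev inequality. -/
theorem exists_higher_integrability (hN : 2 < N) : ∃ C : ℝ, 0 ≤ C ∧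
    ∀ (d : ℕ) (m ν L M r k k' : ℝ) (U : Set (SpaceTime N)) (u : SpaceTime N → Space d)
    (A F G : Fin N → SpaceTime N → Space d) (ξ : SpaceTime N → ℝ),
    LocalSolution m ν L M U u A F G → 0 < m → m ≤ 1 → 1 + m ≤ r → 0 < ν → 0 < L → 0 < k → k < k' →
    ContDiff ℝ ∞ ξ → HasCompactSupport ξ → tsupport ξ ⊆ U → (∀ z, 0 ≤ ξ z) → (∀ z, ξ z ≤ 1) →
    ∀ S : Set (SpaceTime N), MeasurableSet S → (∀ z ∈ S, ξ z = 1) →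
    ∫⁻ z in S, ENNReal.ofReal (levelPow m k' (r + m - 1 + 2 * r / N) (u z)) ≤
      ENNReal.ofReal (C * ((8 * m * steepness k k' + r) *
        ∫ z, energyDensity m r ν L k k' u F ξ z) ^ (2 / (N : ℝ)) *
        ((2 + 16 * (2 * steepness k k' + (r + m - 1) / (4 * m)) ^ 2 / ν) *
        ∫ z, energyDensity m r ν L k k' u F ξ z)) := by
  obtain ⟨C, hCt, hC⟩ := parabolic_sobolev hN
  refine ⟨C.toReal, ENNReal.toReal_nonneg, fun d m ν L M r k k' U u A F G ξ h hm hm1 hr hν hL hk0 hk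
    hξ hξc hξU hξ0 hξ1 S hS hξS => ?_⟩
  have hN' : (2 : ℝ) < N := by exact_mod_cast hN
  set R := ∫ z, energyDensity m r ν L k k' u F ξ z with hR
  have hR0 : 0 ≤ R := by
    have := h.integral_gradient_le hm hr hν hL hk0 hk hξ hξc hξU
    refine le_trans (mul_nonneg (by positivity) (integral_nonneg fun z => ?_)) this
    exact mul_nonneg (sq_nonneg _) (mul_nonneg (mul_nonneg (sq_nonneg _)
        (levelPow_nonneg _)) (Finset.sum_nonneg fun i _ => sq_nonneg _))
  have hst : 0 ≤ steepness k k' := zero_le_one.trans (one_le_steepness hk0 hk)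
  have hrm : 0 < r + m - 1 := by linarith
  have hr0 : 0 < r := by linarith
  have hc0 : 0 ≤ 8 * m * steepness k k' + r := by positivity
  have hwM : ∀ z, ‖vecPow m (u z)‖ ≤ M ^ m := fun z => by
    rw [norm_vecPow hm]; exact Real.rpow_le_rpow (norm_nonneg _) (h.bound z) hm.le
  set γ := 2 * r / (r + m - 1) with hγ
  have hγ0 : 0 ≤ γ := div_nonneg (by linarith) hrm.le
  have hslice : ∀ᵐ t : ℝ, ∫⁻ x, ‖ξ (x, t) • sobolevField m r k k' (vecPow m (u (x, t)))‖ₑ ^ γ ≤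
      ENNReal.ofReal ((8 * m * steepness k k' + r) * R) := by
    filter_upwards [h.ae_integral_slice_le hm hr hν hL hk0 hk hξ hξc hξU] with t ht
    have hle : ∀ x, ‖ξ (x, t) • sobolevField m r k k' (vecPow m (u (x, t)))‖ₑ ^ γ ≤
        ENNReal.ofReal (8 * m * steepness k k' + r) *
        ENNReal.ofReal (radialPotential k k' m r ‖u (x, t)‖ * ξ (x, t) ^ 2) := by
      intro x
      have h0 : 0 ≤ ξ (x, t) * sobolevField m r k k' (vecPow m (u (x, t))) :=
        mul_nonneg (hξ0 _) (sobolevField_vecPow_nonneg hm hk _)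
      rw [smul_eq_mul, Real.enorm_eq_ofReal h0, ENNReal.ofReal_rpow_of_nonneg h0 hγ0,
        ← ENNReal.ofReal_mul hc0]
      exact ENNReal.ofReal_le_ofReal (sobolevField_rpow_le hm hm1 (by linarith) hk0 hk (hξ0 _)
        (hξ1 _) _)
    refine (lintegral_mono hle).trans ?_
    rw [lintegral_const_mul' _ _ ENNReal.ofReal_ne_top, ENNReal.ofReal_mul hc0]
    gcongr
  have key := hC (Space d) U (fun z => vecPow m (u z)) G (M ^ m) ξ (sobolevField m r k k') γ _
    h.grad h.isOpen h.memLp_pow h.memLp_G hwM hξ hξc hξU (contDiff_sobolevField hk0 hk) hγ0 hslice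
  -- On `S` one has ξ = 1, and above level k' the truncated power is the full |u|^{(r+m-1)/2};
  -- raised to 2 + 2γ/N it has the exponent on the left.
  have hleft : ∫⁻ z in S, ENNReal.ofReal (levelPow m k' (r + m - 1 + 2 * r / N) (u z)) ≤
      ∫⁻ z, ‖ξ z • sobolevField m r k k' (vecPow m (u z))‖ₑ ^ (2 + 2 * γ / N) := by
    refine (setLIntegral_mono_ae' hS (ae_of_all _ fun z hz => ?_)).trans
      (setLIntegral_le_lintegral S _)
    rw [levelPow]
    split_ifs with hku
    · have hlt : k < ‖u z‖ ^ (2 * m) := hk.trans hku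
      have e1 : sobolevField m r k k' (vecPow m (u z)) = ‖u z‖ ^ ((r + m - 1) / 2) := by
        rw [sobolevField_vecPow hm hk, cutoff_eq_one hk hku.le, levelPow, if_pos hlt]
        simp
      rw [hξS z hz, one_smul, e1, Real.enorm_eq_ofReal (by positivity),
        ENNReal.ofReal_rpow_of_nonneg (by positivity) (by positivity),
        ← Real.rpow_mul (norm_nonneg _)]
      refine le_of_eq ?_
      congr 2
      rw [hγ]
      field_simp
    · simp
  refine hleft.trans (key.trans ?_)
  have hsum := h.sum_lintegral_prodDeriv_le hm hr hν hL hk0 hk hξ hξc hξU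
  have hA0 : 0 ≤ (8 * m * steepness k k' + r) * R := mul_nonneg hc0 hR0
  rw [ENNReal.ofReal_mul (mul_nonneg ENNReal.toReal_nonneg (Real.rpow_nonneg hA0 _)),
    ENNReal.ofReal_mul ENNReal.toReal_nonneg, ENNReal.ofReal_toReal hCt,
    ← ENNReal.ofReal_rpow_of_nonneg hA0 (by positivity)]
  gcongr

end HigherIntegrability

/-! ### Smooth cutoffs between cylinders -/

section ParabolicCutoff

variable {N : ℕ}

theorem fderiv_mul_prod_spaceDir {η : Space N → ℝ} {ζ : ℝ → ℝ} (hη : ContDiff ℝ ∞ η)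
    (hζ : ContDiff ℝ ∞ ζ) (z : SpaceTime N) (v : Space N) (s : ℝ) :
    fderiv ℝ (fun z : SpaceTime N => η z.1 * ζ z.2) z (v, s) =
      ζ z.2 * fderiv ℝ η z.1 v + η z.1 * (s * deriv ζ z.2) := by
  have h1 : HasFDerivAt (fun z : SpaceTime N => η z.1) _ z :=
    (hη.differentiable (by simp) z.1).hasFDerivAt.comp z hasFDerivAt_fst
  have h2 : HasFDerivAt (fun z : SpaceTime N => ζ z.2) _ z :=
    (hζ.differentiable (by simp) z.2).hasDerivAt.hasFDerivAt.comp z hasFDerivAt_snd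
  have h3 : HasFDerivAt (fun z : SpaceTime N => η z.1 * ζ z.2) _ z := h1.mul h2
  rw [h3.fderiv]
  simp
  ring

theorem deriv_cutoff_eq_zero_of_gt {k k' q : ℝ} (hk : k < k') (h : q < k) :
    deriv (cutoff k k') q = 0 := by
  have : cutoff k k' =ᶠ[𝓝 q] fun _ => 0 := by
    filter_upwards [gt_mem_nhds h] with x hx using cutoff_eq_zero hk hx.le
  rw [this.deriv_eq, deriv_const]

/-- A smooth radial cutoff between two concentric balls. -/
theorem exists_radial_cutoff (x₀ : Space N) {ρ₂ ρ₁ : ℝ} (h0 : 0 < ρ₂) (h : ρ₂ < ρ₁) :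
    ∃ η : Space N → ℝ, ContDiff ℝ ∞ η ∧
      (∀ x, η x ≠ 0 → x ∈ Metric.closedBall x₀ ((ρ₁ + ρ₂) / 2)) ∧
      (∀ x, 0 ≤ η x) ∧ (∀ x, η x ≤ 1) ∧ (∀ x ∈ Metric.ball x₀ ρ₂, η x = 1) ∧
      ∀ x, ∑ i, fderiv ℝ η x (EuclideanSpace.single i 1) ^ 2 ≤
        16 * transitionBound ^ 2 / (ρ₁ - ρ₂) ^ 2 := by
  set ρm := (ρ₁ + ρ₂) / 2 with hρm
  have hm1 : ρ₂ < ρm := by rw [hρm]; linarith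
  have hlt : -ρm ^ 2 < -ρ₂ ^ 2 := by nlinarith
  have hT := one_le_transitionBound
  -- Minus the squared distance is smooth at the centre and has the right monotonicity; stopping at
  -- the midpoint radius leaves the support compactly inside the larger ball.
  refine ⟨fun x => cutoff (-ρm ^ 2) (-ρ₂ ^ 2) (-‖x - x₀‖ ^ 2), ?_, fun x hx => ?_,
    fun x => cutoff_nonneg, fun x => cutoff_le_one, fun x hx => cutoff_eq_one hlt ?_, fun x => ?_⟩
  · exact contDiff_cutoff.comp ((contDiff_id.sub contDiff_const).norm_sq ℝ).neg
  · rw [Metric.mem_closedBall, dist_eq_norm]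
    by_contra hcon
    exact hx (cutoff_eq_zero hlt (by nlinarith [not_le.1 hcon]))
  · rw [Metric.mem_ball, dist_eq_norm] at hx
    nlinarith [norm_nonneg (x - x₀)]
  · have hd : ∀ v, fderiv ℝ (fun x => cutoff (-ρm ^ 2) (-ρ₂ ^ 2) (-‖x - x₀‖ ^ 2)) x v =
        deriv (cutoff (-ρm ^ 2) (-ρ₂ ^ 2)) (-‖x - x₀‖ ^ 2) * (-(2 * inner ℝ (x - x₀) v)) := by
      intro v
      have h1 : HasFDerivAt (fun x : Space N => -‖x - x₀‖ ^ 2) _ x :=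
        (((hasFDerivAt_id x).sub_const x₀).norm_sq).neg
      have h2 := (hasDerivAt_cutoff (k := -ρm ^ 2) (k' := -ρ₂ ^ 2)
          (q := -‖x - x₀‖ ^ 2)).comp_hasFDerivAt x h1
      have h3 : fderiv ℝ (fun x => cutoff (-ρm ^ 2) (-ρ₂ ^ 2) (-‖x - x₀‖ ^ 2)) x = _ := h2.fderiv
      rw [h3]
      simp [inner_sub_left]
    have hsum : ∑ i, fderiv ℝ (fun x => cutoff (-ρm ^ 2) (-ρ₂ ^ 2) (-‖x - x₀‖ ^ 2)) x
        (EuclideanSpace.single i 1) ^ 2 =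
        (deriv (cutoff (-ρm ^ 2) (-ρ₂ ^ 2)) (-‖x - x₀‖ ^ 2) * (2 * ‖x - x₀‖)) ^ 2 := by
      simp only [hd]
      rw [mul_pow, mul_pow, EuclideanSpace.norm_sq_eq, Finset.mul_sum, Finset.mul_sum]
      refine Finset.sum_congr rfl fun i _ => ?_
      rw [EuclideanSpace.inner_single_right]
      simp
      ring
    rw [hsum]
    by_cases hx : ρm < ‖x - x₀‖
    · rw [deriv_cutoff_eq_zero_of_gt hlt (by nlinarith)]
      simp only [zero_mul, ne_eq, OfNat.ofNat_ne_zero, not_false_eq_true, zero_pow]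
      positivity
    · have hx' := not_lt.1 hx
      have hb : |deriv (cutoff (-ρm ^ 2) (-ρ₂ ^ 2)) (-‖x - x₀‖ ^ 2) * (2 * ‖x - x₀‖)| ≤
          4 * transitionBound / (ρ₁ - ρ₂) := by
        rw [abs_mul, abs_of_nonneg (by positivity : 0 ≤ 2 * ‖x - x₀‖)]
        calc _ ≤ transitionBound / (-ρ₂ ^ 2 - -ρm ^ 2) * (2 * (ρm + ρ₂)) := by
              refine mul_le_mul (abs_deriv_cutoff_le hlt) (by linarith) (by positivity) ?_
              exact div_nonneg (by linarith) (by linarith)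
          _ = _ := by
              have e : -ρ₂ ^ 2 - -ρm ^ 2 = ((ρ₁ - ρ₂) / 2) * (ρm + ρ₂) := by rw [hρm]; ring
              have h1 : ρ₁ - ρ₂ ≠ 0 := by linarith
              have h2 : ρm + ρ₂ ≠ 0 := by linarith
              rw [e]
              field_simp
              norm_num
      calc _ = |deriv (cutoff (-ρm ^ 2) (-ρ₂ ^ 2)) (-‖x - x₀‖ ^ 2) * (2 * ‖x - x₀‖)| ^ 2 :=
            (sq_abs _).symm
        _ ≤ (4 * transitionBound / (ρ₁ - ρ₂)) ^ 2 := pow_le_pow_left₀ (abs_nonneg _) hb 2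
        _ = _ := by rw [div_pow]; ring

/-- A smooth cutoff in time which is increasing up to the cylinder and decreasing afterwards. -/
theorem exists_temporal_cutoff {s₁ s₂ t₂ t₁ : ℝ} (hs : s₁ < s₂) (ht : t₂ < t₁) :
    ∃ ζ : ℝ → ℝ, ContDiff ℝ ∞ ζ ∧ (∀ t, ζ t ≠ 0 → t ∈ Icc ((s₁ + s₂) / 2) ((t₁ + t₂) / 2)) ∧
      (∀ t, 0 ≤ ζ t) ∧ (∀ t, ζ t ≤ 1) ∧ (∀ t ∈ Ioc s₂ t₂, ζ t = 1) ∧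
      ∀ t, deriv ζ t ≤ 2 * transitionBound / (s₂ - s₁) := by
  have hT := one_le_transitionBound
  have h1 : (s₁ + s₂) / 2 < s₂ := by linarith
  have h2 : -((t₁ + t₂) / 2) < -t₂ := by linarith
  refine ⟨fun t => cutoff ((s₁ + s₂) / 2) s₂ t * cutoff (-((t₁ + t₂) / 2)) (-t₂) (-t),
    contDiff_cutoff.mul (contDiff_cutoff.comp contDiff_neg), fun t ht => ?_,
    fun t => mul_nonneg cutoff_nonneg cutoff_nonneg,
    fun t => mul_le_one₀ cutoff_le_one cutoff_nonneg cutoff_le_one, fun t ht => ?_, fun t => ?_⟩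
  · obtain ⟨ha, hb⟩ := mul_ne_zero_iff.1 ht
    refine ⟨not_lt.1 fun hlt => ha (cutoff_eq_zero h1 hlt.le), not_lt.1 fun hlt => hb
      (cutoff_eq_zero h2 (by linarith))⟩
  · change cutoff _ _ _ * cutoff _ _ _ = 1
    rw [cutoff_eq_one h1 ht.1.le, cutoff_eq_one h2 (by linarith [ht.2]), one_mul]
  · have hd : HasDerivAt (fun t => cutoff (-((t₁ + t₂) / 2)) (-t₂) (-t))
        (deriv (cutoff (-((t₁ + t₂) / 2)) (-t₂)) (-t) * -1) t :=
      (hasDerivAt_cutoff (k := -((t₁ + t₂) / 2)) (k' := -t₂) (q := -t)).comp t (hasDerivAt_neg t)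
    have hd2 := (hasDerivAt_cutoff (k := (s₁ + s₂) / 2) (k' := s₂) (q := t)).mul hd
    have hd3 : deriv (fun t => cutoff ((s₁ + s₂) / 2) s₂ t *
      cutoff (-((t₁ + t₂) / 2)) (-t₂) (-t)) t = _ := hd2.deriv
    rw [hd3]
    have b1 : deriv (cutoff ((s₁ + s₂) / 2) s₂) t ≤ 2 * transitionBound / (s₂ - s₁) := by
      refine (le_abs_self _).trans ((abs_deriv_cutoff_le h1).trans_eq ?_)
      have : s₂ - s₁ ≠ 0 := by linarith
      have e : s₂ - (s₁ + s₂) / 2 = (s₂ - s₁) / 2 := by ring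
      rw [e]; field_simp
    have b2 : deriv (cutoff ((s₁ + s₂) / 2) s₂) t * cutoff (-((t₁ + t₂) / 2)) (-t₂) (-t) ≤
        deriv (cutoff ((s₁ + s₂) / 2) s₂) t :=
      mul_le_of_le_one_right (deriv_cutoff_nonneg h1) cutoff_le_one
    -- The decreasing factor contributes with a favourable sign, so the derivative bound does not
    -- involve the gap between t₂ and t₁. This permits estimates up to the final time.
    have b3 : 0 ≤ cutoff ((s₁ + s₂) / 2) s₂ t * deriv (cutoff (-((t₁ + t₂) / 2)) (-t₂)) (-t) :=
      mul_nonneg cutoff_nonneg (deriv_cutoff_nonneg h2)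
    linarith

theorem exists_parabolic_cutoff (x₀ : Space N) {ρ₂ ρ₁ s₁ s₂ t₂ t₁ : ℝ} (h0 : 0 < ρ₂) (h : ρ₂ < ρ₁)
    (hs : s₁ < s₂) (ht : t₂ < t₁) :
    ∃ ξ : SpaceTime N → ℝ, ContDiff ℝ ∞ ξ ∧ HasCompactSupport ξ ∧
      tsupport ξ ⊆ Metric.ball x₀ ρ₁ ×ˢ Ioo s₁ t₁ ∧ (∀ z, 0 ≤ ξ z) ∧ (∀ z, ξ z ≤ 1) ∧
      (∀ z ∈ Metric.ball x₀ ρ₂ ×ˢ Ioc s₂ t₂, ξ z = 1) ∧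
      (∀ z, ∑ i, fderiv ℝ ξ z (spaceDir N i) ^ 2 ≤ 16 * transitionBound ^ 2 / (ρ₁ - ρ₂) ^ 2) ∧
      ∀ z, 2 * ξ z * fderiv ℝ ξ z (timeDir N) ≤ 4 * transitionBound / (s₂ - s₁) := by
  have hT := one_le_transitionBound
  obtain ⟨η, hη, hηs, hη0, hη1, hηe, hηd⟩ := exists_radial_cutoff x₀ h0 h
  obtain ⟨ζ, hζ, hζs, hζ0, hζ1, hζe, hζd⟩ := exists_temporal_cutoff hs ht
  have hsub : Function.support (fun z : SpaceTime N => η z.1 * ζ z.2) ⊆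
      Metric.closedBall x₀ ((ρ₁ + ρ₂) / 2) ×ˢ Icc ((s₁ + s₂) / 2) ((t₁ + t₂) / 2) := by
    intro z hz
    obtain ⟨ha, hb⟩ := mul_ne_zero_iff.1 hz
    exact ⟨hηs _ ha, hζs _ hb⟩
  have hcpt : IsCompact (Metric.closedBall x₀ ((ρ₁ + ρ₂) / 2) ×ˢ
      Icc ((s₁ + s₂) / 2) ((t₁ + t₂) / 2)) :=
    (isCompact_closedBall _ _).prod isCompact_Icc
  refine ⟨fun z => η z.1 * ζ z.2, (hη.comp contDiff_fst).mul (hζ.comp contDiff_snd),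
    HasCompactSupport.of_support_subset_isCompact hcpt hsub, ?_,
    fun z => mul_nonneg (hη0 _) (hζ0 _), fun z => mul_le_one₀ (hη1 _) (hζ0 _) (hζ1 _),
    fun z hz => ?_, fun z => ?_, fun z => ?_⟩
  · refine (closure_minimal hsub hcpt.isClosed).trans (prod_mono ?_ ?_)
    · exact Metric.closedBall_subset_ball (by linarith)
    · exact Icc_subset_Ioo (by linarith) (by linarith)
  · change η z.1 * ζ z.2 = 1
    rw [hηe _ hz.1, hζe _ hz.2, one_mul]
  · refine le_trans (Finset.sum_le_sum fun i _ => ?_) (hηd z.1)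
    rw [spaceDir, fderiv_mul_prod_spaceDir hη hζ, zero_mul, mul_zero, add_zero, mul_pow]
    exact mul_le_of_le_one_left (sq_nonneg _) (pow_le_one₀ (hζ0 _) (hζ1 _))
  · rw [timeDir, fderiv_mul_prod_spaceDir hη hζ]
    simp only [map_zero, mul_zero, zero_add, one_mul]
    have hB : 0 ≤ 2 * transitionBound / (s₂ - s₁) := div_nonneg (by linarith) (by linarith)
    have hf0 : 0 ≤ η z.1 * ζ z.2 * η z.1 := mul_nonneg (mul_nonneg (hη0 _) (hζ0 _)) (hη0 _)
    have hf1 : η z.1 * ζ z.2 * η z.1 ≤ 1 :=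
      mul_le_one₀ (mul_le_one₀ (hη1 _) (hζ0 _) (hζ1 _)) (hη0 _) (hη1 _)
    calc _ = 2 * ((η z.1 * ζ z.2 * η z.1) * deriv ζ z.2) := by ring
      _ ≤ 2 * ((η z.1 * ζ z.2 * η z.1) * (2 * transitionBound / (s₂ - s₁))) := by
          gcongr; exact hζd _
      _ ≤ 2 * (1 * (2 * transitionBound / (s₂ - s₁))) := by gcongr
      _ = _ := by ring

end ParabolicCutoff

/-! ### Comparing powers on superlevel sets -/

section LevelComparison

variable {d : ℕ} {m a c c' : ℝ}

/-- Where |v| > a, a power with nonpositive exponent is largest at a. This is how all exponents are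
converted into a single one. -/
theorem levelPow_le_mul_levelPow (hm : 0 < m) (ha : 0 < a) (hc : c ≤ c') (v : Space d) :
    levelPow m (a ^ (2 * m)) c v ≤ a ^ (c - c') * levelPow m (a ^ (2 * m)) c' v := by
  rw [levelPow, levelPow]
  split_ifs with h
  · have hav : a < ‖v‖ := (Real.rpow_lt_rpow_iff ha.le (norm_nonneg _) (by positivity)).1 h
    have hv := ha.trans hav
    calc ‖v‖ ^ c = ‖v‖ ^ (c - c') * ‖v‖ ^ c' := by rw [← Real.rpow_add hv]; ring_nf
      _ ≤ _ := by
        gcongr ?_ * _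
        exact Real.rpow_le_rpow_of_nonpos ha hav.le (by linarith)
  · simp

theorem levelPow_anti {k k' : ℝ} (hk : k ≤ k') (v : Space d) :
    levelPow m k' c v ≤ levelPow m k c v := by
  rw [levelPow, levelPow]
  split_ifs with h1 h2 h2
  · exact le_rfl
  · exact absurd (hk.trans_lt h1) h2
  · positivity
  · exact le_rfl

end LevelComparison

/-! ### The energy density in terms of a single power -/

section DeGiorgiStep

variable {N d : ℕ} {m ν L M r p a a' : ℝ} {U : Set (SpaceTime N)} {u : SpaceTime N → Space d}
  {A F G : Fin N → SpaceTime N → Space d} {ξ : SpaceTime N → ℝ}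

/-- The structural constant of the energy estimate. -/
def energyConst (m r ν L : ℝ) : ℝ :=
  4 * transitionBound + (4 * L ^ 2 / ν + 1) * (16 * transitionBound ^ 2) +
    (1 + (1 + 2 * (2 * transitionBound + (r - 1 - m) / (2 * m))) ^ 2 / ν)

theorem energyConst_nonneg (hν : 0 < ν) : 0 ≤ energyConst m r ν L := by
  have := one_le_transitionBound
  rw [energyConst]; positivity

theorem add_le_sum_mul {c₁ c₂ c₃ κ x y w : ℝ} (hκ : 1 ≤ κ) (h₁ : 0 ≤ c₁) (h₂ : 0 ≤ c₂)
    (h₃ : 0 ≤ c₃) (hx : 0 ≤ x) (hy : 0 ≤ y) (hw : 0 ≤ w) :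
    c₁ * x + c₂ * y + c₃ * κ * w ≤ (c₁ + c₂ + c₃) * κ * (x + y + w) := by
  have t1 : c₁ * x ≤ (c₁ + c₂ + c₃) * κ * x := by
    gcongr
    calc c₁ ≤ (c₁ + c₂ + c₃) * 1 := by linarith
      _ ≤ _ := by gcongr
  have t2 : c₂ * y ≤ (c₁ + c₂ + c₃) * κ * y := by
    gcongr
    calc c₂ ≤ (c₁ + c₂ + c₃) * 1 := by linarith
      _ ≤ _ := by gcongr
  have t3 : c₃ * κ * w ≤ (c₁ + c₂ + c₃) * κ * w := by
    gcongr
    linarith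
  linarith

theorem steepness_sq_le {K b s : ℝ} (hν : 0 < ν) (hb : 0 ≤ b) (hK : 1 ≤ K) (hs0 : 0 ≤ s)
    (hs : s = transitionBound * K) :
    1 + (1 + 2 * (2 * s + b)) ^ 2 / ν ≤
      (1 + (1 + 2 * (2 * transitionBound + b)) ^ 2 / ν) * K ^ 2 := by
  have h1 : 1 + 2 * (2 * s + b) ≤ (1 + 2 * (2 * transitionBound + b)) * K := by
    rw [hs]; nlinarith
  have h2 : 1 ≤ K ^ 2 := one_le_pow₀ hK
  calc _ ≤ 1 * K ^ 2 + ((1 + 2 * (2 * transitionBound + b)) * K) ^ 2 / ν := by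
        rw [one_mul]; gcongr
    _ = _ := by ring

/-- Passing from r+m-1 to r costs a^{m-1}, and passing from r-1-m to r(1-1/p) costs a^{r/p-1-m}; the
latter comparison needs r ≤ p(1+m). The steepness enters quadratically, and only with the source. -/
theorem energyDensity_le (hm : 0 < m) (hm1 : m ≤ 1) (hr : 1 + m ≤ r) (hν : 0 < ν) (hp : 1 < p)
    (hrp : r ≤ p * (1 + m)) (ha : 0 < a) (ha' : a < a') {D₁ D₂ : ℝ} (hD₁ : 0 ≤ D₁)
    (z : SpaceTime N) (hξ0 : 0 ≤ ξ z) (hξ1 : ξ z ≤ 1)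
    (h1 : 2 * ξ z * fderiv ℝ ξ z (timeDir N) ≤ 4 * transitionBound * D₁)
    (h2 : ∑ i, fderiv ℝ ξ z (spaceDir N i) ^ 2 ≤ 16 * transitionBound ^ 2 * D₂) :
    energyDensity m r ν L (a ^ (2 * m)) (a' ^ (2 * m)) u F ξ z ≤
      energyConst m r ν L * (a' ^ (2 * m) / (a' ^ (2 * m) - a ^ (2 * m))) ^ 2 *
        ((D₁ + a ^ (m - 1) * D₂) * levelPow m (a ^ (2 * m)) r (u z) +
          a ^ (r / p - 1 - m) *
            (levelPow m (a ^ (2 * m)) r (u z) ^ (1 - 1 / p) * ∑ i, ‖F i z‖ ^ 2)) := by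
  have hT := one_le_transitionBound
  have hp0 : 0 < p := by linarith
  have ha'0 := ha.trans ha'
  have hkk : a ^ (2 * m) < a' ^ (2 * m) := Real.rpow_lt_rpow ha.le ha' (by linarith)
  have hk0 : 0 < a ^ (2 * m) := by positivity
  set K := a' ^ (2 * m) / (a' ^ (2 * m) - a ^ (2 * m)) with hK
  have hK1 : 1 ≤ K := by rw [hK, le_div_iff₀ (by linarith)]; linarith
  have hK2 : 1 ≤ K ^ 2 := one_le_pow₀ hK1
  set Y := levelPow m (a ^ (2 * m)) r (u z) with hY
  have hY0 : 0 ≤ Y := levelPow_nonneg _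
  set f := ∑ i, ‖F i z‖ ^ 2 with hf
  have hf0 : 0 ≤ f := Finset.sum_nonneg fun i _ => sq_nonneg _
  have e1 : levelPow m (a ^ (2 * m)) (r + m - 1) (u z) ≤ a ^ (m - 1) * Y := by
    have := levelPow_le_mul_levelPow hm ha (by linarith : r + m - 1 ≤ r) (u z)
    rwa [show r + m - 1 - r = m - 1 by ring] at this
  have hpq : 0 < 1 - 1 / p := by rw [sub_pos, div_lt_one hp0]; exact hp
  have e2 : levelPow m (a ^ (2 * m)) (r - 1 - m) (u z) ≤ a ^ (r / p - 1 - m) * Y ^ (1 - 1 / p) := by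
    rw [hY, levelPow_mul_rpow hpq.ne']
    have hle : r - 1 - m ≤ r * (1 - 1 / p) := by
      have : r / p ≤ 1 + m := by rw [div_le_iff₀ hp0]; linarith
      rw [mul_sub, mul_one, mul_one_div]; linarith
    have := levelPow_le_mul_levelPow hm ha hle (u z)
    rwa [show r - 1 - m - r * (1 - 1 / p) = r / p - 1 - m by ring] at this
  have s1 : Y * max (2 * ξ z * fderiv ℝ ξ z (timeDir N)) 0 ≤ Y * (4 * transitionBound * D₁) := by
    gcongr; exact max_le h1 (by positivity)
  have s2 : levelPow m (a ^ (2 * m)) (r + m - 1) (u z) * ∑ i, fderiv ℝ ξ z (spaceDir N i) ^ 2 ≤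
      a ^ (m - 1) * Y * (16 * transitionBound ^ 2 * D₂) :=
    mul_le_mul e1 h2 (Finset.sum_nonneg fun i _ => sq_nonneg _) (by positivity)
  have hD₂ : 0 ≤ D₂ := by
    have : 0 ≤ 16 * transitionBound ^ 2 * D₂ :=
      (Finset.sum_nonneg fun i _ => sq_nonneg _).trans h2
    exact nonneg_of_mul_nonneg_right this (by positivity)
  have s3 : ξ z ^ 2 * levelPow m (a ^ (2 * m)) (r - 1 - m) (u z) * f ≤
      a ^ (r / p - 1 - m) * Y ^ (1 - 1 / p) * f := by
    refine mul_le_mul_of_nonneg_right ?_ hf0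
    calc _ ≤ 1 * levelPow m (a ^ (2 * m)) (r - 1 - m) (u z) :=
          mul_le_mul_of_nonneg_right (pow_le_one₀ hξ0 hξ1) (levelPow_nonneg _)
      _ ≤ _ := by rwa [one_mul]
  set b := (r - 1 - m) / (2 * m) with hb
  have hb0 : 0 ≤ b := div_nonneg (by linarith) (by linarith)
  have s4 : 1 + (1 + 2 * (2 * steepness (a ^ (2 * m)) (a' ^ (2 * m)) + b)) ^ 2 / ν ≤
      (1 + (1 + 2 * (2 * transitionBound + b)) ^ 2 / ν) * K ^ 2 :=
    steepness_sq_le hν hb0 hK1 (zero_le_one.trans (one_le_steepness hk0 hkk)) rfl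
  set c₃ := 1 + (1 + 2 * (2 * transitionBound + b)) ^ 2 / ν with hc₃
  set c₂ := (4 * L ^ 2 / ν + 1) * (16 * transitionBound ^ 2) with hc₂
  have hc₃0 : 0 ≤ c₃ := by positivity
  have hc₂0 : 0 ≤ c₂ := by positivity
  have hYp : 0 ≤ a ^ (r / p - 1 - m) * Y ^ (1 - 1 / p) * f := by positivity
  have hZ : 0 ≤ a ^ (m - 1) * D₂ * Y := by positivity
  have hX : 0 ≤ D₁ * Y := by positivity
  have step : energyDensity m r ν L (a ^ (2 * m)) (a' ^ (2 * m)) u F ξ z ≤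
      4 * transitionBound * (D₁ * Y) + c₂ * (a ^ (m - 1) * D₂ * Y) +
        c₃ * K ^ 2 * (a ^ (r / p - 1 - m) * Y ^ (1 - 1 / p) * f) := by
    rw [energyDensity]
    refine add_le_add (add_le_add ?_ ?_) ?_
    · exact s1.trans_eq (by ring)
    · calc _ ≤ (4 * L ^ 2 / ν + 1) * (a ^ (m - 1) * Y * (16 * transitionBound ^ 2 * D₂)) := by
            gcongr
        _ = _ := by rw [hc₂]; ring
    · refine mul_le_mul s4 s3 ?_ (by positivity)
      exact mul_nonneg (mul_nonneg (sq_nonneg _) (levelPow_nonneg _)) hf0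
  refine step.trans ((add_le_sum_mul hK2 (by linarith) hc₂0 hc₃0 hX hZ hYp).trans_eq ?_)
  change energyConst m r ν L * _ * _ = _
  ring

/-- Hölder's inequality for the source: the power 1 - 1/p of the level function becomes the level
function itself under the exponent conjugate to p. -/
theorem LocalSolution.integral_energyDensity_le (h : LocalSolution m ν L M U u A F G)
    (hm : 0 < m) (hm1 : m ≤ 1) (hr : 1 + m ≤ r) (hν : 0 < ν) (hp : 1 < p)
    (hrp : r ≤ p * (1 + m)) (ha : 0 < a) (ha' : a < a') {D₁ D₂ : ℝ} (hD₁ : 0 ≤ D₁)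
    {S : Set (SpaceTime N)} (hSv : volume S ≠ ⊤)
    (hξ : ContDiff ℝ ∞ ξ) (hξc : HasCompactSupport ξ) (hξS : tsupport ξ ⊆ S)
    (hξ0 : ∀ z, 0 ≤ ξ z) (hξ1 : ∀ z, ξ z ≤ 1)
    (h1 : ∀ z, 2 * ξ z * fderiv ℝ ξ z (timeDir N) ≤ 4 * transitionBound * D₁)
    (h2 : ∀ z, ∑ i, fderiv ℝ ξ z (spaceDir N i) ^ 2 ≤ 16 * transitionBound ^ 2 * D₂)
    (hF : MemLp (fun z => ∑ i, ‖F i z‖ ^ 2) (ENNReal.ofReal p) (volume.restrict S)) :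
    ∫ z, energyDensity m r ν L (a ^ (2 * m)) (a' ^ (2 * m)) u F ξ z ≤
      energyConst m r ν L * (a' ^ (2 * m) / (a' ^ (2 * m) - a ^ (2 * m))) ^ 2 *
        ((D₁ + a ^ (m - 1) * D₂) * (∫ z in S, levelPow m (a ^ (2 * m)) r (u z)) +
          a ^ (r / p - 1 - m) * ((∫ z in S, levelPow m (a ^ (2 * m)) r (u z)) ^ (1 - 1 / p) *
            (∫ z in S, (∑ i, ‖F i z‖ ^ 2) ^ p) ^ (1 / p))) := by
  have hp0 : 0 < p := by linarith
  have hpq : 0 < 1 - 1 / p := by rw [sub_pos, div_lt_one hp0]; exact hp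
  have hzero : ∀ z, z ∉ S → energyDensity m r ν L (a ^ (2 * m)) (a' ^ (2 * m)) u F ξ z = 0 := by
    intro z hz
    have hz' : z ∉ tsupport ξ := fun h => hz (hξS h)
    have e1 : ξ z = 0 := image_eq_zero_of_notMem_tsupport hz'
    have e2 : fderiv ℝ ξ z = 0 := by
      by_contra hne
      exact hz' (support_fderiv_subset ℝ hne)
    simp [energyDensity, e1, e2]
  have : IsFiniteMeasure (volume.restrict S) := ⟨by
    rw [Measure.restrict_apply_univ]; exact hSv.lt_top⟩
  have hM0 : 0 ≤ M := (norm_nonneg (u 0)).trans (h.bound 0)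
  have hYb : ∀ z, ‖levelPow m (a ^ (2 * m)) r (u z)‖ ≤ M ^ r := fun z =>
    abs_levelPow_le (by linarith) (h.bound z)
  have hYm := (h.aestronglyMeasurable_levelPow (k := a ^ (2 * m)) r).restrict (s := S)
  have hYi : Integrable (fun z => levelPow m (a ^ (2 * m)) r (u z)) (volume.restrict S) :=
    Integrable.of_bound hYm _ (ae_of_all _ hYb)
  have hconj : (p.conjExponent).HolderConjugate p := (Real.HolderConjugate.conjExponent hp).symm
  have hq : p.conjExponent⁻¹ = 1 - 1 / p := by
    have := hconj.inv_add_inv_eq_one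
    rw [one_div]; linarith
  have hgm : MemLp (fun z => levelPow m (a ^ (2 * m)) r (u z) ^ (1 - 1 / p))
      (ENNReal.ofReal p.conjExponent) (volume.restrict S) := by
    refine MemLp.of_bound (hYm.aemeasurable.pow_const _).aestronglyMeasurable ((M ^ r) ^ (1 - 1 / p))
      (ae_of_all _ fun z => ?_)
    rw [Real.norm_of_nonneg (Real.rpow_nonneg (levelPow_nonneg _) _)]
    exact Real.rpow_le_rpow (levelPow_nonneg _) ((le_abs_self _).trans (hYb z)) hpq.le
  have hhol := integral_mul_le_Lp_mul_Lq_of_nonneg hconj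
    (ae_of_all _ fun z => Real.rpow_nonneg (levelPow_nonneg (m := m) (k := a ^ (2 * m)) (c := r)
      (u z)) (1 - 1 / p))
    (ae_of_all _ fun z => Finset.sum_nonneg fun i _ => sq_nonneg ‖F i z‖) hgm hF
  have hgq : ∀ z, (levelPow m (a ^ (2 * m)) r (u z) ^ (1 - 1 / p)) ^ p.conjExponent =
      levelPow m (a ^ (2 * m)) r (u z) := fun z => by
    rw [← Real.rpow_mul (levelPow_nonneg _), ← hq, inv_mul_cancel₀ hconj.ne_zero, Real.rpow_one]
  simp only [hgq, one_div p.conjExponent, hq] at hhol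
  have hprod : Integrable (fun z => levelPow m (a ^ (2 * m)) r (u z) ^ (1 - 1 / p) *
      ∑ i, ‖F i z‖ ^ 2) (volume.restrict S) := by
    have : (ENNReal.ofReal p.conjExponent).HolderConjugate (ENNReal.ofReal p) :=
      hconj.ennrealOfReal
    exact hgm.integrable_mul hF
  rw [← setIntegral_eq_integral_of_forall_compl_eq_zero hzero]
  calc _ ≤ ∫ z in S, energyConst m r ν L * (a' ^ (2 * m) / (a' ^ (2 * m) - a ^ (2 * m))) ^ 2 *
        ((D₁ + a ^ (m - 1) * D₂) * levelPow m (a ^ (2 * m)) r (u z) +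
          a ^ (r / p - 1 - m) *
            (levelPow m (a ^ (2 * m)) r (u z) ^ (1 - 1 / p) * ∑ i, ‖F i z‖ ^ 2)) := by
        refine integral_mono (h.integrable_energyDensity hm hr hξ hξc).integrableOn
          (((hYi.const_mul _).add (hprod.const_mul _)).const_mul _) fun z => ?_
        exact energyDensity_le hm hm1 hr hν hp hrp ha ha' hD₁ z (hξ0 z) (hξ1 z) (h1 z) (h2 z)
    _ = energyConst m r ν L * (a' ^ (2 * m) / (a' ^ (2 * m) - a ^ (2 * m))) ^ 2 *
        ((D₁ + a ^ (m - 1) * D₂) * (∫ z in S, levelPow m (a ^ (2 * m)) r (u z)) +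
          a ^ (r / p - 1 - m) * ∫ z in S, (levelPow m (a ^ (2 * m)) r (u z) ^ (1 - 1 / p) *
            ∑ i, ‖F i z‖ ^ 2)) := by
        rw [integral_const_mul, integral_add (hYi.const_mul _) (hprod.const_mul _),
          integral_const_mul, integral_const_mul]
    _ ≤ _ := by
        have := energyConst_nonneg (m := m) (r := r) (L := L) hν
        gcongr

end DeGiorgiStep

/-! ### One step between two levels and two cylinders -/

section LevelStep

variable {N : ℕ}

/-- Bookkeeping for the steepness: the first factor yields K^{3q}, the second K⁴. In the application
q = 2/N, and N ≥ 3 gives 3q ≤ 2, so the total is at most K⁶. -/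
theorem mul_rpow_mul_le {C c₁ c₂ e K E R x y q : ℝ} (hC : 0 ≤ C) (hc₁ : 0 ≤ c₁) (hc₂ : 0 ≤ c₂)
    (he : 0 ≤ e) (hK : 1 ≤ K) (hE : 0 ≤ E) (hq0 : 0 ≤ q) (hq : 3 * q ≤ 2) (hR : 0 ≤ R)
    (hRE : R ≤ e * K ^ 2 * E) (hx0 : 0 ≤ x) (hx : x ≤ c₁ * K) (hy0 : 0 ≤ y) (hy : y ≤ c₂ * K ^ 2) :
    C * (x * R) ^ q * (y * R) ≤ C * (c₁ * e) ^ q * (c₂ * e) * K ^ 6 * E ^ (1 + q) := by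
  have hK0 : 0 ≤ K := zero_le_one.trans hK
  have hKq : K ^ (3 * q) ≤ K ^ 2 := by
    rw [← Real.rpow_natCast]
    exact Real.rpow_le_rpow_of_exponent_le hK (by push_cast; exact hq)
  have e1 : c₁ * K * (e * K ^ 2 * E) = (c₁ * e) * K ^ (3 : ℝ) * E := by
    rw [show (3 : ℝ) = ((3 : ℕ) : ℝ) by norm_num, Real.rpow_natCast]; ring
  calc _ ≤ C * (c₁ * K * (e * K ^ 2 * E)) ^ q * (c₂ * K ^ 2 * (e * K ^ 2 * E)) := by gcongr
    _ = C * (c₁ * e) ^ q * (c₂ * e) * (K ^ (3 * q) * K ^ 4) * E ^ (1 + q) := by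
        rw [e1, Real.mul_rpow (by positivity) hE, Real.mul_rpow (by positivity) (by positivity),
          ← Real.rpow_mul (by positivity), Real.rpow_add' hE (by positivity), Real.rpow_one]
        ring
    _ ≤ C * (c₁ * e) ^ q * (c₂ * e) * (K ^ 2 * K ^ 4) * E ^ (1 + q) := by gcongr
    _ = _ := by ring

/-- Gained integrability at level a' combined with the energy bound at level a. The negative power
of a' is the price of lowering the gained exponent r+m-1+2r/N to r. The bound does not contain t₁ -
t₂. -/
theorem exists_level_step (hN : 2 < N) {m ν L p r : ℝ} (hm : 0 < m) (hm1 : m ≤ 1)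
    (hr : 1 + m ≤ r) (hν : 0 < ν) (hL : 0 < L) (hp : 1 < p) (hrp : r ≤ p * (1 + m))
    (hlam : 0 ≤ m - 1 + 2 * r / N) : ∃ C : ℝ, 0 ≤ C ∧
    ∀ (d : ℕ) (M : ℝ) (U : Set (SpaceTime N)) (u : SpaceTime N → Space d)
      (A F G : Fin N → SpaceTime N → Space d), LocalSolution m ν L M U u A F G →
    ∀ (a a' : ℝ), 0 < a → a < a' →
    ∀ (x₀ : Space N) (ρ₂ ρ₁ s₁ s₂ t₂ t₁ : ℝ), 0 < ρ₂ → ρ₂ < ρ₁ → s₁ < s₂ → t₂ < t₁ →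
    Metric.ball x₀ ρ₁ ×ˢ Ioo s₁ t₁ ⊆ U →
    MemLp (fun z => ∑ i, ‖F i z‖ ^ 2) (ENNReal.ofReal p)
      (volume.restrict (Metric.ball x₀ ρ₁ ×ˢ Ioo s₁ t₁)) →
    ∀ Y B : ℝ, ∫ z in Metric.ball x₀ ρ₁ ×ˢ Ioo s₁ t₁, levelPow m (a ^ (2 * m)) r (u z) ≤ Y →
    (∫ z in Metric.ball x₀ ρ₁ ×ˢ Ioo s₁ t₁, (∑ i, ‖F i z‖ ^ 2) ^ p) ^ (1 / p) ≤ B →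
    ∫⁻ z in Metric.ball x₀ ρ₂ ×ˢ Ioc s₂ t₂, ENNReal.ofReal (levelPow m (a' ^ (2 * m)) r (u z)) ≤
      ENNReal.ofReal (C * a' ^ (-(m - 1 + 2 * r / N)) *
        (a' ^ (2 * m) / (a' ^ (2 * m) - a ^ (2 * m))) ^ 6 *
        (((s₂ - s₁)⁻¹ + a ^ (m - 1) * ((ρ₁ - ρ₂) ^ 2)⁻¹) * Y +
          a ^ (r / p - 1 - m) * (Y ^ (1 - 1 / p) * B)) ^ (1 + 2 / (N : ℝ))) := by
  obtain ⟨C₀, hC₀, hC⟩ := exists_higher_integrability hN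
  have hN' : (2 : ℝ) < N := by exact_mod_cast hN
  have hT := one_le_transitionBound
  have hN3 : (3 : ℝ) ≤ N := by exact_mod_cast hN
  set e := energyConst m r ν L with he
  have he0 : 0 ≤ e := energyConst_nonneg hν
  set b := (r + m - 1) / (4 * m) with hb
  have hb0 : 0 ≤ b := div_nonneg (by linarith) (by linarith)
  set c₁ := 8 * m * transitionBound + r with hc₁
  have hr0 : 0 < r := by linarith
  have hc₁0 : 0 ≤ c₁ := by positivity
  set c₂ := 2 + 16 * (2 * transitionBound + b) ^ 2 / ν with hc₂
  have hc₂0 : 0 ≤ c₂ := by positivity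
  refine ⟨C₀ * (c₁ * e) ^ (2 / (N : ℝ)) * (c₂ * e), by positivity, ?_⟩
  intro d M U u A F G h a a' ha ha' x₀ ρ₂ ρ₁ s₁ s₂ t₂ t₁ hρ₂ hρ hs ht hU hF Y B hY hB
  obtain ⟨ξ, hξ, hξc, hξS, hξ0, hξ1, hξe, hξx, hξt⟩ := exists_parabolic_cutoff x₀ hρ₂ hρ hs ht
  have ha'0 := ha.trans ha'
  have hkk : a ^ (2 * m) < a' ^ (2 * m) := Real.rpow_lt_rpow ha.le ha' (by linarith)
  have hk0 : 0 < a ^ (2 * m) := by positivity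
  have hst := one_le_steepness hk0 hkk
  have hstK : steepness (a ^ (2 * m)) (a' ^ (2 * m)) =
    transitionBound * (a' ^ (2 * m) / (a' ^ (2 * m) - a ^ (2 * m))) := rfl
  set st := steepness (a ^ (2 * m)) (a' ^ (2 * m)) with hstdef
  set K := a' ^ (2 * m) / (a' ^ (2 * m) - a ^ (2 * m)) with hK
  have hK1 : 1 ≤ K := by rw [hK, le_div_iff₀ (by linarith)]; linarith
  set S := Metric.ball x₀ ρ₁ ×ˢ Ioo s₁ t₁ with hS
  have hSv : volume S ≠ ⊤ := by
    rw [hS, Measure.volume_eq_prod, Measure.prod_prod]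
    exact ENNReal.mul_ne_top measure_ball_lt_top.ne (by simp)
  set R := ∫ z, energyDensity m r ν L (a ^ (2 * m)) (a' ^ (2 * m)) u F ξ z with hR
  have hR0 : 0 ≤ R := by
    have := h.integral_gradient_le hm hr hν hL hk0 hkk hξ hξc (hξS.trans hU)
    refine le_trans (mul_nonneg (by positivity) (integral_nonneg fun z => ?_)) this
    exact mul_nonneg (sq_nonneg _) (mul_nonneg (mul_nonneg (sq_nonneg _)
        (levelPow_nonneg _)) (Finset.sum_nonneg fun i _ => sq_nonneg _))
  have hD₁ : 0 ≤ (s₂ - s₁)⁻¹ := inv_nonneg.2 (by linarith)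
  have hRle := h.integral_energyDensity_le (L := L) hm hm1 hr hν hp hrp ha ha' hD₁ hSv hξ hξc hξS
    hξ0 hξ1 (fun z => (hξt z).trans_eq (div_eq_mul_inv _ _))
    (fun z => (hξx z).trans_eq (div_eq_mul_inv _ _)) hF
  have hY0 : 0 ≤ ∫ z in S, levelPow m (a ^ (2 * m)) r (u z) :=
    integral_nonneg fun z => levelPow_nonneg _
  have hB0 : 0 ≤ (∫ z in S, (∑ i, ‖F i z‖ ^ 2) ^ p) ^ (1 / p) :=
    Real.rpow_nonneg (integral_nonneg fun z => Real.rpow_nonneg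
      (Finset.sum_nonneg fun i _ => sq_nonneg _) _) _
  have hpq : 0 ≤ 1 - 1 / p := by rw [sub_nonneg, div_le_one (by linarith)]; exact hp.le
  have hY0' : 0 ≤ Y := hY0.trans hY
  have hB0' : 0 ≤ B := hB0.trans hB
  have hst0 : 0 ≤ st := zero_le_one.trans hst
  set E := ((s₂ - s₁)⁻¹ + a ^ (m - 1) * ((ρ₁ - ρ₂) ^ 2)⁻¹) * Y +
    a ^ (r / p - 1 - m) * (Y ^ (1 - 1 / p) * B) with hE
  have hRE : R ≤ e * K ^ 2 * E := by
    refine hRle.trans ?_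
    rw [hE]
    gcongr
  have hE0 : 0 ≤ E := by positivity
  have h8 : 8 * m * st + r ≤ c₁ * K := by
    rw [hstK, hc₁]; linarith [mul_le_mul_of_nonneg_left hK1 hr0.le]
  have h16 : 2 + 16 * (2 * st + b) ^ 2 / ν ≤ c₂ * K ^ 2 := by
    have h1 : 2 * st + b ≤ (2 * transitionBound + b) * K := by
      rw [hstK]; linarith [mul_le_mul_of_nonneg_left hK1 hb0]
    have h2 : 1 ≤ K ^ 2 := one_le_pow₀ hK1
    calc _ ≤ 2 * K ^ 2 + 16 * ((2 * transitionBound + b) * K) ^ 2 / ν := by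
          have h3 : 0 ≤ 2 * st + b := by positivity
          have h4 := pow_le_pow_left₀ h3 h1 2
          refine add_le_add (by linarith) ?_
          gcongr
      _ = _ := by rw [hc₂]; ring
  have hq : 3 * (2 / (N : ℝ)) ≤ 2 := by
    rw [← mul_div_assoc, div_le_iff₀ (by linarith)]
    linarith
  have hmain := mul_rpow_mul_le (q := 2 / (N : ℝ)) hC₀ hc₁0 hc₂0 he0 hK1 hE0 (by positivity) hq hR0 hRE
    (by positivity : 0 ≤ 8 * m * st + r) h8 (by positivity) h16
  have hint := hC d m ν L M r _ _ U u A F G ξ h hm hm1 hr hν hL hk0 hkk hξ hξc (hξS.trans hU) hξ0 hξ1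
    (Metric.ball x₀ ρ₂ ×ˢ Ioc s₂ t₂) (measurableSet_ball.prod measurableSet_Ioc) hξe
  have hlev : ∀ z, ENNReal.ofReal (levelPow m (a' ^ (2 * m)) r (u z)) ≤
      ENNReal.ofReal (a' ^ (-(m - 1 + 2 * r / N))) *
        ENNReal.ofReal (levelPow m (a' ^ (2 * m)) (r + m - 1 + 2 * r / N) (u z)) := by
    intro z
    rw [← ENNReal.ofReal_mul (by positivity)]
    refine ENNReal.ofReal_le_ofReal ?_
    have := levelPow_le_mul_levelPow hm ha'0 (by linarith : r ≤ r + m - 1 + 2 * r / N) (u z)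
    rwa [show r - (r + m - 1 + 2 * r / N) = -(m - 1 + 2 * r / N) by ring] at this
  refine (lintegral_mono hlev).trans ?_
  rw [lintegral_const_mul' _ _ ENNReal.ofReal_ne_top]
  refine (mul_le_mul_right (hint.trans (ENNReal.ofReal_le_ofReal hmain)) _).trans_eq ?_
  rw [← ENNReal.ofReal_mul (by positivity)]
  congr 1
  ring

/-- Up to every time before `t₀`, the function `u` coincides on the cylinder with a solution in the
sense of `LocalSolution`, with right-hand side of squared length `f`. -/
def IsBackwardSolution (m ν L : ℝ) (x₀ : Space N) (ρ s t₀ : ℝ) {d : ℕ} (u : SpaceTime N → Space d)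
    (f : SpaceTime N → ℝ) : Prop :=
  ∀ t₁ < t₀, ∃ (M : ℝ) (v : SpaceTime N → Space d) (A F G : Fin N → SpaceTime N → Space d),
    LocalSolution m ν L M (Metric.ball x₀ ρ ×ˢ Ioo s t₁) v A F G ∧
    (∀ᵐ z ∂volume.restrict (Metric.ball x₀ ρ ×ˢ Ioo s t₁), v z = u z) ∧
    ∀ᵐ z ∂volume.restrict (Metric.ball x₀ ρ ×ˢ Ioo s t₁), ∑ i, ‖F i z‖ ^ 2 = f z

/-- The previous step on cylinders ending before t₀, with a bound independent of the end time. These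
cylinders increase to the full one up to a null slice, so the bound passes to the limit. -/
theorem exists_backward_level_step (hN : 2 < N) {m ν L p r : ℝ} (hm : 0 < m) (hm1 : m ≤ 1)
    (hr : 1 + m ≤ r) (hν : 0 < ν) (hL : 0 < L) (hp : 1 < p) (hrp : r ≤ p * (1 + m))
    (hlam : 0 ≤ m - 1 + 2 * r / N) : ∃ C : ℝ, 0 ≤ C ∧
    ∀ (d : ℕ) (x₀ : Space N) (ρ s t₀ : ℝ) (u : SpaceTime N → Space d) (f : SpaceTime N → ℝ),
    IsBackwardSolution m ν L x₀ ρ s t₀ u f →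
    AEStronglyMeasurable u (volume.restrict (Metric.ball x₀ ρ ×ˢ Ioc s t₀)) →
    MemLp f (ENNReal.ofReal p) (volume.restrict (Metric.ball x₀ ρ ×ˢ Ioc s t₀)) → (∀ z, 0 ≤ f z) →
    ∀ (a a' : ℝ), 0 < a → a < a' → ∀ (ρ₂ ρ₁ s₁ s₂ : ℝ), 0 < ρ₂ → ρ₂ < ρ₁ → ρ₁ ≤ ρ →
    s ≤ s₁ → s₁ < s₂ →
    IntegrableOn (fun z => levelPow m (a ^ (2 * m)) r (u z)) (Metric.ball x₀ ρ₁ ×ˢ Ioc s₁ t₀) →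
    ∫ z in Metric.ball x₀ ρ₂ ×ˢ Ioc s₂ t₀, levelPow m (a' ^ (2 * m)) r (u z) ≤
      C * a' ^ (-(m - 1 + 2 * r / N)) *
        (a' ^ (2 * m) / (a' ^ (2 * m) - a ^ (2 * m))) ^ 6 *
        (((s₂ - s₁)⁻¹ + a ^ (m - 1) * ((ρ₁ - ρ₂) ^ 2)⁻¹) *
            (∫ z in Metric.ball x₀ ρ₁ ×ˢ Ioc s₁ t₀, levelPow m (a ^ (2 * m)) r (u z)) +
          a ^ (r / p - 1 - m) *
            ((∫ z in Metric.ball x₀ ρ₁ ×ˢ Ioc s₁ t₀, levelPow m (a ^ (2 * m)) r (u z)) ^ (1 - 1 / p) *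
            (∫ z in Metric.ball x₀ ρ ×ˢ Ioc s t₀, f z ^ p) ^ (1 / p))) ^ (1 + 2 / (N : ℝ)) := by
  obtain ⟨C, hC0, hC⟩ := exists_level_step hN hm hm1 hr hν hL hp hrp hlam
  refine ⟨C, hC0, fun d x₀ ρ s t₀ u f hu hum hf hf0 a a' ha ha' ρ₂ ρ₁ s₁ s₂ hρ₂ hρ hρ₁ hs hs₂ hint => ?_⟩
  set Y := ∫ z in Metric.ball x₀ ρ₁ ×ˢ Ioc s₁ t₀, levelPow m (a ^ (2 * m)) r (u z) with hY
  set B := (∫ z in Metric.ball x₀ ρ ×ˢ Ioc s t₀, f z ^ p) ^ (1 / p) with hB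
  have hp0 : 0 < p := by linarith
  have ha'0 := ha.trans ha'
  have hkk : a ^ (2 * m) < a' ^ (2 * m) := Real.rpow_lt_rpow ha.le ha' (by linarith)
  have hY0 : 0 ≤ Y := integral_nonneg fun z => levelPow_nonneg _
  have hB0 : 0 ≤ B := Real.rpow_nonneg (integral_nonneg fun z => Real.rpow_nonneg (hf0 z) _) _
  have hK0 : 0 ≤ a' ^ (2 * m) / (a' ^ (2 * m) - a ^ (2 * m)) :=
    div_nonneg (by positivity) (by linarith)
  have hD : 0 ≤ (s₂ - s₁)⁻¹ := inv_nonneg.2 (by linarith)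
  set X := C * a' ^ (-(m - 1 + 2 * r / N)) *
        (a' ^ (2 * m) / (a' ^ (2 * m) - a ^ (2 * m))) ^ 6 *
        (((s₂ - s₁)⁻¹ + a ^ (m - 1) * ((ρ₁ - ρ₂) ^ 2)⁻¹) * Y +
          a ^ (r / p - 1 - m) * (Y ^ (1 - 1 / p) * B)) ^ (1 + 2 / (N : ℝ)) with hX
  have hX0 : 0 ≤ X := by positivity
  have hfp : IntegrableOn (fun z => f z ^ p) (Metric.ball x₀ ρ ×ˢ Ioc s t₀) := by
    have := hf.integrable_norm_rpow (by simpa using hp0) ENNReal.ofReal_ne_top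
    simp only [ENNReal.toReal_ofReal hp0.le, Real.norm_of_nonneg (hf0 _)] at this
    exact this
  have key : ∀ n : ℕ, ∫⁻ z in Metric.ball x₀ ρ₂ ×ˢ Ioc s₂ (t₀ - 1 / ((n : ℝ) + 1)),
      ENNReal.ofReal (levelPow m (a' ^ (2 * m)) r (u z)) ≤ ENNReal.ofReal X := by
    intro n
    have hn : 0 < 1 / ((n : ℝ) + 1) := by positivity
    -- Half of the gap is left for the descent of the time cutoff, the other half keeps t₁ below t₀.
    set t₁ := t₀ - 1 / ((n : ℝ) + 1) / 2 with ht₁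
    have ht₁0 : t₁ < t₀ := by rw [ht₁]; linarith
    have ht₂ : t₀ - 1 / ((n : ℝ) + 1) < t₁ := by rw [ht₁]; linarith
    obtain ⟨M, v, A, F, G, hsol, hvu, hFf⟩ := hu t₁ ht₁0
    have hsub1 : Metric.ball x₀ ρ₁ ×ˢ Ioo s₁ t₁ ⊆ Metric.ball x₀ ρ ×ˢ Ioo s t₁ :=
      prod_mono (Metric.ball_subset_ball hρ₁) (Ioo_subset_Ioo_left hs)
    have hsub2 : Metric.ball x₀ ρ₁ ×ˢ Ioo s₁ t₁ ⊆ Metric.ball x₀ ρ ×ˢ Ioc s t₀ :=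
      hsub1.trans (prod_mono subset_rfl fun t ht => ⟨ht.1, ht.2.le.trans ht₁0.le⟩)
    have hsub3 : Metric.ball x₀ ρ₁ ×ˢ Ioo s₁ t₁ ⊆ Metric.ball x₀ ρ₁ ×ˢ Ioc s₁ t₀ :=
      prod_mono subset_rfl fun t ht => ⟨ht.1, ht.2.le.trans ht₁0.le⟩
    have hsub4 : Metric.ball x₀ ρ₂ ×ˢ Ioc s₂ (t₀ - 1 / ((n : ℝ) + 1)) ⊆
        Metric.ball x₀ ρ ×ˢ Ioo s t₁ :=
      prod_mono (Metric.ball_subset_ball (hρ.le.trans hρ₁)) fun t ht =>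
        ⟨hs.trans_lt (hs₂.trans ht.1), ht.2.trans_lt ht₂⟩
    have hFf1 := ae_restrict_of_ae_restrict_of_subset hsub1 hFf
    have hvu1 := ae_restrict_of_ae_restrict_of_subset hsub1 hvu
    have hvu4 := ae_restrict_of_ae_restrict_of_subset hsub4 hvu
    have hle := hC d M _ v A F G hsol a a' ha ha' x₀ ρ₂ ρ₁ s₁ s₂ _ t₁ hρ₂ hρ hs₂ ht₂ hsub1
      ((memLp_congr_ae hFf1).2 (hf.mono_measure (Measure.restrict_mono hsub2 le_rfl))) Y B ?_ ?_
    · refine le_trans (le_of_eq (lintegral_congr_ae ?_)) hle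
      filter_upwards [hvu4] with z hz
      rw [hz]
    · rw [integral_congr_ae (g := fun z => levelPow m (a ^ (2 * m)) r (u z))
        (by filter_upwards [hvu1] with z hz; rw [hz])]
      exact setIntegral_mono_set hint (ae_of_all _ fun z => levelPow_nonneg _) hsub3.eventuallyLE
    · rw [integral_congr_ae (g := fun z => f z ^ p)
        (by filter_upwards [hFf1] with z hz; rw [hz])]
      refine Real.rpow_le_rpow (integral_nonneg fun z => Real.rpow_nonneg (hf0 z) _) ?_ (by positivity)
      exact setIntegral_mono_set hfp (ae_of_all _ fun z => Real.rpow_nonneg (hf0 z) _)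
        hsub2.eventuallyLE
  have hun : (Metric.ball x₀ ρ₂ ×ˢ Ioc s₂ t₀ : Set (SpaceTime N)) =ᵐ[volume]
      ⋃ n : ℕ, Metric.ball x₀ ρ₂ ×ˢ Ioc s₂ (t₀ - 1 / ((n : ℝ) + 1)) := by
    rw [← prod_iUnion]
    refine Measure.set_prod_ae_eq ae_eq_rfl ?_
    have : ⋃ n : ℕ, Ioc s₂ (t₀ - 1 / ((n : ℝ) + 1)) = Ioo s₂ t₀ := by
      ext t
      simp only [mem_iUnion, mem_Ioc, mem_Ioo]
      constructor
      · rintro ⟨n, h1, h2⟩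
        have : 0 < 1 / ((n : ℝ) + 1) := by positivity
        exact ⟨h1, by linarith⟩
      · rintro ⟨h1, h2⟩
        obtain ⟨n, hn⟩ := exists_nat_one_div_lt (sub_pos.2 h2)
        exact ⟨n, h1, by linarith⟩
    rw [this]
    exact Ioo_ae_eq_Ioc.symm
  rw [integral_eq_lintegral_of_nonneg_ae (ae_of_all _ fun z => levelPow_nonneg _) ?_]
  · refine ENNReal.toReal_le_of_le_ofReal hX0 ?_
    rw [setLIntegral_congr hun, setLIntegral_iUnion_of_directed _ ?_]
    · exact iSup_le key
    · refine (monotone_nat_of_le_succ fun n => ?_).directed_le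
      refine prod_mono subset_rfl (Ioc_subset_Ioc_right ?_)
      gcongr
      simp
  · have hsub : Metric.ball x₀ ρ₂ ×ˢ Ioc s₂ t₀ ⊆ Metric.ball x₀ ρ ×ˢ Ioc s t₀ :=
      prod_mono (Metric.ball_subset_ball (hρ.le.trans hρ₁)) (Ioc_subset_Ioc_left (hs.trans hs₂.le))
    exact (measurable_levelPow.comp_aemeasurable (hum.mono_measure
      (Measure.restrict_mono hsub le_rfl)).aemeasurable).aestronglyMeasurable

end LevelStep

/-! ### Fast geometric convergence -/

section FastGeometricConvergence

/-- By induction x_n ≤ ε δⁿ: the choice δ^α b = 1 cancels the growth of bⁿ, and Cε^α ≤ δ supplies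
one more factor δ. The recursion is required only while x_n ≤ 1, which the induction guarantees and
the next lemma exploits. -/
theorem tendsto_zero_of_le_pow_mul_rpow {C b α : ℝ} (hC : 0 < C) (hb : 1 < b) (hα : 0 < α) :
    ∃ ε : ℝ, 0 < ε ∧ ε ≤ 1 ∧ ∀ x : ℕ → ℝ, (∀ n, 0 ≤ x n) → x 0 ≤ ε →
      (∀ n, x n ≤ 1 → x (n + 1) ≤ C * b ^ n * x n ^ (1 + α)) → Tendsto x atTop (𝓝 0) := by
  have hb0 : 0 < b := by linarith
  obtain ⟨δ, hδ⟩ : ∃ δ : ℝ, δ = b ^ (-(1 / α)) := ⟨_, rfl⟩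
  have hδ0 : 0 < δ := by rw [hδ]; positivity
  have hδ1 : δ < 1 := by
    rw [hδ]; exact Real.rpow_lt_one_of_one_lt_of_neg hb (by simpa using hα)
  have hδα : δ ^ α * b = 1 := by
    rw [hδ, ← Real.rpow_mul hb0.le, neg_mul, one_div_mul_cancel hα.ne', Real.rpow_neg_one,
      inv_mul_cancel₀ hb0.ne']
  obtain ⟨ε, hε⟩ : ∃ ε : ℝ, ε = min 1 ((δ / C) ^ (1 / α)) := ⟨_, rfl⟩
  have hε0 : 0 < ε := by rw [hε]; positivity
  have hε1 : ε ≤ 1 := by rw [hε]; exact min_le_left _ _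
  have hεC : C * ε ^ α ≤ δ := by
    calc C * ε ^ α ≤ C * ((δ / C) ^ (1 / α)) ^ α := by
          gcongr; rw [hε]; exact min_le_right _ _
      _ = δ := by
          rw [← Real.rpow_mul (by positivity), one_div_mul_cancel hα.ne', Real.rpow_one]
          field_simp
  refine ⟨ε, hε0, hε1, fun x hx0 hx hrec => ?_⟩
  have key : ∀ n, x n ≤ ε * δ ^ n := by
    intro n
    induction n with
    | zero => simpa using hx
    | succ n ih =>
      have := hx0 n
      have hp : δ ^ n ≤ 1 := pow_le_one₀ hδ0.le hδ1.le
      have hxε : x n ≤ ε := ih.trans (mul_le_of_le_one_right hε0.le hp)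
      calc x (n + 1) ≤ C * b ^ n * x n ^ (1 + α) := hrec n (hxε.trans hε1)
        _ = C * b ^ n * x n ^ α * x n := by
            rw [Real.rpow_add' (hx0 n) (by positivity), Real.rpow_one]; ring
        _ ≤ C * b ^ n * (ε * δ ^ n) ^ α * (ε * δ ^ n) := by
            gcongr
        _ = C * ε ^ α * (δ ^ α * b) ^ n * (ε * δ ^ n) := by
            rw [Real.mul_rpow hε0.le (by positivity), ← Real.rpow_natCast δ n,
              ← Real.rpow_mul hδ0.le, mul_comm (n : ℝ) α, Real.rpow_mul hδ0.le,
              Real.rpow_natCast]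
            ring
        _ ≤ δ * (ε * δ ^ n) := by
            rw [hδα, one_pow, mul_one]
            gcongr
        _ = _ := by ring
  refine squeeze_zero hx0 key ?_
  simpa using (tendsto_pow_atTop_nhds_zero_of_lt_one hδ0.le hδ1).const_mul ε

/-- For x_n ≤ 1 the smaller power dominates, so the sum is at most 2 x_n^s and the total exponent sq
exceeds 1. -/
theorem tendsto_zero_of_le_pow_mul_add_rpow {C b s q : ℝ} (hC : 0 < C) (hb : 1 < b) (hs : s ≤ 1)
    (hq : 0 < q) (hsq : 1 < s * q) :
    ∃ ε : ℝ, 0 < ε ∧ ∀ x : ℕ → ℝ, (∀ n, 0 ≤ x n) → x 0 ≤ ε →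
      (∀ n, x (n + 1) ≤ C * b ^ n * (x n + x n ^ s) ^ q) → Tendsto x atTop (𝓝 0) := by
  obtain ⟨ε, hε0, -, hε⟩ := tendsto_zero_of_le_pow_mul_rpow (C := C * 2 ^ q) (b := b)
    (α := s * q - 1) (by positivity) hb (by linarith)
  have hs0 : 0 < s := pos_of_mul_pos_left (by linarith) hq.le
  refine ⟨ε, hε0, fun x hx0 hx hrec => hε x hx0 hx fun n hn => (hrec n).trans ?_⟩
  have h1 : x n ≤ x n ^ s := by
    simpa using Real.rpow_le_rpow_of_exponent_ge' (hx0 n) hn hs0.le hs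
  have hb0 : 0 < b := by linarith
  have := hx0 n
  calc C * b ^ n * (x n + x n ^ s) ^ q ≤ C * b ^ n * (2 * x n ^ s) ^ q := by
        gcongr; linarith
    _ = _ := by
        rw [Real.mul_rpow (by norm_num) (by positivity), ← Real.rpow_mul this]
        rw [show 1 + (s * q - 1) = s * q by ring]
        ring

end FastGeometricConvergence

/-! ### Scaling of the recursion -/

section NormalizedStep

/-- The level integral is written as D^{N+2} W x, with D = 1 - σ and W its natural size for level κ
and duration θ. By θ κ^{m-1} ≤ ρ² the spatial cutoff term is controlled by the same θ⁻¹ as the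
temporal one. -/
theorem normalized_energy_le {N m p r κ θ ρ D c a β x W J : ℝ} {n k : ℕ} (hk : (k : ℝ) = N)
    (hm : m ≤ 1)
    (hp : (N + 2) / 2 ≤ p) (hp1 : 1 < p) (hrp : r ≤ p * (1 + m)) (hκ : 0 < κ) (hθ : 0 < θ)
    (hρ : 0 < ρ) (hD : 0 < D) (hD1 : D ≤ 1) (hc : 0 < c) (hca : c * κ ≤ a)
    (hβ : 0 ≤ β) (hx : 0 ≤ x) (hκρ : θ * κ ^ (m - 1) ≤ ρ ^ 2)
    (hW : W = κ ^ (N * (m - 1) / 2 + r) * θ ^ ((N + 2) / 2)) (hJ0 : 0 ≤ J)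
    (hJ : J ≤ β * (κ ^ (1 + m - N * (1 - m) / (2 * p)) * θ ^ (-1 + (N + 2) / (2 * p)))) :
    ((D * θ * (1 / 2) ^ (n + 1))⁻¹ + a ^ (m - 1) * ((D * ρ * (1 / 2) ^ (n + 1)) ^ 2)⁻¹) *
        (D ^ (k + 2) * W * x) +
      a ^ (r / p - 1 - m) * ((D ^ (k + 2) * W * x) ^ (1 - 1 / p) * J) ≤
    (1 + c ^ (m - 1) + c ^ (r / p - 1 - m) * β) * 4 ^ (n + 1) * θ⁻¹ * W * D ^ k *
      (x + x ^ (1 - 1 / p)) := by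
  have hW0 : 0 < W := by rw [hW]; positivity
  have hp0 : 0 < p := by linarith
  have ha : 0 < a := lt_of_lt_of_le (by positivity) hca
  have hs : 0 < 1 - 1 / p := by rw [sub_pos, div_lt_one hp0]; exact hp1
  have a1 : a ^ (m - 1) ≤ c ^ (m - 1) * κ ^ (m - 1) := by
    rw [← Real.mul_rpow hc.le hκ.le]
    exact Real.rpow_le_rpow_of_nonpos (by positivity) hca (by linarith)
  have he : r / p - 1 - m ≤ 0 := by
    have : r / p ≤ 1 + m := by rw [div_le_iff₀ hp0]; linarith
    linarith
  have a2 : a ^ (r / p - 1 - m) ≤ c ^ (r / p - 1 - m) * κ ^ (r / p - 1 - m) := by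
    rw [← Real.mul_rpow hc.le hκ.le]
    exact Real.rpow_le_rpow_of_nonpos (by positivity) hca he
  have h2 : (1 : ℝ) ≤ 2 ^ (n + 1) := one_le_pow₀ (by norm_num)
  have h4 : (4 : ℝ) ^ (n + 1) = 2 ^ (n + 1) * 2 ^ (n + 1) := by rw [← mul_pow]; norm_num
  have hDD : D⁻¹ ≤ (D ^ 2)⁻¹ := inv_anti₀ (by positivity) (by nlinarith)
  have b1 : (D * θ * (1 / 2) ^ (n + 1))⁻¹ ≤ 4 ^ (n + 1) * θ⁻¹ * (D ^ 2)⁻¹ := by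
    calc _ = 2 ^ (n + 1) * θ⁻¹ * D⁻¹ := by
          rw [mul_inv, mul_inv, one_div, inv_pow, inv_inv]; ring
      _ ≤ _ := by
          gcongr
          norm_num
  have b2 : a ^ (m - 1) * ((D * ρ * (1 / 2) ^ (n + 1)) ^ 2)⁻¹ ≤
      c ^ (m - 1) * (4 ^ (n + 1) * θ⁻¹ * (D ^ 2)⁻¹) := by
    have e1 : ((D * ρ * (1 / 2) ^ (n + 1)) ^ 2)⁻¹ = 4 ^ (n + 1) * (D ^ 2)⁻¹ * (ρ ^ 2)⁻¹ := by
      rw [mul_pow, mul_pow, mul_inv, mul_inv, one_div, inv_pow, inv_pow, inv_inv, h4]; ring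
    rw [e1]
    calc _ ≤ c ^ (m - 1) * κ ^ (m - 1) * (4 ^ (n + 1) * (D ^ 2)⁻¹ * (ρ ^ 2)⁻¹) := by gcongr
      _ = c ^ (m - 1) * (4 ^ (n + 1) * (D ^ 2)⁻¹ * (κ ^ (m - 1) * (ρ ^ 2)⁻¹)) := by ring
      _ ≤ c ^ (m - 1) * (4 ^ (n + 1) * (D ^ 2)⁻¹ * θ⁻¹) := by
          gcongr
          rw [← div_eq_mul_inv, div_le_iff₀ (by positivity), inv_mul_eq_div, le_div_iff₀ hθ]
          linarith
      _ = _ := by ring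
  have e2 : (D ^ 2)⁻¹ * D ^ (k + 2) = D ^ k := by
    rw [pow_add]; field_simp
  have part1 : ((D * θ * (1 / 2) ^ (n + 1))⁻¹ +
      a ^ (m - 1) * ((D * ρ * (1 / 2) ^ (n + 1)) ^ 2)⁻¹) * (D ^ (k + 2) * W * x) ≤
      (1 + c ^ (m - 1)) * (4 ^ (n + 1) * θ⁻¹ * W * D ^ k * x) := by
    calc _ ≤ (4 ^ (n + 1) * θ⁻¹ * (D ^ 2)⁻¹ + c ^ (m - 1) * (4 ^ (n + 1) * θ⁻¹ * (D ^ 2)⁻¹)) *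
          (D ^ (k + 2) * W * x) := by gcongr
      _ = (1 + c ^ (m - 1)) * (4 ^ (n + 1) * θ⁻¹ * W * ((D ^ 2)⁻¹ * D ^ (k + 2)) * x) := by ring
      _ = _ := by rw [e2]
  -- The source term lacks the factor D⁻² of the cutoffs, but (N+2)/p ≤ 2 makes its power of D no
  -- worse.
  have hDk : (D ^ (k + 2)) ^ (1 - 1 / p) ≤ D ^ k := by
    rw [← Real.rpow_natCast, ← Real.rpow_natCast, ← Real.rpow_mul hD.le]
    refine Real.rpow_le_rpow_of_exponent_ge hD hD1 ?_
    push_cast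
    rw [hk]
    have : (N + 2) / p ≤ 2 := by rw [div_le_iff₀ hp0]; linarith
    rw [mul_sub, mul_one, mul_one_div]
    linarith
  -- The admissible size of the source is exactly the one giving it the same scaling as the other
  -- terms.
  have hWid : κ ^ (r / p - 1 - m) *
      (κ ^ (1 + m - N * (1 - m) / (2 * p)) * θ ^ (-1 + (N + 2) / (2 * p))) = W ^ (1 / p) * θ⁻¹ := by
    rw [← mul_assoc, ← Real.rpow_add hκ, Real.rpow_add hθ, Real.rpow_neg_one, hW,
      Real.mul_rpow (by positivity) (by positivity), ← Real.rpow_mul hκ.le, ← Real.rpow_mul hθ.le]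
    have f1 : r / p - 1 - m + (1 + m - N * (1 - m) / (2 * p)) = (N * (m - 1) / 2 + r) * (1 / p) := by
      field_simp; ring
    have f2 : (N + 2) / (2 * p) = (N + 2) / 2 * (1 / p) := by field_simp
    rw [f1, f2]
    ring
  have hWW : W ^ (1 - 1 / p) * W ^ (1 / p) = W := by
    rw [← Real.rpow_add hW0]; simp
  have part2 : a ^ (r / p - 1 - m) * ((D ^ (k + 2) * W * x) ^ (1 - 1 / p) * J) ≤
      c ^ (r / p - 1 - m) * β * (θ⁻¹ * W * D ^ k * x ^ (1 - 1 / p)) := by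
    rw [Real.mul_rpow (by positivity) hx, Real.mul_rpow (by positivity) hW0.le]
    calc _ ≤ c ^ (r / p - 1 - m) * κ ^ (r / p - 1 - m) *
          (D ^ k * W ^ (1 - 1 / p) * x ^ (1 - 1 / p) *
          (β * (κ ^ (1 + m - N * (1 - m) / (2 * p)) * θ ^ (-1 + (N + 2) / (2 * p))))) := by gcongr
      _ = c ^ (r / p - 1 - m) * β * (D ^ k * x ^ (1 - 1 / p) * (W ^ (1 - 1 / p) *
          (κ ^ (r / p - 1 - m) *
          (κ ^ (1 + m - N * (1 - m) / (2 * p)) * θ ^ (-1 + (N + 2) / (2 * p)))))) := by ring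
      _ = c ^ (r / p - 1 - m) * β * (D ^ k * x ^ (1 - 1 / p) *
          ((W ^ (1 - 1 / p) * W ^ (1 / p)) * θ⁻¹)) := by rw [hWid]; ring
      _ = _ := by rw [hWW]; ring
  have h41 : (1 : ℝ) ≤ 4 ^ (n + 1) := one_le_pow₀ (by norm_num)
  have hZ : 0 ≤ θ⁻¹ * W * D ^ k := by positivity
  have hxs : 0 ≤ x ^ (1 - 1 / p) := Real.rpow_nonneg hx _
  have hcc : 0 ≤ c ^ (r / p - 1 - m) * β := by positivity
  have hcm : 0 ≤ c ^ (m - 1) := by positivity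
  generalize c ^ (r / p - 1 - m) * β = c₁ at *
  generalize c ^ (m - 1) = c₂ at *
  generalize x ^ (1 - 1 / p) = y at *
  generalize (4 : ℝ) ^ (n + 1) = q at *
  calc _ ≤ (1 + c₂) * (q * θ⁻¹ * W * D ^ k * x) + c₁ * (θ⁻¹ * W * D ^ k * y) :=
        add_le_add part1 part2
    _ = (1 + c₂) * q * (θ⁻¹ * W * D ^ k) * x + c₁ * 1 * (θ⁻¹ * W * D ^ k) * y := by ring
    _ ≤ (1 + c₂ + c₁) * q * (θ⁻¹ * W * D ^ k) * x + (1 + c₂ + c₁) * q * (θ⁻¹ * W * D ^ k) * y := by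
        refine add_le_add ?_ ?_
        · exact mul_le_mul_of_nonneg_right (mul_le_mul_of_nonneg_right (mul_le_mul_of_nonneg_right
            (by linarith) (by linarith)) hZ) hx
        · exact mul_le_mul_of_nonneg_right (mul_le_mul_of_nonneg_right (mul_le_mul (by linarith) h41
            zero_le_one (by linarith)) hZ) hxs
    _ = _ := by ring

/-- After normalization all dimensional factors disappear. The exponent 1 + 2/N turns D^N into
D^{N+2}, which explains the power of 1 - σ in the final estimate, and W reproduces itself. -/
theorem normalized_step {N m p r κ θ ρ D c a a' β x W J C K : ℝ} {n k : ℕ} (hk : (k : ℝ) = N)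
    (hN : 0 < N) (hm : m ≤ 1)
    (hp : (N + 2) / 2 ≤ p) (hp1 : 1 < p) (hrp : r ≤ p * (1 + m)) (hκ : 0 < κ) (hθ : 0 < θ)
    (hρ : 0 < ρ) (hD : 0 < D) (hD1 : D ≤ 1) (hc : 0 < c) (hca : c * κ ≤ a) (hca' : c * κ ≤ a')
    (hβ : 0 ≤ β) (hx : 0 ≤ x) (hκρ : θ * κ ^ (m - 1) ≤ ρ ^ 2)
    (hW : W = κ ^ (N * (m - 1) / 2 + r) * θ ^ ((N + 2) / 2)) (hJ0 : 0 ≤ J)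
    (hJ : J ≤ β * (κ ^ (1 + m - N * (1 - m) / (2 * p)) * θ ^ (-1 + (N + 2) / (2 * p))))
    (hC : 0 ≤ C) (hK0 : 0 ≤ K) (hK : K ≤ 2 ^ (n + 2)) (hlam : 0 ≤ m - 1 + 2 * r / N) :
    C * a' ^ (-(m - 1 + 2 * r / N)) * K ^ 6 *
      (((D * θ * (1 / 2) ^ (n + 1))⁻¹ + a ^ (m - 1) * ((D * ρ * (1 / 2) ^ (n + 1)) ^ 2)⁻¹) *
        (D ^ (k + 2) * W * x) +
      a ^ (r / p - 1 - m) * ((D ^ (k + 2) * W * x) ^ (1 - 1 / p) * J)) ^ (1 + 2 / N) ≤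
    D ^ (k + 2) * W *
      ((C * c ^ (-(m - 1 + 2 * r / N)) * 2 ^ 12 *
        ((1 + c ^ (m - 1) + c ^ (r / p - 1 - m) * β) * 4) ^ (1 + 2 / N)) *
        (2 ^ 6 * 4 ^ (1 + 2 / N)) ^ n * (x + x ^ (1 - 1 / p)) ^ (1 + 2 / N)) := by
  have hE := normalized_energy_le (n := n) hk hm hp hp1 hrp hκ hθ hρ hD hD1 hc hca hβ hx hκρ hW hJ0 hJ
  have hW0 : 0 < W := by rw [hW]; positivity
  have ha : 0 < a := lt_of_lt_of_le (by positivity) hca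
  have hX : 0 ≤ x + x ^ (1 - 1 / p) := add_nonneg hx (Real.rpow_nonneg hx _)
  have hq : 0 < 1 + 2 / N := by positivity
  have hG0 : 0 ≤ 1 + c ^ (m - 1) + c ^ (r / p - 1 - m) * β := by positivity
  generalize 1 + c ^ (m - 1) + c ^ (r / p - 1 - m) * β = g at *
  generalize x + x ^ (1 - 1 / p) = X at *
  have a1 : a' ^ (-(m - 1 + 2 * r / N)) ≤
      c ^ (-(m - 1 + 2 * r / N)) * κ ^ (-(m - 1 + 2 * r / N)) := by
    rw [← Real.mul_rpow hc.le hκ.le]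
    exact Real.rpow_le_rpow_of_nonpos (by positivity) hca' (by linarith)
  -- Self-consistency of the scaling: this identity dictates the exponents of κ and θ in `W`.
  have hid : κ ^ (-(m - 1 + 2 * r / N)) * (θ⁻¹ * W) ^ (1 + 2 / N) = W := by
    have e1 : W ^ (2 / N) = κ ^ (m - 1 + 2 * r / N) * θ ^ (1 + 2 / N) := by
      rw [hW, Real.mul_rpow (by positivity) (by positivity), ← Real.rpow_mul hκ.le,
        ← Real.rpow_mul hθ.le]
      congr 2 <;> field_simp
    rw [Real.mul_rpow (by positivity) hW0.le, Real.inv_rpow hθ.le, Real.rpow_add hW0,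
      Real.rpow_one, e1, Real.rpow_neg hκ.le]
    field_simp
  have hDk : (D ^ k) ^ (1 + 2 / N) = D ^ (k + 2) := by
    rw [← Real.rpow_natCast, ← Real.rpow_natCast, ← Real.rpow_mul hD.le]
    congr 1
    push_cast
    rw [hk]
    field_simp
  have h4 : ((4 : ℝ) ^ n) ^ (1 + 2 / N) = (4 ^ (1 + 2 / N)) ^ n := by
    rw [← Real.rpow_natCast, ← Real.rpow_natCast, ← Real.rpow_mul (by norm_num),
      ← Real.rpow_mul (by norm_num), mul_comm]
  have hE0 : 0 ≤ ((D * θ * (1 / 2) ^ (n + 1))⁻¹ +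
      a ^ (m - 1) * ((D * ρ * (1 / 2) ^ (n + 1)) ^ 2)⁻¹) * (D ^ (k + 2) * W * x) +
      a ^ (r / p - 1 - m) * ((D ^ (k + 2) * W * x) ^ (1 - 1 / p) * J) := by positivity
  calc _ ≤ C * (c ^ (-(m - 1 + 2 * r / N)) * κ ^ (-(m - 1 + 2 * r / N))) * (2 ^ (n + 2)) ^ 6 *
        (g * 4 ^ (n + 1) * θ⁻¹ * W * D ^ k * X) ^ (1 + 2 / N) := by
        gcongr
    _ = C * (c ^ (-(m - 1 + 2 * r / N)) * κ ^ (-(m - 1 + 2 * r / N))) * (2 ^ (n + 2)) ^ 6 *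
        ((g * 4) ^ (1 + 2 / N) * ((4 : ℝ) ^ n) ^ (1 + 2 / N) * (θ⁻¹ * W) ^ (1 + 2 / N) *
          (D ^ k) ^ (1 + 2 / N) * X ^ (1 + 2 / N)) := by
        rw [show g * 4 ^ (n + 1) * θ⁻¹ * W * D ^ k * X =
          (g * 4) * 4 ^ n * (θ⁻¹ * W) * D ^ k * X by ring]
        rw [Real.mul_rpow (by positivity) hX, Real.mul_rpow (by positivity) (by positivity),
          Real.mul_rpow (by positivity) (by positivity), Real.mul_rpow (by positivity) (by positivity)]
    _ = D ^ (k + 2) * (κ ^ (-(m - 1 + 2 * r / N)) * (θ⁻¹ * W) ^ (1 + 2 / N)) *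
        ((C * c ^ (-(m - 1 + 2 * r / N)) * 2 ^ 12 * (g * 4) ^ (1 + 2 / N)) *
        (2 ^ 6 * 4 ^ (1 + 2 / N)) ^ n * X ^ (1 + 2 / N)) := by
        rw [hDk, h4, mul_pow (2 ^ 6)]
        rw [show ((2 : ℝ) ^ (n + 2)) ^ 6 = 2 ^ 12 * (2 ^ 6) ^ n by
          rw [← pow_mul, ← pow_mul, ← pow_add]; congr 1; ring]
        ring
    _ = _ := by rw [hid]

end NormalizedStep

/-! ### The iteration -/

section SupBound

variable {N : ℕ}

/-- The levels increase to κ while the cylinders shrink to the inner one. The normalized level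
integrals tend to zero, so the integral of |u|^r over the part of the inner cylinder where |u| > κ
vanishes. -/
theorem exists_sup_bound (hN : 2 < N) {m ν L p r β : ℝ} (hm : 0 < m) (hm1 : m ≤ 1)
    (hr : 1 + m ≤ r) (hν : 0 < ν) (hL : 0 < L) (hp : ((N : ℝ) + 2) / 2 < p)
    (hrp : r ≤ p * (1 + m)) (hlam : 0 ≤ m - 1 + 2 * r / N) (hβ : 0 ≤ β) : ∃ ε : ℝ, 0 < ε ∧
    ∀ (d : ℕ) (x₀ : Space N) (ρ θ σ t₀ κ : ℝ) (u : SpaceTime N → Space d) (f : SpaceTime N → ℝ),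
    0 < ρ → 0 < θ → 0 < σ → σ < 1 → 0 < κ →
    IsBackwardSolution m ν L x₀ ρ (t₀ - θ) t₀ u f →
    AEStronglyMeasurable u (volume.restrict (Metric.ball x₀ ρ ×ˢ Ioc (t₀ - θ) t₀)) →
    MemLp f (ENNReal.ofReal p) (volume.restrict (Metric.ball x₀ ρ ×ˢ Ioc (t₀ - θ) t₀)) →
    (∀ z, 0 ≤ f z) →
    IntegrableOn (fun z => levelPow m (κ ^ (2 * m) / 2) r (u z))
      (Metric.ball x₀ ρ ×ˢ Ioc (t₀ - θ) t₀) →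
    θ * κ ^ (m - 1) ≤ ρ ^ 2 →
    (∫ z in Metric.ball x₀ ρ ×ˢ Ioc (t₀ - θ) t₀, f z ^ p) ^ (1 / p) ≤
      β * (κ ^ (1 + m - N * (1 - m) / (2 * p)) * θ ^ (-1 + ((N : ℝ) + 2) / (2 * p))) →
    ∫ z in Metric.ball x₀ ρ ×ˢ Ioc (t₀ - θ) t₀, levelPow m (κ ^ (2 * m) / 2) r (u z) ≤
      ε * ((1 - σ) ^ (N + 2) * (κ ^ (N * (m - 1) / 2 + r) * θ ^ (((N : ℝ) + 2) / 2))) →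
    ∀ᵐ z ∂volume.restrict (Metric.ball x₀ (σ * ρ) ×ˢ Ioc (t₀ - σ * θ) t₀), ‖u z‖ ≤ κ := by
  have hN' : (2 : ℝ) < N := by exact_mod_cast hN
  have hN0 : (0 : ℝ) < N := by linarith
  have hp1 : 1 < p := by linarith
  have hp0 : 0 < p := by linarith
  obtain ⟨C, hC0, hC⟩ := exists_backward_level_step hN hm hm1 hr hν hL hp1 hrp hlam
  -- The lowest level is cκ, that is κ^{2m}/2 in terms of |u|^{2m}; all levels are comparable to κ.
  obtain ⟨c, hc⟩ : ∃ c : ℝ, c = (1 / 2) ^ (1 / (2 * m)) := ⟨_, rfl⟩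
  have hc0 : 0 < c := by rw [hc]; positivity
  obtain ⟨C', hC'⟩ : ∃ C' : ℝ, C' = C * c ^ (-(m - 1 + 2 * r / N)) * 2 ^ 12 *
        ((1 + c ^ (m - 1) + c ^ (r / p - 1 - m) * β) * 4) ^ (1 + 2 / (N : ℝ)) := ⟨_, rfl⟩
  have hC'0 : 0 ≤ C' := by rw [hC']; positivity
  obtain ⟨b, hb⟩ : ∃ b : ℝ, b = 2 ^ 6 * 4 ^ (1 + 2 / (N : ℝ)) := ⟨_, rfl⟩
  have hb1 : 1 < b := by
    have h1 : (1 : ℝ) ≤ 4 ^ (1 + 2 / (N : ℝ)) :=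
      Real.one_le_rpow (by norm_num) (by positivity)
    rw [hb]; linarith
  -- Equivalent to p > (N+2)/2; the strict inequality makes the iteration superlinear.
  have hsq : 1 < (1 - 1 / p) * (1 + 2 / (N : ℝ)) := by
    have e : (1 - 1 / p) * (1 + 2 / (N : ℝ)) = ((p - 1) * (N + 2)) / (p * N) := by
      field_simp
    rw [e, lt_div_iff₀ (by positivity)]
    linarith
  -- `C'` is only known to be nonnegative, hence `C' + 1`.
  obtain ⟨ε, hε0, hε⟩ := tendsto_zero_of_le_pow_mul_add_rpow (C := C' + 1) (b := b) (s := 1 - 1 / p)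
    (q := 1 + 2 / (N : ℝ)) (by linarith) hb1 (by simpa using hp0.le) (by positivity) hsq
  refine ⟨ε, hε0, fun d x₀ ρ θ σ t₀ κ u f hρ hθ hσ hσ1 hκ hu hum hf hf0 hint hκρ hfB hY0 => ?_⟩
  obtain ⟨D, hD⟩ : ∃ D, D = 1 - σ := ⟨_, rfl⟩
  have hD0 : 0 < D := by linarith
  have hD1 : D ≤ 1 := by linarith
  rw [← hD] at hY0
  obtain ⟨W, hW⟩ : ∃ W : ℝ, W = κ ^ (N * (m - 1) / 2 + r) * θ ^ (((N : ℝ) + 2) / 2) := ⟨_, rfl⟩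
  have hW0 : 0 < W := by rw [hW]; positivity
  rw [← hW] at hY0
  -- the sequences of levels, radii and initial times
  obtain ⟨a, ha⟩ : ∃ a : ℕ → ℝ, ∀ n, a n = κ * (1 - (1 / 2) ^ (n + 1)) ^ (1 / (2 * m)) :=
    ⟨_, fun _ => rfl⟩
  have hhalf : ∀ n : ℕ, ((1 : ℝ) / 2) ^ (n + 1) ≤ 1 / 2 := fun n => by
    rw [pow_succ]
    exact mul_le_of_le_one_left (by norm_num) (pow_le_one₀ (by norm_num) (by norm_num))
  have hhalf0 : ∀ n : ℕ, (0 : ℝ) < (1 / 2) ^ n := fun n => by positivity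
  have hca : ∀ n, c * κ ≤ a n := fun n => by
    rw [ha, hc, mul_comm]
    gcongr
    linarith [hhalf n]
  have ha0 : ∀ n, 0 < a n := fun n => lt_of_lt_of_le (by positivity) (hca n)
  have ha2 : ∀ n, a n ^ (2 * m) = κ ^ (2 * m) * (1 - (1 / 2) ^ (n + 1)) := fun n => by
    have h1 : (0 : ℝ) ≤ 1 - (1 / 2) ^ (n + 1) := by linarith [hhalf n]
    rw [ha, Real.mul_rpow hκ.le (by positivity), ← Real.rpow_mul h1,
      one_div_mul_cancel (by positivity), Real.rpow_one]
  have hκ2 : 0 < κ ^ (2 * m) := by positivity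
  have haa : ∀ n, a n < a (n + 1) := fun n => by
    rw [ha, ha]
    have h1 : ((1 : ℝ) / 2) ^ (n + 1 + 1) < (1 / 2) ^ (n + 1) :=
      pow_lt_pow_right_of_lt_one₀ (by norm_num) (by norm_num) (Nat.lt_succ_self _)
    exact mul_lt_mul_of_pos_left (Real.rpow_lt_rpow (by linarith [hhalf n]) (by linarith)
      (by positivity)) hκ
  have ha2κ : ∀ n, a n ^ (2 * m) ≤ κ ^ (2 * m) := fun n => by
    rw [ha2]; exact mul_le_of_le_one_right hκ2.le (by linarith [hhalf0 (n + 1)])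
  have ha2h : ∀ n, κ ^ (2 * m) / 2 ≤ a n ^ (2 * m) := fun n => by
    rw [ha2]; nlinarith [hhalf n]
  obtain ⟨R, hR⟩ : ∃ R : ℕ → ℝ, ∀ n, R n = σ * ρ + D * ρ * (1 / 2) ^ n := ⟨_, fun _ => rfl⟩
  obtain ⟨s, hs⟩ : ∃ s : ℕ → ℝ, ∀ n, s n = t₀ - σ * θ - D * θ * (1 / 2) ^ n := ⟨_, fun _ => rfl⟩
  have hRσ : ∀ n, σ * ρ ≤ R n := fun n => by
    rw [hR]; exact le_add_of_nonneg_right (by positivity)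
  have hsσ : ∀ n, s n ≤ t₀ - σ * θ := fun n => by
    rw [hs]; exact sub_le_self _ (by positivity)
  have hRρ : ∀ n, R n ≤ ρ := fun n => by
    have h1 : ((1 : ℝ) / 2) ^ n ≤ 1 := pow_le_one₀ (by norm_num) (by norm_num)
    calc R n = σ * ρ + D * ρ * (1 / 2) ^ n := hR n
      _ ≤ σ * ρ + D * ρ * 1 := by gcongr
      _ = ρ := by rw [hD]; ring
  have hsθ : ∀ n, t₀ - θ ≤ s n := fun n => by
    have h1 : ((1 : ℝ) / 2) ^ n ≤ 1 := pow_le_one₀ (by norm_num) (by norm_num)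
    calc t₀ - θ = t₀ - σ * θ - D * θ * 1 := by rw [hD]; ring
      _ ≤ t₀ - σ * θ - D * θ * (1 / 2) ^ n := by gcongr
      _ = s n := (hs n).symm
  have hRR : ∀ n, R n - R (n + 1) = D * ρ * (1 / 2) ^ (n + 1) := fun n => by
    rw [hR, hR]; ring
  have hss : ∀ n, s (n + 1) - s n = D * θ * (1 / 2) ^ (n + 1) := fun n => by
    rw [hs, hs]; ring
  obtain ⟨S, hS⟩ : ∃ S : ℕ → Set (SpaceTime N), ∀ n, S n = Metric.ball x₀ (R n) ×ˢ Ioc (s n) t₀ :=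
    ⟨_, fun _ => rfl⟩
  obtain ⟨Y, hY⟩ : ∃ Y : ℕ → ℝ, ∀ n, Y n = ∫ z in S n, levelPow m (a n ^ (2 * m)) r (u z) :=
    ⟨_, fun _ => rfl⟩
  have hYnn : ∀ n, 0 ≤ Y n := fun n => by
    rw [hY]; exact integral_nonneg fun z => levelPow_nonneg _
  have hSsub : ∀ n, S n ⊆ Metric.ball x₀ ρ ×ˢ Ioc (t₀ - θ) t₀ := fun n => by
    rw [hS]
    exact prod_mono (Metric.ball_subset_ball (hRρ n)) (Ioc_subset_Ioc_left (hsθ n))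
  have hlint : ∀ k : ℝ, κ ^ (2 * m) / 2 ≤ k → IntegrableOn (fun z => levelPow m k r (u z))
      (Metric.ball x₀ ρ ×ˢ Ioc (t₀ - θ) t₀) := fun k hk => by
    refine Integrable.mono hint
      (measurable_levelPow.comp_aemeasurable hum.aemeasurable).aestronglyMeasurable
      (ae_of_all _ fun z => ?_)
    rw [Real.norm_of_nonneg (levelPow_nonneg _), Real.norm_of_nonneg (levelPow_nonneg _)]
    exact levelPow_anti hk _
  -- the recursion
  have hrec : ∀ n, Y (n + 1) ≤ D ^ (N + 2) * W * (C' * b ^ n *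
      (Y n / (D ^ (N + 2) * W) + (Y n / (D ^ (N + 2) * W)) ^ (1 - 1 / p)) ^ (1 + 2 / (N : ℝ))) := by
    intro n
    have hRpos : 0 < R (n + 1) := lt_of_lt_of_le (by positivity) (hRσ _)
    have hRlt : R (n + 1) < R n := by
      have : 0 < D * ρ * (1 / 2) ^ (n + 1) := by positivity
      linarith [hRR n]
    have hslt : s n < s (n + 1) := by
      have : 0 < D * θ * (1 / 2) ^ (n + 1) := by positivity
      linarith [hss n]
    have step := hC d x₀ ρ (t₀ - θ) t₀ u f hu hum hf hf0 (a n) (a (n + 1)) (ha0 n) (haa n)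
      (R (n + 1)) (R n) (s n) (s (n + 1)) hRpos hRlt (hRρ n) (hsθ n) hslt
      (by rw [← hS]; exact (hlint _ (ha2h n)).mono_set (hSsub n))
    rw [← hS, ← hS, ← hY, ← hY, hss, hRR] at step
    have hYx : Y n = D ^ (N + 2) * W * (Y n / (D ^ (N + 2) * W)) := by field_simp
    have hx0 : 0 ≤ Y n / (D ^ (N + 2) * W) := div_nonneg (hYnn n) (by positivity)
    generalize Y n / (D ^ (N + 2) * W) = x at *
    rw [hYx] at step
    -- The levels are geometric in |u|^{2m}, so the steepness is explicit and below 2^{n+2}.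
    have hKeq : a (n + 1) ^ (2 * m) / (a (n + 1) ^ (2 * m) - a n ^ (2 * m)) =
        (1 - (1 / 2) ^ (n + 2)) * 2 ^ (n + 2) := by
      have e1 : a (n + 1) ^ (2 * m) - a n ^ (2 * m) = κ ^ (2 * m) * (1 / 2) ^ (n + 2) := by
        rw [ha2, ha2]; ring
      rw [e1, ha2, mul_div_mul_left _ _ hκ2.ne', one_div, inv_pow, div_inv_eq_mul]
    rw [hKeq] at step
    have hh := hhalf (n + 1)
    have hh0 := hhalf0 (n + 2)
    have h2 : (0 : ℝ) < 2 ^ (n + 2) := by positivity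
    rw [hC', hb]
    exact step.trans (normalized_step rfl hN0 hm1 hp.le hp1 hrp hκ hθ hρ hD0 hD1 hc0 (hca n)
      (hca (n + 1)) hβ hx0 hκρ hW
      (Real.rpow_nonneg (integral_nonneg fun z => Real.rpow_nonneg (hf0 z) _) _) hfB hC0
      (mul_nonneg (by linarith) h2.le) (mul_le_of_le_one_left h2.le (by linarith)) hlam)
  have hlim : Tendsto (fun n => Y n / (D ^ (N + 2) * W)) atTop (𝓝 0) := by
    have hDW : 0 < D ^ (N + 2) * W := by positivity
    refine hε _ (fun n => div_nonneg (hYnn n) hDW.le) ?_ fun n => ?_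
    · rw [div_le_iff₀ hDW]
      refine le_trans ?_ hY0
      rw [hY]
      calc _ ≤ ∫ z in Metric.ball x₀ ρ ×ˢ Ioc (t₀ - θ) t₀, levelPow m (a 0 ^ (2 * m)) r (u z) :=
            setIntegral_mono_set (hlint _ (ha2h 0)) (ae_of_all _ fun z => levelPow_nonneg _)
              (hSsub 0).eventuallyLE
        _ ≤ _ := integral_mono (hlint _ (ha2h 0)) hint fun z => levelPow_anti (ha2h 0) _
    · have hX : 0 ≤ b ^ n * (Y n / (D ^ (N + 2) * W) +
          (Y n / (D ^ (N + 2) * W)) ^ (1 - 1 / p)) ^ (1 + 2 / (N : ℝ)) := by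
        have : 0 ≤ Y n / (D ^ (N + 2) * W) := div_nonneg (hYnn n) hDW.le
        have : 0 ≤ b := by linarith
        positivity
      rw [div_le_iff₀ hDW]
      refine (hrec n).trans ?_
      linarith [mul_nonneg hX hDW.le]
  -- conclusion
  have hsub : ∀ n, Metric.ball x₀ (σ * ρ) ×ˢ Ioc (t₀ - σ * θ) t₀ ⊆ S n := fun n => by
    rw [hS]
    exact prod_mono (Metric.ball_subset_ball (hRσ n)) (Ioc_subset_Ioc_left (hsσ n))
  have hinf : ∀ n, ∫ z in Metric.ball x₀ (σ * ρ) ×ˢ Ioc (t₀ - σ * θ) t₀,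
      levelPow m (κ ^ (2 * m)) r (u z) ≤ Y n := fun n => by
    rw [hY]
    calc _ ≤ ∫ z in S n, levelPow m (κ ^ (2 * m)) r (u z) :=
          setIntegral_mono_set ((hlint _ (by linarith)).mono_set (hSsub n))
            (ae_of_all _ fun z => levelPow_nonneg _) (hsub n).eventuallyLE
      _ ≤ _ := integral_mono ((hlint _ (by linarith)).mono_set (hSsub n))
            ((hlint _ (ha2h n)).mono_set (hSsub n)) fun z => levelPow_anti (ha2κ n) _
  have hDW : 0 < D ^ (N + 2) * W := by positivity
  have hlimY : Tendsto Y atTop (𝓝 0) := by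
    have := hlim.mul_const (D ^ (N + 2) * W)
    rw [zero_mul] at this
    refine this.congr fun n => ?_
    field_simp
  have hzero : ∫ z in Metric.ball x₀ (σ * ρ) ×ˢ Ioc (t₀ - σ * θ) t₀,
      levelPow m (κ ^ (2 * m)) r (u z) = 0 :=
    le_antisymm (ge_of_tendsto' hlimY hinf) (integral_nonneg fun z => levelPow_nonneg _)
  rw [integral_eq_zero_iff_of_nonneg (fun z => levelPow_nonneg _)
    ((hlint _ (by linarith)).mono_set ((hsub 0).trans (hSsub 0)))] at hzero
  filter_upwards [hzero] with z hz
  by_contra hcon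
  have hlt := not_le.1 hcon
  have h1 : κ ^ (2 * m) < ‖u z‖ ^ (2 * m) := Real.rpow_lt_rpow hκ.le hlt (by positivity)
  simp only [levelPow, if_pos h1, Pi.zero_apply] at hz
  exact (Real.rpow_pos_of_pos (hκ.trans hlt) r).ne' hz

end SupBound

/-! ### Measurability of superposition operators -/

section Caratheodory

/-- Superposition operators of Carathéodory functions preserve measurability. -/
theorem aestronglyMeasurable_comp_of_continuous {Z X Y : Type*} [MeasurableSpace Z]
    {μ : Measure Z} [TopologicalSpace X] [NormedAddCommGroup Y] {A : Z → X → Y}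
    (hA : ∀ x, AEStronglyMeasurable (fun z => A z x) μ) (hc : ∀ᵐ z ∂μ, Continuous (A z))
    {g : Z → X} (hg : AEStronglyMeasurable g μ) : AEStronglyMeasurable (fun z => A z (g z)) μ := by
  set g' := hg.mk g with hg'
  have hsm : StronglyMeasurable g' := hg.stronglyMeasurable_mk
  suffices h : AEStronglyMeasurable (fun z => A z (g' z)) μ by
    refine h.congr ?_
    filter_upwards [hg.ae_eq_mk] with z hz
    rw [hz]
  refine aestronglyMeasurable_of_tendsto_ae atTop (f := fun n z => A z (hsm.approx n z))
    (fun n => ?_) ?_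
  -- For a simple inner function the composition is a finite sum over its values; continuity in the
  -- second variable then gives the limit.
  · have : (fun z => A z (hsm.approx n z)) = fun z => ∑ x ∈ (hsm.approx n).range,
        ((hsm.approx n) ⁻¹' {x}).indicator (fun z => A z x) z := by
      funext z
      rw [Finset.sum_eq_single_of_mem (hsm.approx n z) (SimpleFunc.mem_range_self _ z)]
      · simp [indicator]
      · intro x _ hx
        exact indicator_of_notMem (fun h => hx h.symm) _
    rw [this]
    exact Finset.aestronglyMeasurable_fun_sum _ fun x _ =>
      (hA x).indicator ((hsm.approx n).measurableSet_fiber x)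
  · filter_upwards [hc] with z hz
    exact (hz.tendsto _).comp (hsm.tendsto_approx z)

end Caratheodory

/-! ### From time slices to space-time -/

section Slices

variable {N d : ℕ}

theorem timeDeriv_eq_fderiv {φ : SpaceTime N → Space d} (hφ : ContDiff ℝ ∞ φ) (z : SpaceTime N) :
    timeDeriv φ z = fderiv ℝ φ z (timeDir N) := by
  have h1 : HasDerivAt (fun s : ℝ => (z.1, s)) ((0 : Space N), (1 : ℝ)) z.2 :=
    (hasDerivAt_const _ _).prodMk (hasDerivAt_id _)
  have h2 := (hφ.differentiable (by simp) (z.1, z.2)).hasFDerivAt.comp_hasDerivAt z.2 h1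
  exact h2.deriv

theorem fderiv_slice_apply {Y : Type*} [NormedAddCommGroup Y] [NormedSpace ℝ Y]
    {φ : SpaceTime N → Y} (hφ : ContDiff ℝ ∞ φ) (x : Space N) (t : ℝ) (i : Fin N) :
    fderiv ℝ (fun x => φ (x, t)) x (EuclideanSpace.single i 1) =
      fderiv ℝ φ (x, t) (spaceDir N i) := by
  have h1 : HasFDerivAt (fun x : Space N => (x, t)) (ContinuousLinearMap.inl ℝ (Space N) ℝ) x :=
    hasFDerivAt_prodMk_left x t
  have h2 := (hφ.differentiable (by simp) (x, t)).hasFDerivAt.comp x h1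
  have h3 : fderiv ℝ (fun x => φ (x, t)) x = _ := h2.fderiv
  rw [h3]
  simp [spaceDir]

theorem spaceGrad_apply {φ : SpaceTime N → Space d} (hφ : ContDiff ℝ ∞ φ) (z : SpaceTime N)
    (i : Fin N) : spaceGrad φ z i = fderiv ℝ φ z (spaceDir N i) :=
  fderiv_slice_apply hφ z.1 z.2 i

theorem inner_spaceGrad {φ : SpaceTime N → Space d} (hφ : ContDiff ℝ ∞ φ) (z : SpaceTime N)
    (y : GradSpace N d) :
    (inner ℝ y (spaceGrad φ z) : ℝ) = ∑ i, (inner ℝ (y i) (fderiv ℝ φ z (spaceDir N i)) : ℝ) := by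
  rw [PiLp.inner_apply]
  exact Finset.sum_congr rfl fun i _ => by rw [← spaceGrad_apply hφ]

theorem tsupport_slice_subset {Y : Type*} [NormedAddCommGroup Y] (φ : SpaceTime N → Y) (t : ℝ) :
    tsupport (fun x => φ (x, t)) ⊆ (fun x => (x, t)) ⁻¹' tsupport φ :=
  closure_minimal (fun _ hx => subset_tsupport φ hx)
    ((isClosed_tsupport φ).preimage (by fun_prop))

/-- Weak gradients on almost every time slice give weak derivatives in space-time. -/
theorem hasWeakDerivs_of_slices {Ω : Set (Space N)} {T : ℝ} {U : Set (SpaceTime N)}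
    {w : SpaceTime N → Space d} {G : SpaceTime N → GradSpace N d}
    (hUm : MeasurableSet U) (hU : U ⊆ Ω ×ˢ Ioo 0 T) (hw : IntegrableOn w U)
    (hG : ∀ i, IntegrableOn (fun z => G z i) U)
    (h : ∀ᵐ t ∂volume.restrict (Ioo 0 T),
      HasWeakGradientOn Ω (fun x => w (x, t)) (fun x => G (x, t))) {w' : SpaceTime N → Space d}
    (hw' : ∀ᵐ z ∂volume.restrict U, w' z = w z) :
    HasWeakDerivs volume U (spaceDir N) w' (fun i => U.indicator fun z => G z i) := by
  intro η hη hηc hηU i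
  have hη0 : ∀ z, z ∉ U → η z = 0 := fun z hz =>
    image_eq_zero_of_notMem_tsupport fun h => hz (hηU h)
  have hdη0 : ∀ z, z ∉ U → fderiv ℝ η z = 0 := fun z hz => by
    by_contra hne
    exact hz (hηU (support_fderiv_subset ℝ hne))
  have hdc : Continuous (fun z => fderiv ℝ η z (spaceDir N i)) :=
    (hη.continuous_fderiv (by simp)).clm_apply continuous_const
  obtain ⟨B, hB⟩ := hηc.exists_bound_of_continuous hη.continuous
  obtain ⟨B', hB'⟩ := (hηc.fderiv_apply ℝ (spaceDir N i)).exists_bound_of_continuous hdc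
  have i1 : Integrable (fun z => fderiv ℝ η z (spaceDir N i) • w z) := by
    refine (integrableOn_iff_integrable_of_support_subset (s := U) fun z hz => ?_).1 ?_
    · by_contra hzU
      exact hz (by simp [hdη0 z hzU])
    · refine Integrable.mono' (hw.norm.const_mul B')
        (hdc.aestronglyMeasurable.smul hw.aestronglyMeasurable) (ae_of_all _ fun z => ?_)
      rw [norm_smul]
      exact mul_le_mul_of_nonneg_right (hB' z) (norm_nonneg _)
  have i2 : Integrable (fun z => η z • G z i) := by
    refine (integrableOn_iff_integrable_of_support_subset (s := U) fun z hz => ?_).1 ?_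
    · by_contra hzU
      exact hz (by simp [hη0 z hzU])
    · refine Integrable.mono' ((hG i).norm.const_mul B)
        (hη.continuous.aestronglyMeasurable.smul (hG i).aestronglyMeasurable)
        (ae_of_all _ fun z => ?_)
      rw [norm_smul]
      exact mul_le_mul_of_nonneg_right (hB z) (norm_nonneg _)
  have e1 : ∫ z, fderiv ℝ η z (spaceDir N i) • w' z =
      ∫ z, fderiv ℝ η z (spaceDir N i) • w z := by
    refine integral_congr_ae ?_
    filter_upwards [(ae_restrict_iff' hUm).1 hw'] with z hz
    by_cases hzU : z ∈ U
    · rw [hz hzU]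
    · simp [hdη0 z hzU]
  have e2 : ∫ z, η z • U.indicator (fun z => G z i) z = ∫ z, η z • G z i := by
    refine integral_congr_ae (ae_of_all _ fun z => ?_)
    by_cases hzU : z ∈ U
    · simp [hzU]
    · simp [hη0 z hzU]
  rw [e1, e2, Measure.volume_eq_prod, integral_prod_symm _ i1, integral_prod_symm _ i2,
    ← integral_neg]
  refine integral_congr_ae ?_
  filter_upwards [(ae_restrict_iff' measurableSet_Ioo).1 h] with t ht
  by_cases htT : t ∈ Ioo 0 T
  · have hsub : tsupport (fun x => η (x, t)) ⊆ Ω := fun x hx =>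
      (hU (hηU (tsupport_slice_subset η t hx))).1
    have hslice := (ht htT).integral_eq (fun x => η (x, t)) (hη.comp (by fun_prop)) ?_ hsub i
    · rw [setIntegral_eq_integral_of_forall_compl_eq_zero,
        setIntegral_eq_integral_of_forall_compl_eq_zero] at hslice
      · simpa only [fderiv_slice_apply hη] using hslice
      · intro x hx
        rw [image_eq_zero_of_notMem_tsupport (f := fun x => η (x, t)) fun h => hx (hsub h), zero_smul]
      · intro x hx
        rw [fderiv_slice_apply hη, hdη0 _ fun hz => hx (hU hz).1]
        simp
    · refine HasCompactSupport.of_support_subset_isCompact (hηc.image continuous_fst) fun x hx => ?_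
      exact ⟨(x, t), subset_tsupport η hx, rfl⟩
  · have h0 : ∀ x, (x, t) ∉ U := fun x hx => htT (hU hx).2
    simp [hη0 _ (h0 _), hdη0 _ (h0 _)]

end Slices

/-! ### Localizing a weak solution -/

section Construction

variable {N d : ℕ} {m ν L T : ℝ} {Ω : Set (Space N)}
  {A : SpaceTime N → Space d → GradSpace N d → GradSpace N d}
  {F : SpaceTime N → GradSpace N d} {u : SpaceTime N → Space d}

theorem continuous_vecPow (hm : 0 < m) : Continuous (vecPow m : Space d → Space d) := by
  rw [continuous_iff_continuousAt]
  intro v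
  by_cases hv : v = 0
  · subst hv
    have h0 : vecPow m (0 : Space d) = 0 := by simp [vecPow]
    rw [ContinuousAt, h0, tendsto_zero_iff_norm_tendsto_zero]
    simp only [norm_vecPow hm]
    have : ContinuousAt (fun v : Space d => ‖v‖ ^ m) 0 :=
      (continuous_norm.rpow_const fun _ => Or.inr hm.le).continuousAt
    simpa [ContinuousAt, Real.zero_rpow hm.ne'] using this
  · exact (continuousAt_id.norm.rpow_const (Or.inl (norm_ne_zero_iff.2 hv))).smul continuousAt_id

/-- All data are extended by zero. Test functions supported in `U` do not see the change, and off
`U` the structure conditions are trivial. -/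
theorem IsLocalWeakSolution.exists_localSolution (h : IsLocalWeakSolution m Ω T A F u)
    (hm : 0 < m) (hA : IsCaratheodory (domain Ω T) A)
    (hg : GrowthConditions m ν L (domain Ω T) A) {U K : Set (SpaceTime N)} (hU : IsOpen U)
    (hUK : U ⊆ K) (hK : IsCompact K) (hKΩ : K ⊆ Ω ×ˢ Ioo 0 T) {M : ℝ} (hM0 : 0 ≤ M)
    (hM : ∀ᵐ z ∂volume.restrict U, ‖u z‖ ≤ M) :
    ∃ (v : SpaceTime N → Space d) (A' F' G' : Fin N → SpaceTime N → Space d),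
      LocalSolution m ν L M U v A' F' G' ∧ (∀ᵐ z ∂volume.restrict U, v z = u z) ∧
      ∀ᵐ z ∂volume.restrict U, ∑ i, ‖F' i z‖ ^ 2 = ‖F z‖ ^ 2 := by
  classical
  obtain ⟨G, hG, hGw, hweak⟩ := h.exists_grad
  have hUm : MeasurableSet U := hU.measurableSet
  have hUΩ : U ⊆ Ω ×ˢ Ioo 0 T := hUK.trans hKΩ
  have hUD : U ⊆ domain Ω T := hUΩ.trans (prod_mono subset_rfl Ioo_subset_Ioc_self)
  have hUfin : volume U ≠ ⊤ := ((measure_mono hUK).trans_lt hK.measure_lt_top).ne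
  have : IsFiniteMeasure (volume.restrict U) := ⟨by
    rw [Measure.restrict_apply_univ]; exact hUfin.lt_top⟩
  have hGU : MemLp G 2 (volume.restrict U) :=
    (hG K hKΩ hK).mono_measure (Measure.restrict_mono hUK le_rfl)
  have hFU : MemLp F 2 (volume.restrict U) :=
    (h.memLp_rhs K hKΩ hK).mono_measure (Measure.restrict_mono hUK le_rfl)
  have hum : AEStronglyMeasurable u (volume.restrict U) :=
    h.aestronglyMeasurable.mono_measure (Measure.restrict_mono hUΩ le_rfl)
  have hgU := ae_restrict_of_ae_restrict_of_subset hUD hg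
  have hAU : MemLp (fun z => A z (u z) (G z)) 2 (volume.restrict U) := by
    refine hGU.of_le_mul (c := L) ?_ ?_
    · exact aestronglyMeasurable_comp_of_continuous (A := fun z (y : Space d × GradSpace N d) =>
        A z y.1 y.2) (g := fun z => (u z, G z))
        (fun y => (hA.measurable y.1 y.2).mono_measure (Measure.restrict_mono hUD le_rfl))
        (ae_restrict_of_ae_restrict_of_subset hUD hA.continuous) (hum.prodMk hGU.1)
    · filter_upwards [hgU] with z hz
      exact (hz (u z) (G z)).2.1
  have hcomp : ∀ {H : SpaceTime N → GradSpace N d}, MemLp H 2 (volume.restrict U) → ∀ i,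
      MemLp (fun z => H z i) 2 (volume.restrict U) := fun hH i =>
    (PiLp.proj (𝕜 := ℝ) 2 (fun _ : Fin N => Space d) i).comp_memLp' hH
  -- Cutting off values above `M` alters u on a null set only and turns the almost everywhere bound
  -- into one at every point.
  set v : SpaceTime N → Space d := U.indicator fun z => if ‖u z‖ ≤ M then u z else 0 with hv
  have hvu : ∀ᵐ z ∂volume.restrict U, v z = u z := by
    filter_upwards [hM, ae_restrict_mem hUm] with z hz hzU
    rw [hv, indicator_of_mem hzU, if_pos hz]
  have hvu' : ∀ᵐ z, z ∈ U → v z = u z := (ae_restrict_iff' hUm).1 hvu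
  have hv0 : ∀ z, z ∉ U → v z = 0 := fun z hz => indicator_of_notMem hz _
  have hvM : ∀ z, ‖v z‖ ≤ M := fun z => by
    by_cases hz : z ∈ U
    · rw [hv, indicator_of_mem hz]
      split_ifs with h1
      · exact h1
      · simpa using hM0
    · rw [hv0 z hz]; simpa using hM0
  have hvind : U.indicator u =ᵐ[volume] v := by
    filter_upwards [hvu'] with z hz
    by_cases hzU : z ∈ U
    · rw [indicator_of_mem hzU, hz hzU]
    · rw [indicator_of_notMem hzU, hv0 z hzU]
  have hvm : AEStronglyMeasurable v :=
    ((aestronglyMeasurable_indicator_iff hUm).2 hum).congr hvind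
  have hvp0 : vecPow m (0 : Space d) = 0 := by simp [vecPow]
  have hvpow : MemLp (fun z => vecPow m (v z)) 2 := by
    have hle : MemLp (U.indicator fun _ => M ^ m) 2 (volume : Measure (SpaceTime N)) :=
      (memLp_indicator_iff_restrict hUm).2 (memLp_const _)
    refine hle.mono' ((continuous_vecPow hm).comp_aestronglyMeasurable hvm)
      (ae_of_all _ fun z => ?_)
    rw [norm_vecPow hm]
    by_cases hz : z ∈ U
    · rw [indicator_of_mem hz]; exact Real.rpow_le_rpow (norm_nonneg _) (hvM z) hm.le
    · rw [indicator_of_notMem hz, hv0 z hz, norm_zero, Real.zero_rpow hm.ne']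
  have hvpU : ∀ᵐ z ∂volume.restrict U, vecPow m (v z) = vecPow m (u z) := by
    filter_upwards [hvu] with z hz
    rw [hz]
  have hwint : IntegrableOn (fun z => vecPow m (u z)) U :=
    ((hvpow.restrict U).integrable (by norm_num)).congr hvpU
  refine ⟨v, fun i => U.indicator fun z => A z (u z) (G z) i, fun i => U.indicator fun z => F z i,
    fun i => U.indicator fun z => G z i, ?_, hvu, ?_⟩
  · refine ⟨hU, hvm, hvM, hvpow, fun i => (memLp_indicator_iff_restrict hUm).2 (hcomp hAU i),
      fun i => (memLp_indicator_iff_restrict hUm).2 (hcomp hFU i),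
      fun i => (memLp_indicator_iff_restrict hUm).2 (hcomp hGU i), ?_, ?_, ?_, ?_, ?_⟩
    · intro φ hφ hφc hφU
      have hdφ0 : ∀ z, z ∉ U → fderiv ℝ φ z = 0 := fun z hz => by
        by_contra hne
        exact hz (hφU (support_fderiv_subset ℝ hne))
      have hdm : ∀ e, MemLp (fun z => fderiv ℝ φ z e) 2 (volume.restrict U) := fun e =>
        (memLp_of_continuous_compactSupport ((hφ.continuous_fderiv (by simp)).clm_apply
          continuous_const) (hφc.fderiv_apply ℝ e) 2).restrict U
      have hw := hweak φ hφ hφc (hφU.trans hUΩ)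
      simp only [timeDeriv_eq_fderiv hφ, inner_spaceGrad hφ] at hw
      have z1 : ∀ z, z ∉ U → ∀ y : Space d, ∀ y' : GradSpace N d,
          (inner ℝ y (fderiv ℝ φ z (timeDir N)) : ℝ) -
            ∑ i, (inner ℝ (y' i) (fderiv ℝ φ z (spaceDir N i)) : ℝ) = 0 := fun z hz y y' => by
        simp [hdφ0 z hz]
      have z2 : ∀ z, z ∉ U → ∀ y' : GradSpace N d,
          ∑ i, (inner ℝ (y' i) (fderiv ℝ φ z (spaceDir N i)) : ℝ) = 0 := fun z hz y' => by
        simp [hdφ0 z hz]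
      rw [setIntegral_eq_integral_of_forall_compl_eq_zero fun z hz =>
          z1 z (fun h => hz (hUΩ h)) (u z) (A z (u z) (G z)),
        setIntegral_eq_integral_of_forall_compl_eq_zero fun z hz =>
          z2 z (fun h => hz (hUΩ h)) (F z),
        ← setIntegral_eq_integral_of_forall_compl_eq_zero (s := U) fun z hz =>
          z1 z hz (u z) (A z (u z) (G z)),
        ← setIntegral_eq_integral_of_forall_compl_eq_zero (s := U) fun z hz =>
          z2 z hz (F z)] at hw
      have hvL2 : MemLp u 2 (volume.restrict U) :=
        MemLp.of_bound hum M hM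
      have iA : ∀ i, Integrable (fun z => (inner ℝ (A z (u z) (G z) i)
          (fderiv ℝ φ z (spaceDir N i)) : ℝ)) (volume.restrict U) := fun i =>
        integrable_inner_of_memLp (hcomp hAU i) (hdm _)
      have iF : ∀ i, Integrable (fun z => (inner ℝ (F z i)
          (fderiv ℝ φ z (spaceDir N i)) : ℝ)) (volume.restrict U) := fun i =>
        integrable_inner_of_memLp (hcomp hFU i) (hdm _)
      rw [integral_sub (integrable_inner_of_memLp hvL2 (hdm _)) (integrable_finsetSum _ fun i _ => iA i),
        integral_finsetSum _ fun i _ => iA i, integral_finsetSum _ fun i _ => iF i] at hw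
      have l1 : ∫ z, (inner ℝ (v z) (fderiv ℝ φ z (timeDir N)) : ℝ) =
          ∫ z in U, (inner ℝ (u z) (fderiv ℝ φ z (timeDir N)) : ℝ) := by
        rw [← setIntegral_eq_integral_of_forall_compl_eq_zero (s := U) fun z hz => by
          rw [hv0 z hz, inner_zero_left]]
        refine integral_congr_ae ?_
        filter_upwards [hvu] with z hz
        rw [hz]
      have l2 : ∀ i, ∫ z, (inner ℝ (((U.indicator fun z => A z (u z) (G z) i) +
            U.indicator fun z => F z i) z) (fderiv ℝ φ z (spaceDir N i)) : ℝ) =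
          (∫ z in U, (inner ℝ (A z (u z) (G z) i) (fderiv ℝ φ z (spaceDir N i)) : ℝ)) +
          ∫ z in U, (inner ℝ (F z i) (fderiv ℝ φ z (spaceDir N i)) : ℝ) := by
        intro i
        rw [← setIntegral_eq_integral_of_forall_compl_eq_zero (s := U) fun z hz => by
          rw [hdφ0 z hz]; simp, ← integral_add (iA i) (iF i)]
        refine setIntegral_congr_fun hUm fun z hz => ?_
        simp only [Pi.add_apply, indicator_of_mem hz, inner_add_left]
      rw [l1, Finset.sum_congr rfl fun i _ => l2 i, Finset.sum_add_distrib]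
      linarith
    · exact hasWeakDerivs_of_slices hUm hUΩ hwint
        (fun i => (hcomp hGU i).integrable (by norm_num)) hGw hvpU
    · filter_upwards [(ae_restrict_iff' hUm).1 hgU] with z hz
      by_cases hzU : z ∈ U
      · have := (hz hzU (u z) (G z)).1
        rw [PiLp.norm_sq_eq_of_L2, PiLp.inner_apply] at this
        simpa only [indicator_of_mem hzU] using this
      · simp [indicator_of_notMem hzU]
    · filter_upwards [(ae_restrict_iff' hUm).1 hgU] with z hz
      by_cases hzU : z ∈ U
      · have := pow_le_pow_left₀ (norm_nonneg _) (hz hzU (u z) (G z)).2.1 2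
        rw [mul_pow, PiLp.norm_sq_eq_of_L2, PiLp.norm_sq_eq_of_L2] at this
        simpa only [indicator_of_mem hzU] using this
      · simp [indicator_of_notMem hzU]
    · filter_upwards [(ae_restrict_iff' hUm).1 hgU, hvu'] with z hz hzv
      by_cases hzU : z ∈ U
      · have := (hz hzU (u z) (G z)).2.2
        simpa only [indicator_of_mem hzU, hzv hzU] using this
      · simp [indicator_of_notMem hzU]
  · filter_upwards [ae_restrict_mem hUm] with z hz
    rw [PiLp.norm_sq_eq_of_L2]
    simp only [indicator_of_mem hz]

/-- The cylinder may touch t = T, whereas the equation is posed on the open interval (0, T). Ending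
at t₁ < t₀ puts its closure inside Ω × (0, T). -/
theorem IsLocalWeakSolution.isBackwardSolution (h : IsLocalWeakSolution m Ω T A F u)
    (hm : 0 < m) (hA : IsCaratheodory (domain Ω T) A)
    (hg : GrowthConditions m ν L (domain Ω T) A) (hu : LocallyBoundedOn u (domain Ω T))
    {x₀ : Space N} {t₀ ρ θ : ℝ} (hQ : Metric.closedBall x₀ ρ ×ˢ Icc (t₀ - θ) t₀ ⊆ domain Ω T)
    (hρ : 0 ≤ ρ) (hθ : 0 ≤ θ) :
    IsBackwardSolution m ν L x₀ ρ (t₀ - θ) t₀ u fun z => ‖F z‖ ^ 2 := by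
  intro t₁ ht₁
  have hK : IsCompact (Metric.closedBall x₀ ρ ×ˢ Icc (t₀ - θ) t₀) :=
    (isCompact_closedBall _ _).prod isCompact_Icc
  obtain ⟨M, hM⟩ := hu _ hQ hK
  have h1 : (x₀, t₀ - θ) ∈ domain Ω T :=
    hQ ⟨Metric.mem_closedBall_self hρ, left_mem_Icc.2 (by linarith)⟩
  have h2 : (x₀, t₀) ∈ domain Ω T :=
    hQ ⟨Metric.mem_closedBall_self hρ, right_mem_Icc.2 (by linarith)⟩
  have hUK : Metric.ball x₀ ρ ×ˢ Ioo (t₀ - θ) t₁ ⊆ Metric.closedBall x₀ ρ ×ˢ Icc (t₀ - θ) t₁ :=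
    prod_mono Metric.ball_subset_closedBall Ioo_subset_Icc_self
  have hKK : Metric.closedBall x₀ ρ ×ˢ Icc (t₀ - θ) t₁ ⊆
      Metric.closedBall x₀ ρ ×ˢ Icc (t₀ - θ) t₀ :=
    prod_mono subset_rfl (Icc_subset_Icc_right ht₁.le)
  have hKΩ : Metric.closedBall x₀ ρ ×ˢ Icc (t₀ - θ) t₁ ⊆ Ω ×ˢ Ioo 0 T := by
    rintro ⟨x, t⟩ ⟨hx, ht⟩
    refine ⟨(hQ (hKK ⟨hx, ht⟩)).1, h1.2.1.trans_le ht.1, ?_⟩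
    exact lt_of_lt_of_le (lt_of_le_of_lt ht.2 ht₁) h2.2.2
  have hM' : ∀ᵐ z ∂volume.restrict (Metric.ball x₀ ρ ×ˢ Ioo (t₀ - θ) t₁), ‖u z‖ ≤ max M 0 := by
    filter_upwards [ae_restrict_of_ae_restrict_of_subset (hUK.trans hKK) hM] with z hz
    exact hz.trans (le_max_left _ _)
  obtain ⟨v, A', F', G', hsol, hv, hF⟩ := h.exists_localSolution hm hA hg
    (Metric.isOpen_ball.prod isOpen_Ioo) hUK ((isCompact_closedBall _ _).prod isCompact_Icc) hKΩ
    (le_max_right M 0) hM'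
  exact ⟨_, v, A', F', G', hsol, hv, hF⟩

end Construction

/-! ### Scaling of the averages -/

section Scaling

theorem le_rpow_of_rpow_le {X κ l : ℝ} (hX : 0 ≤ X) (hl : 0 < l) (h : X ^ (2 / l) ≤ κ) :
    X ≤ κ ^ (l / 2) := by
  calc X = (X ^ (2 / l)) ^ (l / 2) := by
        rw [← Real.rpow_mul hX, show 2 / l * (l / 2) = 1 by field_simp, Real.rpow_one]
    _ ≤ κ ^ (l / 2) := by gcongr

/-- Here βρ^Nθ is the volume of the cylinder. All powers of ρ cancel, and only the power of θ
occurring in `exists_sup_bound` remains. -/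
theorem mul_le_of_scaled_average_le {N : ℕ} {C D β ρ θ I X : ℝ} {k : ℕ} (hD : 0 < D) (hβ : 0 < β)
    (hρ : 0 < ρ) (hθ : 0 < θ)
    (h : C / D ^ k * (ρ ^ 2 / θ) ^ ((N : ℝ) / 2) * ((β * ρ ^ N * θ)⁻¹ * I) ≤ X) :
    C * I ≤ D ^ k * β * (X * θ ^ (((N : ℝ) + 2) / 2)) := by
  have e1 : (ρ ^ 2 / θ) ^ ((N : ℝ) / 2) = ρ ^ N * (θ ^ ((N : ℝ) / 2))⁻¹ := by
    rw [Real.div_rpow (by positivity) hθ.le, ← Real.rpow_natCast ρ 2, ← Real.rpow_mul hρ.le,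
      ← Real.rpow_natCast ρ N, div_eq_mul_inv]
    congr 2
    push_cast
    ring
  have e2 : θ ^ (((N : ℝ) + 2) / 2) = θ ^ ((N : ℝ) / 2) * θ := by
    rw [add_div, div_self two_ne_zero, Real.rpow_add hθ, Real.rpow_one]
  have hP : 0 < θ ^ ((N : ℝ) / 2) := by positivity
  rw [e1] at h
  rw [e2]
  generalize θ ^ ((N : ℝ) / 2) = P at *
  calc C * I = D ^ k * β * ((C / D ^ k * (ρ ^ N * P⁻¹) * ((β * ρ ^ N * θ)⁻¹ * I)) * (P * θ)) := by
        field_simp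
    _ ≤ _ := by gcongr

/-- The same cancellation of ρ for the source, whose weight contributes ρ^{2p}. -/
theorem le_of_scaled_source_average_le {N : ℕ} {p β ρ θ I X : ℝ} (hβ : 0 < β)
    (hρ : 0 < ρ) (hθ : 0 < θ)
    (h : (θ / ρ ^ 2) ^ (p - (N : ℝ) / 2) * ((β * ρ ^ N * θ)⁻¹ * (ρ ^ (2 * p) * I)) ≤ X) :
    I ≤ β * (X * θ ^ (-p + ((N : ℝ) + 2) / 2)) := by
  have e1 : (θ / ρ ^ 2) ^ (p - (N : ℝ) / 2) = θ ^ (p - (N : ℝ) / 2) * ρ ^ N * (ρ ^ (2 * p))⁻¹ := by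
    rw [Real.div_rpow hθ.le (by positivity), ← Real.rpow_natCast ρ 2, ← Real.rpow_mul hρ.le,
      ← Real.rpow_natCast ρ N, div_eq_mul_inv, mul_assoc, ← Real.rpow_neg hρ.le,
      ← Real.rpow_neg hρ.le, ← Real.rpow_add hρ]
    congr 2
    push_cast
    ring
  have e2 : θ ^ (-p + ((N : ℝ) + 2) / 2) = (θ ^ (p - (N : ℝ) / 2))⁻¹ * θ := by
    rw [← Real.rpow_neg hθ.le]
    nth_rewrite 3 [← Real.rpow_one θ]
    rw [← Real.rpow_add hθ]
    ring_nf
  have hP : 0 < θ ^ (p - (N : ℝ) / 2) := by positivity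
  have hQ : 0 < ρ ^ (2 * p) := by positivity
  rw [e1] at h
  rw [e2]
  generalize θ ^ (p - (N : ℝ) / 2) = P at *
  generalize ρ ^ (2 * p) = Q at *
  calc I = β * ((P * ρ ^ N * Q⁻¹ * ((β * ρ ^ N * θ)⁻¹ * (Q * I))) * (P⁻¹ * θ)) := by
        field_simp
    _ ≤ _ := by gcongr

/-- The volume of the unit ball. -/
def unitBallVolume (N : ℕ) : ℝ := volume.real (Metric.ball (0 : Space N) 1)

theorem unitBallVolume_pos (N : ℕ) : 0 < unitBallVolume N :=
  ENNReal.toReal_pos (Metric.measure_ball_pos _ _ one_pos).ne' measure_ball_lt_top.ne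

theorem volume_real_cylinder {N : ℕ} (z : SpaceTime N) {ρ θ : ℝ} (hρ : 0 < ρ) (hθ : 0 < θ) :
    volume.real (cylinder z ρ θ) = unitBallVolume N * ρ ^ N * θ := by
  rw [cylinder, Measure.volume_eq_prod, measureReal_prod_prod,
    measureReal_def, Measure.addHaar_ball_of_pos volume z.1 hρ, finrank_euclideanSpace_fin, ENNReal.toReal_mul,
    ENNReal.toReal_ofReal (by positivity), ← measureReal_def,
    Real.volume_real_Ioc_of_le (by linarith), unitBallVolume]
  ring

theorem closure_cylinder {N : ℕ} (z : SpaceTime N) {ρ θ : ℝ} (hρ : 0 < ρ) (hθ : 0 < θ) :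
    closure (cylinder z ρ θ) = Metric.closedBall z.1 ρ ×ˢ Icc (z.2 - θ) z.2 := by
  rw [cylinder, closure_prod_eq, closure_ball _ hρ.ne', closure_Ioc (by linarith)]

end Scaling

/-! ### Measurability and integrability on the given cylinder -/

section Main

variable {N d : ℕ} {m ν L T : ℝ} {Ω : Set (Space N)}
  {A : SpaceTime N → Space d → GradSpace N d → GradSpace N d}
  {F : SpaceTime N → GradSpace N d} {u : SpaceTime N → Space d}

/-- Measurability is given for t < T only; the top slice of the cylinder is a null set. -/
theorem IsLocalWeakSolution.aestronglyMeasurable_cylinder (h : IsLocalWeakSolution m Ω T A F u)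
    {z : SpaceTime N} {ρ θ : ℝ} (hQ : cylinder z ρ θ ⊆ domain Ω T) :
    AEStronglyMeasurable u (volume.restrict (cylinder z ρ θ)) := by
  have hae : (cylinder z ρ θ : Set (SpaceTime N)) =ᵐ[volume]
      Metric.ball z.1 ρ ×ˢ Ioo (z.2 - θ) z.2 :=
    Measure.set_prod_ae_eq ae_eq_rfl Ioo_ae_eq_Ioc.symm
  rw [Measure.restrict_congr_set hae]
  refine h.aestronglyMeasurable.mono_measure (Measure.restrict_mono ?_ le_rfl)
  rintro ⟨x, t⟩ ⟨hx, ht⟩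
  have h1 : (x, t) ∈ domain Ω T := hQ ⟨hx, ht.1, ht.2.le⟩
  have h2 : (x, z.2) ∈ domain Ω T := hQ ⟨hx, ht.1.trans ht.2, le_rfl⟩
  exact ⟨h1.1, h1.2.1, ht.2.trans_le h2.2.2⟩

theorem memLp_norm_sq {α Y : Type*} [MeasurableSpace α] [NormedAddCommGroup Y] {μ : Measure α}
    {f : α → Y} {p : ℝ} (hf : MemLp f (ENNReal.ofReal (2 * p)) μ) :
    MemLp (fun z => ‖f z‖ ^ 2) (ENNReal.ofReal p) μ := by
  have := hf.norm_rpow_div 2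
  have e : ENNReal.ofReal (2 * p) / 2 = ENNReal.ofReal p := by
    rw [ENNReal.ofReal_mul (by norm_num), ENNReal.ofReal_ofNat, mul_comm,
      ENNReal.mul_div_cancel_right (by norm_num) (by norm_num)]
  rw [e] at this
  simpa using this

end Main

end PorousMedium

end

theorem proposition4p2 (N : ℕ) (m ν L p r : ℝ)
    (hm : 0 < m) (hmc : m ≤ ((N : ℝ) - 2) / ((N : ℝ) + 2))
    (hν : 0 < ν) (hL : 0 < L)
    (hp : ((N : ℝ) + 2) / 2 < p) (hr : 1 ≤ r) (hlam : 0 < PorousMedium.lam N m r) :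
    ∃ C : ℝ, 0 < C ∧
      ∀ (k : ℕ) (Ω : Set (PorousMedium.Space N)) (T : ℝ)
        (A : PorousMedium.SpaceTime N → PorousMedium.Space k →
          PorousMedium.GradSpace N k → PorousMedium.GradSpace N k)
        (F : PorousMedium.SpaceTime N → PorousMedium.GradSpace N k)
        (u : PorousMedium.SpaceTime N → PorousMedium.Space k),
        IsOpen Ω → Bornology.IsBounded Ω → 0 < T →
        PorousMedium.IsCaratheodory (PorousMedium.domain Ω T) A →
        PorousMedium.GrowthConditions m ν L (PorousMedium.domain Ω T) A →
        PorousMedium.MemLpLocOn F (ENNReal.ofReal (2 * p)) (PorousMedium.domain Ω T) →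
        PorousMedium.IsLocalWeakSolution m Ω T A F u →
        PorousMedium.LocallyBoundedOn u (PorousMedium.domain Ω T) →
        ∀ (z : PorousMedium.SpaceTime N) (ρ θ σ : ℝ), 0 < ρ → 0 < θ →
          closure (PorousMedium.cylinder z ρ θ) ⊆ PorousMedium.domain Ω T →
          σ ∈ Set.Ico (1 / 2 : ℝ) 1 →
          ∀ᵐ y ∂(volume.restrict (PorousMedium.cylinder z (σ * ρ) (σ * θ))),
            ‖u y‖ ≤
              max
                ((C / (1 - σ) ^ (N + 2) * (ρ ^ 2 / θ) ^ ((N : ℝ) / 2) *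
                    ⨍ w in PorousMedium.cylinder z ρ θ, ‖u w‖ ^ r) ^
                  (2 / PorousMedium.lam N m r))
                (max
                  (((θ / ρ ^ 2) ^ (p - (N : ℝ) / 2) *
                      ⨍ w in PorousMedium.cylinder z ρ θ, (ρ * ‖F w‖) ^ (2 * p)) ^
                    (2 / PorousMedium.lam N m (p * (1 + m))))
                  ((θ / ρ ^ 2) ^ (1 / (1 - m)))) := by
  -- For N ≤ 2 the upper bound on m would not be positive.
  have hN2 : (2 : ℝ) < N := by
    by_contra hcon
    have h1 : ((N : ℝ) - 2) / (N + 2) ≤ 0 :=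
      div_nonpos_of_nonpos_of_nonneg (by linarith) (by positivity)
    linarith
  have hN : 2 < N := by exact_mod_cast hN2
  have hN0 : (0 : ℝ) < N := by linarith
  have hmc' : m * (N + 2) ≤ N - 2 := (le_div_iff₀ (by linarith)).1 hmc
  have hm1 : m < 1 := by nlinarith
  have hlam' : 0 < N * (m - 1) + 2 * r := hlam
  have hp1 : 1 < p := by linarith
  have hp0 : 0 < p := by linarith
  -- Positivity of λ_r reads 2r > N(1-m), and m ≤ m_c reads N(1-m) ≥ 2(1+m).
  have hrm : 1 + m ≤ r := by nlinarith
  have hrm' : 1 + m ≤ p * (1 + m) := le_mul_of_one_le_left (by linarith) hp1.le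
  have hlamF : 0 < PorousMedium.lam N m (p * (1 + m)) := by
    have h1 : (N + 2) / 2 * (1 + m) < p * (1 + m) := by gcongr
    change 0 < N * (m - 1) + 2 * (p * (1 + m))
    nlinarith
  -- the exponent used in the iteration
  obtain ⟨q, hq⟩ : ∃ q, q = min r (p * (1 + m)) := ⟨_, rfl⟩
  -- The lower bound keeps the truncated powers nonsingular, the upper one admits Hölder's
  -- inequality for the source, and q ≤ r lets the average of |u|^r control the initial level
  -- integral.
  have hqm : 1 + m ≤ q := by rw [hq]; exact le_min hrm hrm'
  have hqp : q ≤ p * (1 + m) := by rw [hq]; exact min_le_right _ _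
  have hqr : q ≤ r := by rw [hq]; exact min_le_left _ _
  have hlamq : 0 < N * (m - 1) + 2 * q := by
    rcases min_choice r (p * (1 + m)) with h | h
    · rw [hq, h]; exact hlam'
    · rw [hq, h]; exact hlamF
  have hlamq' : 0 ≤ m - 1 + 2 * q / N := by
    have : m - 1 + 2 * q / N = (N * (m - 1) + 2 * q) / N := by field_simp
    rw [this]
    positivity
  have hβ := PorousMedium.unitBallVolume_pos N
  obtain ⟨β, hβdef⟩ : ∃ β, β = PorousMedium.unitBallVolume N := ⟨_, rfl⟩
  rw [← hβdef] at hβ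
  obtain ⟨ε, hε0, hε⟩ := PorousMedium.exists_sup_bound (β := β ^ (1 / p)) hN hm hm1.le hqm hν hL hp
    hqp hlamq' (by positivity)
  obtain ⟨c, hc⟩ : ∃ c : ℝ, c = (1 / 2) ^ (1 / (2 * m)) := ⟨_, rfl⟩
  have hc0 : 0 < c := by rw [hc]; positivity
  have hc2 : c ^ (2 * m) = 1 / 2 := by
    rw [hc, ← Real.rpow_mul (by norm_num), one_div_mul_cancel (by positivity), Real.rpow_one]
  -- The factor c^{q-r} comes from comparing the powers q and r above level cκ, β from the volume of
  -- the cylinder, and ε is the smallness threshold of the iteration.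
  refine ⟨c ^ (q - r) * β / ε, by positivity, ?_⟩
  obtain ⟨C, hC⟩ : ∃ C, C = c ^ (q - r) * β / ε := ⟨_, rfl⟩
  have hC0 : 0 < C := by rw [hC]; positivity
  rw [← hC]
  intro d Ω T A F u hΩ _ hT hA hg hF hu hub z ρ θ σ hρ hθ hcl hσ
  obtain ⟨κ, hκ⟩ : ∃ κ, κ = max
                ((C / (1 - σ) ^ (N + 2) * (ρ ^ 2 / θ) ^ ((N : ℝ) / 2) *
                    ⨍ w in PorousMedium.cylinder z ρ θ, ‖u w‖ ^ r) ^
                  (2 / PorousMedium.lam N m r))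
                (max
                  (((θ / ρ ^ 2) ^ (p - (N : ℝ) / 2) *
                      ⨍ w in PorousMedium.cylinder z ρ θ, (ρ * ‖F w‖) ^ (2 * p)) ^
                    (2 / PorousMedium.lam N m (p * (1 + m))))
                  ((θ / ρ ^ 2) ^ (1 / (1 - m)))) := ⟨_, rfl⟩
  rw [← hκ]
  have hκ1 := (le_max_left _ _).trans_eq hκ.symm
  have hκ2 := ((le_max_left _ _).trans (le_max_right _ _)).trans_eq hκ.symm
  have hκ3 := ((le_max_right _ _).trans (le_max_right _ _)).trans_eq hκ.symm
  have hκ0 : 0 < κ := lt_of_lt_of_le (by positivity) hκ3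
  have hσ0 : 0 < σ := lt_of_lt_of_le (by norm_num) hσ.1
  have hσ1 : 0 < 1 - σ := by linarith [hσ.2]
  have hQ := hcl
  rw [PorousMedium.closure_cylinder z hρ hθ] at hQ
  have hcyl : PorousMedium.cylinder z ρ θ ⊆ PorousMedium.domain Ω T := subset_closure.trans hcl
  have hcompact : IsCompact (Metric.closedBall z.1 ρ ×ˢ Icc (z.2 - θ) z.2) :=
    (isCompact_closedBall _ _).prod isCompact_Icc
  have hsub : PorousMedium.cylinder z ρ θ ⊆ Metric.closedBall z.1 ρ ×ˢ Icc (z.2 - θ) z.2 :=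
    prod_mono Metric.ball_subset_closedBall Ioc_subset_Icc_self
  have hfin : IsFiniteMeasure (volume.restrict (PorousMedium.cylinder z ρ θ)) := ⟨by
    rw [Measure.restrict_apply_univ]
    exact (measure_mono hsub).trans_lt hcompact.measure_lt_top⟩
  have hum := hu.aestronglyMeasurable_cylinder hcyl
  obtain ⟨M, hM⟩ := hub _ hQ hcompact
  have hMc := ae_restrict_of_ae_restrict_of_subset hsub hM
  have hFp := (hF _ hQ hcompact).mono_measure (Measure.restrict_mono hsub le_rfl)
  have hint : ∀ s : ℝ, 0 ≤ s → IntegrableOn (fun w => ‖u w‖ ^ s) (PorousMedium.cylinder z ρ θ) := by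
    intro s hs
    refine Integrable.of_bound (C := M ^ s)
      (hum.norm.aemeasurable.pow_const s).aestronglyMeasurable ?_
    filter_upwards [hMc] with w hw
    rw [Real.norm_of_nonneg (by positivity)]
    exact Real.rpow_le_rpow (norm_nonneg _) hw hs
  have hlev : IntegrableOn (fun w => PorousMedium.levelPow m (κ ^ (2 * m) / 2) q (u w))
      (PorousMedium.cylinder z ρ θ) := by
    refine Integrable.mono (hint q (by linarith))
      (PorousMedium.measurable_levelPow.comp_aemeasurable hum.aemeasurable).aestronglyMeasurable
      (ae_of_all _ fun w => ?_)
    rw [Real.norm_of_nonneg (PorousMedium.levelPow_nonneg _), Real.norm_of_nonneg (by positivity),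
      PorousMedium.levelPow]
    split_ifs
    · exact le_rfl
    · positivity
  have havg : ∀ f : PorousMedium.SpaceTime N → ℝ, ⨍ w in PorousMedium.cylinder z ρ θ, f w =
      (β * ρ ^ N * θ)⁻¹ * ∫ w in PorousMedium.cylinder z ρ θ, f w := fun f => by
    rw [setAverage_eq, PorousMedium.volume_real_cylinder z hρ hθ, hβdef, smul_eq_mul]
  have hIu : 0 ≤ ∫ w in PorousMedium.cylinder z ρ θ, ‖u w‖ ^ r :=
    integral_nonneg fun w => by positivity
  have hIF : 0 ≤ ∫ w in PorousMedium.cylinder z ρ θ, (‖F w‖ ^ 2) ^ p :=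
    integral_nonneg fun w => by positivity
  have hFeq : ∫ w in PorousMedium.cylinder z ρ θ, (ρ * ‖F w‖) ^ (2 * p) =
      ρ ^ (2 * p) * ∫ w in PorousMedium.cylinder z ρ θ, (‖F w‖ ^ 2) ^ p := by
    rw [← integral_const_mul]
    refine integral_congr_ae (ae_of_all _ fun w => ?_)
    change (ρ * ‖F w‖) ^ (2 * p) = ρ ^ (2 * p) * (‖F w‖ ^ 2) ^ p
    rw [Real.mul_rpow hρ.le (norm_nonneg _), Real.rpow_mul (norm_nonneg _), Real.rpow_two]
  rw [havg] at hκ1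
  rw [havg, hFeq] at hκ2
  have b1 := PorousMedium.mul_le_of_scaled_average_le hσ1 hβ hρ hθ
    (PorousMedium.le_rpow_of_rpow_le (by positivity) hlam hκ1)
  have b2 := PorousMedium.le_of_scaled_source_average_le hβ hρ hθ
    (PorousMedium.le_rpow_of_rpow_le (by positivity) hlamF hκ2)
  refine hε d z.1 ρ θ σ z.2 κ u (fun w => ‖F w‖ ^ 2) hρ hθ hσ0 hσ.2 hκ0
    (hu.isBackwardSolution hm hA hg hub hQ hρ.le hθ.le) hum (PorousMedium.memLp_norm_sq hFp)
    (fun w => sq_nonneg _) hlev ?_ ?_ ?_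
  -- The third entry of the maximum gives the comparison of θ κ^{m-1} with ρ².
  · have h1 : θ / ρ ^ 2 ≤ κ ^ (1 - m) := by
      calc θ / ρ ^ 2 = ((θ / ρ ^ 2) ^ (1 / (1 - m))) ^ (1 - m) := by
            rw [← Real.rpow_mul (by positivity), one_div_mul_cancel (by linarith), Real.rpow_one]
        _ ≤ κ ^ (1 - m) := Real.rpow_le_rpow (by positivity) hκ3 (by linarith)
    rw [show m - 1 = -(1 - m) by ring, Real.rpow_neg hκ0.le, ← div_eq_mul_inv,
      div_le_iff₀ (by positivity)]
    rwa [div_le_iff₀ (by positivity), mul_comm] at h1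
  -- The second entry of the maximum bounds the source; its exponent is the one for which the powers
  -- of κ match.
  · calc _ ≤ (β * (κ ^ (PorousMedium.lam N m (p * (1 + m)) / 2) *
          θ ^ (-p + ((N : ℝ) + 2) / 2))) ^ (1 / p) := Real.rpow_le_rpow hIF b2 (by positivity)
      _ = _ := by
          rw [Real.mul_rpow hβ.le (by positivity), Real.mul_rpow (by positivity) (by positivity),
            ← Real.rpow_mul hκ0.le, ← Real.rpow_mul hθ.le]
          congr 3
          · rw [PorousMedium.lam]; field_simp; ring
          · field_simp
  -- The first entry of the maximum gives smallness of the initial level integral. On the lowest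
  -- superlevel set |u| > cκ, so the power q is controlled by the power r.
  · have hpt : ∀ w, PorousMedium.levelPow m (κ ^ (2 * m) / 2) q (u w) ≤
        (c * κ) ^ (q - r) * ‖u w‖ ^ r := by
      intro w
      have h1 := PorousMedium.levelPow_le_mul_levelPow (a := c * κ) hm (by positivity) hqr (u w)
      rw [Real.mul_rpow hc0.le hκ0.le, hc2, one_div, inv_mul_eq_div] at h1
      refine h1.trans ?_
      gcongr
      rw [PorousMedium.levelPow]
      split_ifs
      · exact le_rfl
      · positivity
    have hεC : c ^ (q - r) * β = ε * C := by rw [hC]; field_simp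
    have hexp : κ ^ (q - r) * κ ^ (PorousMedium.lam N m r / 2) = κ ^ (N * (m - 1) / 2 + q) := by
      rw [← Real.rpow_add hκ0]
      congr 1
      rw [PorousMedium.lam]
      ring
    refine le_of_mul_le_mul_left ?_ hC0
    calc _ ≤ C * ∫ w in PorousMedium.cylinder z ρ θ, (c * κ) ^ (q - r) * ‖u w‖ ^ r := by
          refine mul_le_mul_of_nonneg_left ?_ hC0.le
          exact integral_mono hlev ((hint r (by linarith)).const_mul _) hpt
      _ = c ^ (q - r) * κ ^ (q - r) * (C * ∫ w in PorousMedium.cylinder z ρ θ, ‖u w‖ ^ r) := by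
          rw [integral_const_mul, Real.mul_rpow hc0.le hκ0.le]; ring
      _ ≤ c ^ (q - r) * κ ^ (q - r) * ((1 - σ) ^ (N + 2) * β *
          (κ ^ (PorousMedium.lam N m r / 2) * θ ^ (((N : ℝ) + 2) / 2))) := by gcongr
      _ = (c ^ (q - r) * β) * ((1 - σ) ^ (N + 2) *
          ((κ ^ (q - r) * κ ^ (PorousMedium.lam N m r / 2)) * θ ^ (((N : ℝ) + 2) / 2))) := by ring
      _ = _ := by rw [hεC, hexp]; ring
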